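/- **Setting.** Let $\mathcal K$ be the skew field over $\mathbb C$ generated by $x,y,q,p,t,d$ and central parameters $\alpha_0,\alpha_1,\alpha_2,\alpha_3,\epsilon_1,\epsilon_2$, subject to $[y,x]=\epsilon_1$, $[p,q]=\epsilon_2$, $[d,t]=1$, all other commutators being zero, and to the single relation $\alpha_0+\alpha_1+\alpha_2+\alpha_3=-\epsilon_1+\epsilon_2$ (the parameters are otherwise algebraically independent; $\mathcal K$ is the skew field of fractions of the corresponding Weyl algebra over the field of rational functions in the parameters). Put $\kappa=\epsilon_1-\epsilon_2$. For $a=(a_0,a_1,a_2,a_3)$ with entries in the field of parameters let $$H^x(a)=(x-1)(y+t)xy-(a_1+a_3-\epsilon_1)xy+a_1y+(a_2+\epsilon_1)tx,$$ let $H^q(a)$ be obtained by replacing $x,y,\epsilon_1$ by $q,p,\epsilon_2$, and let $$L_V(a)=H^x(a)-H^q(a_0+\kappa,a_1,a_2+\kappa,a_3)-\kappa\,(x-q)^{-1}\bigl(x(x-1)y-q(q-1)p\bigr),$$ $$B_V(a)=\epsilon_2H^x(a)-\epsilon_1H^q(a_0+\kappa,a_1,a_2+\kappa,a_3)-\kappa\epsilon_1\epsilon_2\,t\,d,$$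 $$D(\alpha_2)=yp+(\alpha_2+\epsilon_1)(x-q)^{-1}y+(\alpha_2+\epsilon_1)(q-x)^{-1}p .$$ Automorphisms of the field of parameters ($\epsilon_1,\epsilon_2$ fixed, indices mod $4$): $s_i:\alpha_i\mapsto-\alpha_i,\ \alpha_{i\pm1}\mapsto\alpha_{i\pm1}+\alpha_i,\ \alpha_{i+2}\mapsto\alpha_{i+2}$; $\pi:\alpha_j\mapsto\alpha_{j+1}$; $\sigma:\alpha_j\mapsto\alpha_{2-j}$. For a word $w$ write $w(\alpha)=(w(\alpha_0),\dots,w(\alpha_3))$; products are compositions, the rightmost factor being applied first. Automorphisms of $\mathcal K$ fixing all parameters (generators not mentioned are fixed): $\mathcal L_x:x\mapsto-y,\ y\mapsto x$; $\mathrm{Ad}((x-c)^{\beta/\epsilon_1}):y\mapsto y-\beta(x-c)^{-1}$; $\mathrm{Ad}(e^{xt/\epsilon_1}):y\mapsto y-t,\ d\mapsto d-x/\epsilon_1$; $(x\mapsto t(x-1)):x\mapsto t(x-1),\ y\mapsto t^{-1}y,\ d\mapsto d-\epsilon_1^{-1}t^{-1}(x-1)y$; $(t\mapsto-t):t\mapsto-t,\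 d\mapsto-d$. For a parameter $b$, $$R^x_{s_1}(b)=\mathrm{Ad}(x^{-b/\epsilon_1}),\quad R^x_{s_3}(b)=\mathrm{Ad}((x-1)^{-b/\epsilon_1}),\quad R^x_{s_2}(b)=\mathcal L_x^{-1}\,\mathrm{Ad}(x^{-b/\epsilon_1})\,\mathcal L_x,\quad R^x_\pi=(x\mapsto t(x-1))\,\mathcal L_x,$$ and $R^q_{s_i}(b),R^q_\pi$ and the corresponding substitutions are obtained by replacing $x,y,\epsilon_1$ by $q,p,\epsilon_2$. Put $\bar\alpha_i=\alpha_i+\alpha_2+\kappa$ ($i=1,3$) and $$R_{s_i}=R^x_{s_i}(\alpha_i)R^q_{s_i}(\alpha_i)\ (i=1,3),\qquad R_\sigma=(t\mapsto-t)\,\mathrm{Ad}(e^{xt/\epsilon_1})\,\mathrm{Ad}(e^{qt/\epsilon_2}),\qquad R_\pi=R^x_\pi R^q_\pi,$$ $$T_{\sigma s_1s_3s_2}=R^x_{s_2}(-\alpha_2-\kappa)R^x_{s_1}(\alpha_1)R^x_{s_3}(\alpha_3)R_\sigma R^q_{s_1}(\bar\alpha_1)R^q_{s_3}(\bar\alpha_3)R^q_{s_2}(\alpha_2+\kappa),$$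 $$T_{s_1s_2s_3\pi^{-1}}=R^x_\pi R^x_{s_3}(s_1s_2(\alpha_3))R^x_{s_2}(s_1(\alpha_2))R^x_{s_1}(\alpha_1)\,Q,$$ $$Q=R^q_{s_1}(-\alpha_1+\kappa)R^q_{s_2}(-s_1(\alpha_2))R^q_{s_3}(-s_1s_2(\alpha_3))(R^q_\pi)^{-1},$$ $$S=\mathrm{Ad}(D(\alpha_2)^{-1})\,R^x_{s_2}(\alpha_2)R^q_{s_2}(\alpha_2+\kappa),$$ where $\mathrm{Ad}(u)(z)=uzu^{-1}$. **Theorem.** 1. For $s\in\{s_1,s_3,\sigma\}$: $R_s(L_V(\alpha))=L_V(s(\alpha))$ and $R_s(B_V(\alpha))=B_V(s(\alpha))+f_s$, where $f_{s_1}=\kappa\alpha_1(\alpha_3+t)$, $f_{s_3}=\kappa\alpha_1\alpha_3$, $f_\sigma=-\kappa\alpha_1t$. 2. $R_\pi^2((x-q)L_V(\alpha))=(q-x)L_V(\pi^2(\alpha))$ and $R_\pi^2(B_V(\alpha))=B_V(\pi^2(\alpha))-\kappa(\alpha_2+\alpha_3-\epsilon_2)t-2\kappa\epsilon_1\epsilon_2$.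 Moreover, for $R'=R^x_\pi(R^q_\pi)^{-1}$: $R'^2((x-q)L_V(\alpha))=(q-x)L_V(\pi^2(\alpha))$ and $R'^2(B_V(\alpha))=B_V(\pi^2(\alpha))-\kappa(\alpha_2+\alpha_3+\kappa)t$. 3. Let $r=\sigma s_1s_3s_2$ and $P=p+t+\bar\alpha_1q^{-1}+\bar\alpha_3(q-1)^{-1}$. Then $l\,T_r((x-q)L_V(\alpha))=(x-q)L_V(r(\alpha))$ with $$l=\bigl((x-q)yP+(\alpha_2+\kappa)(y+P)\bigr)^{-1}(x-q)Py,$$ and moreover $$((x-q)p-\alpha_2-\kappa)\,y\,R^x_{s_2}(-\alpha_2-\kappa)R^x_{s_1}(\alpha_1)R^x_{s_3}(\alpha_3)\mathrm{Ad}(e^{xt/\epsilon_1})\bigl((x-q)L_V(\alpha)\bigr)$$ $$=((x-q)y+\alpha_2+\kappa)\,p\,R^q_{s_2}(-\alpha_2-\kappa)R^q_{s_1}(-\bar\alpha_1)R^q_{s_3}(-\bar\alpha_3)(t\mapsto-t)\mathrm{Ad}(e^{qt/\epsilon_2})\bigl((x-q)L_V(r(\alpha))\bigr),$$ and $T_r(B_V(\alpha))=B_V(r(\alpha))+\kappa(\alpha_2+\kappa)(\alpha_0+t)$.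 4. Let $r=s_1s_2s_3\pi^{-1}$. There are elements $a_{i,j},b_{i,j}$ of the field of rational functions of $x,q,t$ and the parameters such that, with $$A=a_{0,3}p^3-\tfrac{q-1}{x-1}yp^2+a_{0,2}p^2+\tfrac{\alpha_3-\epsilon_2+t(1-q)(1+x)}{x-1}yp+a_{1,0}y+a_{0,1}p+a_{0,0},$$ $$B=y^3+b_{2,1}y^2p+b_{2,0}y^2+b_{1,1}yp+b_{1,0}y+b_{0,1}p+b_{0,0},$$ one has $$A\,R^x_\pi\Bigl((x-1)R^x_{s_3}(s_1s_2(\alpha_3))\bigl(y\,R^x_{s_2}(s_1(\alpha_2))R^x_{s_1}(\alpha_1)((x-q)L_V(\alpha))\bigr)\Bigr)$$ $$=B\,R^q_\pi\Bigl((q-1)R^q_{s_3}(s_1s_2(\alpha_3))\bigl(p\,R^q_{s_2}(s_1(\alpha_2))R^q_{s_1}(\alpha_1-\kappa)((x-q)L_V(r(\alpha)))\bigr)\Bigr),$$ and $l\,T_r((x-q)L_V(\alpha))=(x-q)L_V(r(\alpha))$ with $$l=Q\Bigl(B\,R^q_\pi\bigl((q-1)R^q_{s_3}(s_1s_2(\alpha_3))(p)\bigr)\Bigr)^{-1}\,Q\Bigl(A\,R^x_\pi\bigl((x-1)R^x_{s_3}(s_1s_2(\alpha_3))(y)\bigr)\Bigr).$$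 Moreover $T_r(B_V(\alpha))=B_V(r(\alpha))$. 5. Let $\tilde\alpha=(\alpha_0,\ \alpha_1+\alpha_2+\epsilon_1,\ -\alpha_2-2\epsilon_1,\ \alpha_3+\alpha_2+\epsilon_1)$. Then $$yp\,\bigl(R^x_{s_2}(\alpha_2)R^q_{s_2}(\alpha_2+\kappa)((x-q)L_V(\alpha))\bigr)D(\alpha_2)$$ $$=\bigl((x-q)yp+(\alpha_2+\kappa-\epsilon_2)y+(\epsilon_1-\alpha_2)p\bigr)\bigl(D(\alpha_2)-(\alpha_2+\epsilon_1)(\epsilon_1+\epsilon_2)(x-q)^{-2}\bigr)L_V(\tilde\alpha),$$ $$S\bigl(B_V(\alpha)+f_S\bigr)=B_V(\tilde\alpha)-D(\alpha_2)^{-1}\,2(\alpha_2+\epsilon_1)\epsilon_1\epsilon_2\,(x-q)^{-2}L_V(\tilde\alpha),$$ where $f_S=\kappa(\alpha_2+\epsilon_1)(\alpha_1+\alpha_2+\alpha_3+\epsilon_1+t)$. -/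

import Mathlib

set_option linter.unusedSectionVars false

open MvPolynomial

noncomputable section
namespace QW

universe u
variable (F : Type u) [Field F] (eps : Fin 3 → F)

/-- The free algebra on the position generators `inl i` and the momentum generators `inr i`. -/
abbrev Free := FreeAlgebra F (Fin 3 ⊕ Fin 3)

/-- The canonical commutation relations `[x_i, x_j] = 0`, `[y_i, y_j] = 0`, `[y_i, x_j] = δ_ij eps i`. -/
inductive Rel : Free F → Free F → Prop
  | pos (i j : Fin 3) : Rel (FreeAlgebra.ι F (Sum.inl i) * FreeAlgebra.ι F (Sum.inl j))
      (FreeAlgebra.ι F (Sum.inl j) * FreeAlgebra.ι F (Sum.inl i))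
  | mom (i j : Fin 3) : Rel (FreeAlgebra.ι F (Sum.inr i) * FreeAlgebra.ι F (Sum.inr j))
      (FreeAlgebra.ι F (Sum.inr j) * FreeAlgebra.ι F (Sum.inr i))
  | cross (i j : Fin 3) : Rel (FreeAlgebra.ι F (Sum.inr i) * FreeAlgebra.ι F (Sum.inl j))
      (FreeAlgebra.ι F (Sum.inl j) * FreeAlgebra.ι F (Sum.inr i) +
        algebraMap F (Free F) (if i = j then eps i else 0))

/-- The Weyl algebra over `F` with three pairs of canonical generators. -/
def Weyl : Type u := RingQuot (Rel F eps)

instance : Ring (Weyl F eps) := inferInstanceAs (Ring (RingQuot (Rel F eps)))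
instance : Algebra F (Weyl F eps) := inferInstanceAs (Algebra F (RingQuot (Rel F eps)))

namespace Weyl
variable {F}

def mk : Free F →ₐ[F] Weyl F eps := RingQuot.mkAlgHom F (Rel F eps)

def gen (g : Fin 3 ⊕ Fin 3) : Weyl F eps := mk eps (FreeAlgebra.ι F g)

theorem mk_rel {a b : Free F} (h : Rel F eps a b) : mk eps a = mk eps b :=
  RingQuot.mkAlgHom_rel F h

/-- Elements `X i`, `Y i` of an algebra that satisfy the canonical commutation relations. -/
structure Canon {R : Type*} [Ring R] [Algebra F R] (X Y : Fin 3 → R) : Prop where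
  pos : ∀ i j, X i * X j = X j * X i
  mom : ∀ i j, Y i * Y j = Y j * Y i
  cross : ∀ i j, Y i * X j = X j * Y i + algebraMap F R (if i = j then eps i else 0)

theorem canon_gen : Canon eps (fun i => gen eps (Sum.inl i)) (fun i => gen eps (Sum.inr i)) where
  pos i j := by simpa only [gen, map_mul] using mk_rel eps (Rel.pos i j)
  mom i j := by simpa only [gen, map_mul] using mk_rel eps (Rel.mom i j)
  cross i j := by
    simpa only [gen, map_mul, map_add, AlgHom.commutes] using mk_rel eps (Rel.cross i j)

variable {eps}

/-- The algebra map out of the Weyl algebra given by elements with the canonical relations. -/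
def lift {R : Type*} [Ring R] [Algebra F R] {X Y : Fin 3 → R} (h : Canon eps X Y) :
    Weyl F eps →ₐ[F] R :=
  RingQuot.liftAlgHom F ⟨FreeAlgebra.lift F (Sum.elim X Y), by
    intro a b hab
    cases hab with
    | pos i j => simpa using h.pos i j
    | mom i j => simpa using h.mom i j
    | cross i j =>
      simp only [map_mul, map_add, FreeAlgebra.lift_ι_apply, Sum.elim_inl, Sum.elim_inr,
        AlgHom.commutes]
      exact h.cross i j⟩

@[simp] theorem lift_gen {R : Type*} [Ring R] [Algebra F R] {X Y : Fin 3 → R}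
    (h : Canon eps X Y) (g : Fin 3 ⊕ Fin 3) : lift h (gen eps g) = Sum.elim X Y g := by
  unfold lift gen mk
  erw [RingQuot.liftAlgHom_mkAlgHom_apply]
  simp

theorem hom_ext {R : Type*} [Ring R] [Algebra F R] {f g : Weyl F eps →ₐ[F] R}
    (h : ∀ a, f (gen eps a) = g (gen eps a)) : f = g := by
  apply RingQuot.ringQuot_ext'
  apply FreeAlgebra.hom_ext
  funext a
  exact h a

theorem left_induction {p : Weyl F eps → Prop} (one : p 1)
    (smul : ∀ (c : F) a, p a → p (c • a)) (add : ∀ a b, p a → p b → p (a + b))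
    (mul : ∀ g a, p a → p (gen eps g * a)) (a : Weyl F eps) : p a := by
  have key : ∀ a : Free F, ∀ b : Weyl F eps, p b → p (mk eps a * b) := by
    intro a
    induction a using FreeAlgebra.induction with
    | grade0 r =>
      intro b hb
      rw [AlgHom.commutes, ← Algebra.smul_def]; exact smul _ _ hb
    | grade1 g => intro b hb; exact mul g b hb
    | mul a b ha hb =>
      intro c hc
      rw [map_mul, mul_assoc]; exact ha _ (hb _ hc)
    | add a b ha hb =>
      intro c hc
      rw [map_add, add_mul]; exact add _ _ (ha _ hc) (hb _ hc)
  obtain ⟨a', rfl⟩ : ∃ a', mk eps a' = a := RingQuot.mkAlgHom_surjective F (Rel F eps) a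
  have := key a' 1 one
  rwa [mul_one] at this

/-! ### Action on polynomials, and the normally ordered basis -/
abbrev Sym (F : Type u) [Field F] := MvPolynomial (Fin 3 ⊕ Fin 3) F

variable (eps) in
def der (i : Fin 3) : Derivation F (Sym F) (Sym F) := eps i • pderiv (Sum.inl i)

variable (eps) in
def opX (i : Fin 3) : Module.End F (Sym F) := LinearMap.mulLeft F (X (Sum.inl i))
variable (eps) in
def opY (i : Fin 3) : Module.End F (Sym F) :=
  LinearMap.mulLeft F (X (Sum.inr i)) + (der eps i).toLinearMap

theorem der_comm (i j : Fin 3) (f : Sym F) : der eps i (der eps j f) = der eps j (der eps i f) := by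
  have h : ⁅der eps i, der eps j⁆ = 0 := by
    apply MvPolynomial.derivation_ext
    intro k
    simp only [Derivation.commutator_apply, der, Derivation.smul_apply, pderiv_X]
    cases k <;> simp [Pi.single_apply]
    all_goals split_ifs <;> simp
  have := congrArg (fun D : Derivation F (Sym F) (Sym F) => D f) h
  simpa [Derivation.commutator_apply, sub_eq_zero] using this

theorem der_X_inl (i j : Fin 3) : der eps i (X (Sum.inl j)) = C (if i = j then eps i else 0) := by
  simp [der, pderiv_X, Pi.single_apply, smul_eq_C_mul]
  split_ifs with h h' <;> simp_all
theorem der_X_inr (i j : Fin 3) : der eps i (X (Sum.inr j)) = 0 := by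
  simp [der, pderiv_X]

theorem canon_op : Canon eps (opX : Fin 3 → Module.End F (Sym F)) (opY eps) where
  pos i j := by
    refine LinearMap.ext fun f => ?_
    simp only [opX, Module.End.mul_apply, LinearMap.mulLeft_apply]
    ring
  mom i j := by
    refine LinearMap.ext fun f => ?_
    simp only [opY, Module.End.mul_apply, LinearMap.add_apply, LinearMap.mulLeft_apply,
      Derivation.coeFn_coe, map_add, Derivation.leibniz, der_X_inr, der_comm i j, smul_eq_mul]
    ring
  cross i j := by
    refine LinearMap.ext fun f => ?_
    simp only [opX, opY, Module.End.mul_apply, LinearMap.add_apply, LinearMap.mulLeft_apply,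
      Derivation.coeFn_coe, Derivation.leibniz, der_X_inl, smul_eq_mul, Module.algebraMap_end_apply,
      smul_eq_C_mul]
    ring

def rep : Weyl F eps →ₐ[F] Module.End F (Sym F) := lift canon_op

theorem rep_inl (i : Fin 3) (f : Sym F) :
    rep (gen eps (Sum.inl i)) f = X (Sum.inl i) * f := by simp [rep, opX]
theorem rep_inr (i : Fin 3) (f : Sym F) :
    rep (gen eps (Sum.inr i)) f = X (Sum.inr i) * f + der eps i f := by simp [rep, opY]

variable (eps) in
/-- The normally ordered monomials. -/
def nmon (m : Fin 3 ⊕ Fin 3 →₀ ℕ) : Weyl F eps :=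
  gen eps (Sum.inl 0) ^ m (Sum.inl 0) * gen eps (Sum.inl 1) ^ m (Sum.inl 1) *
    gen eps (Sum.inl 2) ^ m (Sum.inl 2) * (gen eps (Sum.inr 0) ^ m (Sum.inr 0) *
    gen eps (Sum.inr 1) ^ m (Sum.inr 1) * gen eps (Sum.inr 2) ^ m (Sum.inr 2))

variable (eps) in
def nord : Sym F →ₗ[F] Weyl F eps := (basisMonomials (Fin 3 ⊕ Fin 3) F).constr F (nmon eps)

theorem nord_monomial (m : Fin 3 ⊕ Fin 3 →₀ ℕ) (c : F) :
    nord eps (monomial m c) = c • nmon eps m := by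
  have : (monomial m c : Sym F) = c • basisMonomials (Fin 3 ⊕ Fin 3) F m := by
    simp [coe_basisMonomials, smul_monomial]
  rw [this, map_smul, nord, Module.Basis.constr_basis]

theorem cross_pow (i : Fin 3) (n : ℕ) :
    gen eps (Sum.inr i) * gen eps (Sum.inl i) ^ n =
      gen eps (Sum.inl i) ^ n * gen eps (Sum.inr i) +
        (n * eps i) • gen eps (Sum.inl i) ^ (n - 1) := by
  induction n with
  | zero => simp
  | succ n ih =>
    rw [pow_succ, ← mul_assoc, ih, add_mul, mul_assoc, (canon_gen eps).cross i i]
    simp only [if_true, mul_add, Algebra.algebraMap_eq_smul_one, mul_smul_comm, mul_one,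
      smul_mul_assoc, Nat.add_sub_cancel, mul_assoc, add_assoc]
    congr 1
    rcases n with _ | n
    · simp
    · rw [Nat.add_sub_cancel, ← pow_succ, ← add_smul]; congr 1; push_cast; ring

theorem pos_comm (i j : Fin 3) (n : ℕ) : gen eps (Sum.inl i) * gen eps (Sum.inl j) ^ n =
      gen eps (Sum.inl j) ^ n * gen eps (Sum.inl i) :=
  (Commute.pow_right ((canon_gen eps).pos i j) n)
theorem mom_comm (i j : Fin 3) (n : ℕ) : gen eps (Sum.inr i) * gen eps (Sum.inr j) ^ n =
      gen eps (Sum.inr j) ^ n * gen eps (Sum.inr i) :=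
  (Commute.pow_right ((canon_gen eps).mom i j) n)
theorem cross_comm (i j : Fin 3) (h : i ≠ j) (n : ℕ) :
    gen eps (Sum.inr i) * gen eps (Sum.inl j) ^ n =
      gen eps (Sum.inl j) ^ n * gen eps (Sum.inr i) :=
  by
  have h1 : Commute (gen eps (Sum.inr i)) (gen eps (Sum.inl j)) := by
    have := (canon_gen eps).cross i j
    rwa [if_neg h, map_zero, add_zero] at this
  exact h1.pow_right n

theorem nmon_inl (i : Fin 3) (m : Fin 3 ⊕ Fin 3 →₀ ℕ) :
    gen eps (Sum.inl i) * nmon eps m = nmon eps (Finsupp.single (Sum.inl i) 1 + m) := by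
  unfold nmon
  fin_cases i
  · simp [pow_add, mul_assoc]
  · simp [pow_add, mul_assoc]
    rw [← mul_assoc, pos_comm, mul_assoc]
  · simp [pow_add, mul_assoc]
    rw [← mul_assoc, pos_comm, mul_assoc, ← mul_assoc (gen eps (Sum.inl 2)), pos_comm, mul_assoc]

theorem nmon_inr (i : Fin 3) (m : Fin 3 ⊕ Fin 3 →₀ ℕ) :
    gen eps (Sum.inr i) * nmon eps m = nmon eps (Finsupp.single (Sum.inr i) 1 + m) +
      (m (Sum.inl i) * eps i) • nmon eps (m - Finsupp.single (Sum.inl i) 1) := by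
  unfold nmon
  set x := fun i => gen eps (Sum.inl i) with hx
  set y := fun i => gen eps (Sum.inr i) with hy
  have e1 : ∀ (i : Fin 3) (n : ℕ), y i * x i ^ n = x i ^ n * y i + (n * eps i) • x i ^ (n - 1) := cross_pow
  have e2 : ∀ (i j : Fin 3) (n : ℕ), i ≠ j → y i * x j ^ n = x j ^ n * y i :=
    fun i j n h => cross_comm i j h n
  have e3 : ∀ (i j : Fin 3) n, y i * y j ^ n = y j ^ n * y i := mom_comm
  have e2' : ∀ (i j : Fin 3) n z, i ≠ j → y i * (x j ^ n * z) = x j ^ n * (y i * z) :=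
    fun i j n z h => by rw [← mul_assoc, e2 i j n h, mul_assoc]
  have e3' : ∀ (i j : Fin 3) n z, y i * (y j ^ n * z) = y j ^ n * (y i * z) :=
    fun i j n z => by rw [← mul_assoc, e3, mul_assoc]
  have e1' : ∀ (i : Fin 3) (n : ℕ) z, y i * (x i ^ n * z) = x i ^ n * (y i * z) +
      (n * eps i) • (x i ^ (n - 1) * z) :=
    fun i n z => by rw [← mul_assoc, e1, add_mul, mul_assoc, smul_mul_assoc]
  change y i * (x 0 ^ _ * x 1 ^ _ * x 2 ^ _ * (y 0 ^ _ * y 1 ^ _ * y 2 ^ _)) =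
    (x 0 ^ _ * x 1 ^ _ * x 2 ^ _ * (y 0 ^ _ * y 1 ^ _ * y 2 ^ _)) + _ •
     (x 0 ^ _ * x 1 ^ _ * x 2 ^ _ * (y 0 ^ _ * y 1 ^ _ * y 2 ^ _))
  clear_value x y
  fin_cases i
  · simp [pow_add, mul_assoc]
    rw [e1', e2' 0 1 _ _ (by decide), e2' 0 2 _ _ (by decide)]
  · simp [pow_add, mul_assoc]
    rw [e2' 1 0 _ _ (by decide), e1', e2' 1 2 _ _ (by decide), e3', mul_add, mul_smul_comm]
  · simp [pow_add, mul_assoc]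
    rw [e2' 2 0 _ _ (by decide), e2' 2 1 _ _ (by decide), e1', e3', e3', mul_add, mul_add,
      mul_smul_comm, mul_smul_comm]

theorem nord_gen (g : Fin 3 ⊕ Fin 3) (f : Sym F) :
    nord eps (rep (gen eps g) f) = gen eps g * nord eps f := by
  induction f using MvPolynomial.induction_on' with
  | add p q hp hq => simp only [map_add, mul_add, hp, hq]
  | monomial m c =>
    rcases g with i | i
    · rw [rep_inl, X, monomial_mul, one_mul, nord_monomial, nord_monomial, mul_smul_comm, nmon_inl]
    · rw [rep_inr, X, monomial_mul, one_mul, map_add, nord_monomial, nord_monomial, mul_smul_comm,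
        nmon_inr, der, Derivation.smul_apply, pderiv_monomial, map_smul, nord_monomial, smul_add,
        smul_smul, smul_smul]
      congr 2; ring

theorem nord_rep (a : Weyl F eps) (f : Sym F) : nord eps (rep a f) = a * nord eps f := by
  induction a using left_induction generalizing f with
  | one => simp
  | smul c a ih => simp [ih]
  | add a b iha ihb => simp [iha, ihb, add_mul]
  | mul g a ih => rw [map_mul, Module.End.mul_apply, nord_gen, ih, mul_assoc]

theorem nord_one : nord eps 1 = 1 := by
  rw [show (1 : Sym F) = monomial 0 1 from rfl, nord_monomial]; simp [nmon]

/-- The symbol of an element with respect to normal ordering. -/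
def symb (a : Weyl F eps) : Sym F := rep a 1

theorem nord_symb (a : Weyl F eps) : nord eps (symb a) = a := by
  rw [symb, nord_rep, nord_one, mul_one]

/-! ### The Weyl algebra has no zero divisors -/
theorem map_restrictSupport (T : Sym F →ₗ[F] Sym F) (s t : Set (Fin 3 ⊕ Fin 3 →₀ ℕ))
    (h : ∀ m ∈ s, T (monomial m 1) ∈ restrictSupport F t) {f : Sym F}
    (hf : f ∈ restrictSupport F s) : T f ∈ restrictSupport F t := by
  rw [restrictSupport_eq_span] at hf
  induction hf using Submodule.span_induction with
  | mem x hx => obtain ⟨m, hm, rfl⟩ := hx; exact h m hm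
  | zero => simp
  | add x y _ _ hx hy => rw [map_add]; exact add_mem hx hy
  | smul c x _ hx => rw [map_smul]; exact Submodule.smul_mem _ _ hx

theorem mul_restrictSupport {s t u : Set (Fin 3 ⊕ Fin 3 →₀ ℕ)}
    (h : ∀ a ∈ s, ∀ b ∈ t, a + b ∈ u) {f g : Sym F}
    (hf : f ∈ restrictSupport F s) (hg : g ∈ restrictSupport F t) :
    f * g ∈ restrictSupport F u := by
  have h1 := Submodule.mul_mem_mul hf hg
  rw [← restrictSupport_add] at h1
  refine restrictSupport_mono F ?_ h1
  rintro _ ⟨a, ha, b, hb, rfl⟩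
  exact h a ha b hb

variable (F) in
def fil (n : ℕ) : Submodule F (Sym F) := restrictSupport F {m | m.degree < n}

theorem fil_mono {a b : ℕ} (h : a ≤ b) : fil F a ≤ fil F b :=
  restrictSupport_mono F fun _ hm => lt_of_lt_of_le hm h

theorem fil_mul {a b : ℕ} {f g : Sym F} (hf : f ∈ fil F (a + 1)) (hg : g ∈ fil F b) :
    f * g ∈ fil F (a + b) := by
  refine mul_restrictSupport ?_ hf hg
  intro x hx y hy
  simp only [Set.mem_ofPred_eq, map_add] at *
  omega

theorem mem_fil_iff {n : ℕ} {f : Sym F} : f ∈ fil F (n + 1) ↔ f.totalDegree ≤ n := by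
  have e : f.totalDegree ≤ n ↔ ∀ m ∈ f.support, m.degree ≤ n := Finset.sup_le_iff
  rw [fil, mem_restrictSupport_iff, e]
  exact ⟨fun h m hm => Nat.lt_succ_iff.1 (h hm), fun h m hm => Nat.lt_succ_iff.2 (h m hm)⟩

theorem der_fil (i : Fin 3) {n : ℕ} {f : Sym F} (hf : f ∈ fil F n) : der eps i f ∈ fil F n := by
  refine map_restrictSupport (der eps i).toLinearMap _ _ ?_ hf
  intro m hm
  simp only [der, Derivation.coeFn_coe, Derivation.smul_apply, pderiv_monomial]
  refine Submodule.smul_mem _ _ ((monomial_mem_restrictSupport F).2 (Or.inl ?_))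
  simp only [Set.mem_ofPred_eq] at hm ⊢
  exact lt_of_le_of_lt (Finsupp.degree_mono tsub_le_self) hm

/-- `O` acts as multiplication by `p` up to terms of lower degree. -/
def Lead (O : Module.End F (Sym F)) (p : Sym F) (n : ℕ) : Prop :=
  p ∈ fil F (n + 1) ∧ ∀ k, ∀ f ∈ fil F (k + 1), O f - p * f ∈ fil F (k + n)

theorem Lead.mul {O O' : Module.End F (Sym F)} {p p' : Sym F} {n n' : ℕ} (h : Lead O p n)
    (h' : Lead O' p' n') : Lead (O * O') (p * p') (n + n') := by
  refine ⟨by simpa [add_assoc] using fil_mul h.1 h'.1, fun k f hf => ?_⟩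
  have e1 := h'.2 k f hf
  have e2 : O' f ∈ fil F ((k + n') + 1) := by
    have : O' f = (O' f - p' * f) + p' * f := by ring
    rw [this]
    refine add_mem (fil_mono (by omega) e1) ?_
    have := fil_mul h'.1 hf
    exact fil_mono (by omega) this
  have e3 := h.2 _ _ e2
  have e4 := fil_mul h.1 e1
  have : (O * O') f - p * p' * f = (O (O' f) - p * O' f) + p * (O' f - p' * f) := by
    simp only [Module.End.mul_apply]; ring
  rw [this]
  exact add_mem (fil_mono (by omega) e3) (fil_mono (by omega) e4)

theorem Lead.one : Lead (1 : Module.End F (Sym F)) 1 0 :=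
  ⟨mem_fil_iff.2 (by simp), fun k f _ => by simp⟩

theorem Lead.pow {O : Module.End F (Sym F)} {p : Sym F} (h : Lead O p 1) (n : ℕ) :
    Lead (O ^ n) (p ^ n) n := by
  induction n with
  | zero => simpa using Lead.one
  | succ n ih => rw [pow_succ, pow_succ]; exact ih.mul h

theorem lead_gen (g : Fin 3 ⊕ Fin 3) : Lead (rep (gen eps g)) (X g) 1 := by
  refine ⟨mem_fil_iff.2 (by simp), fun k f hf => ?_⟩
  rcases g with i | i
  · rw [rep_inl, sub_self]; exact zero_mem _
  · rw [rep_inr, add_sub_cancel_left]; exact der_fil i hf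

theorem lead_nmon (m : Fin 3 ⊕ Fin 3 →₀ ℕ) :
    Lead (rep (nmon eps m)) (monomial m 1) m.degree := by
  have hp : ∀ g, Lead (rep (gen eps g ^ m g)) (X g ^ m g) (m g) := fun g => by
    rw [map_pow]; exact (lead_gen g).pow _
  have h := (((hp (.inl 0)).mul (hp (.inl 1))).mul (hp (.inl 2))).mul
    (((hp (.inr 0)).mul (hp (.inr 1))).mul (hp (.inr 2)))
  simp only [← map_mul] at h
  have e1 : (monomial m 1 : Sym F) = X (.inl 0) ^ m (.inl 0) * X (.inl 1) ^ m (.inl 1) *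
      X (.inl 2) ^ m (.inl 2) * (X (.inr 0) ^ m (.inr 0) * X (.inr 1) ^ m (.inr 1) *
      X (.inr 2) ^ m (.inr 2)) := by
    rw [monomial_eq, Finsupp.prod_fintype _ _ (by simp)]
    simp [Fintype.prod_sum_type, Fin.prod_univ_three]
  have e2 : m.degree = m (.inl 0) + m (.inl 1) + m (.inl 2) +
      (m (.inr 0) + m (.inr 1) + m (.inr 2)) := by
    rw [Finsupp.degree_eq_sum]
    simp [Fintype.sum_sum_type, Fin.sum_univ_three]
  rw [e1, e2]
  exact h

theorem lead_nord (p : Sym F) (n k : ℕ) (hp : p ∈ fil F (n + 1)) (f : Sym F)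
    (hf : f ∈ fil F (k + 1)) : rep (nord eps p) f - p * f ∈ fil F (k + n) := by
  let T : Sym F →ₗ[F] Sym F := (LinearMap.applyₗ f) ∘ₗ rep.toLinearMap ∘ₗ (nord eps) -
    LinearMap.mulRight F f
  have := map_restrictSupport T _ {m | m.degree < k + n} ?_ hp
  · exact this
  · intro m hm
    have h1 := (lead_nmon (eps := eps) m).2 k f hf
    have : T (monomial m 1) = rep (nmon eps m) f - monomial m 1 * f := by
      simp [T, nord_monomial]
    rw [this]
    exact fil_mono (by simp only [Set.mem_ofPred_eq] at hm; omega) h1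

theorem rep_nord_ne_zero {p f : Sym F} (hp : p ≠ 0) (hf : f ≠ 0) : rep (nord eps p) f ≠ 0 := by
  intro h0
  have h := lead_nord (eps := eps) p _ _ (mem_fil_iff.2 le_rfl) f (mem_fil_iff.2 le_rfl)
  rw [h0, zero_sub, neg_mem_iff] at h
  have hpf : p * f ≠ 0 := mul_ne_zero hp hf
  have hd := totalDegree_mul_of_isDomain hp hf
  rcases Nat.eq_zero_or_pos (f.totalDegree + p.totalDegree) with h1 | h1
  · rw [h1] at h
    have : p * f ∈ restrictSupport F (∅ : Set (Fin 3 ⊕ Fin 3 →₀ ℕ)) := by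
      convert h using 2; ext; simp [fil]
    rw [mem_restrictSupport_iff] at this
    exact hpf (by simpa using this)
  · obtain ⟨n, hn⟩ := Nat.exists_eq_succ_of_ne_zero h1.ne'
    rw [hn] at h
    have := mem_fil_iff.1 h
    omega

theorem rep_ne_zero {a : Weyl F eps} {f : Sym F} (ha : a ≠ 0) (hf : f ≠ 0) : rep a f ≠ 0 := by
  rw [← nord_symb a]
  refine rep_nord_ne_zero ?_ hf
  rintro h
  apply ha
  rw [← nord_symb a, h, map_zero]

theorem symb_ne_zero {a : Weyl F eps} (ha : a ≠ 0) : symb a ≠ 0 := rep_ne_zero ha one_ne_zero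

theorem nord_ne_zero {p : Sym F} (hp : p ≠ 0) : nord eps p ≠ 0 := fun h =>
  rep_nord_ne_zero (eps := eps) hp one_ne_zero (by simp [h])

instance : Nontrivial (Weyl F eps) := ⟨⟨1, 0, nord_one (eps := eps) ▸ nord_ne_zero one_ne_zero⟩⟩

instance : NoZeroDivisors (Weyl F eps) where
  eq_zero_or_eq_zero_of_mul_eq_zero {a b} h := by
    by_contra! hc
    have h1 := rep_ne_zero hc.1 (symb_ne_zero hc.2)
    apply h1
    have : rep (a * b) (1 : Sym F) = 0 := by rw [h]; simp
    simpa [symb] using this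

/-! ### The Ore condition -/
variable (F) in
def box (v : Fin 3 ⊕ Fin 3 →₀ ℕ) : Submodule F (Sym F) := restrictSupport F (Set.Iic v)

theorem box_mono {v w : Fin 3 ⊕ Fin 3 →₀ ℕ} (h : v ≤ w) : box F v ≤ box F w :=
  restrictSupport_mono F fun _ hm => le_trans hm h

def BMap (O : Module.End F (Sym F)) (u : Fin 3 ⊕ Fin 3 →₀ ℕ) : Prop :=
  ∀ v, ∀ f ∈ box F v, O f ∈ box F (v + u)

theorem BMap.mul {O O' : Module.End F (Sym F)} {u u'} (h : BMap O u) (h' : BMap O' u') :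
    BMap (O * O') (u + u') := fun v f hf => by
  have := h _ _ (h' v f hf)
  rwa [add_assoc, add_comm u' u] at this

theorem BMap.pow {O : Module.End F (Sym F)} {u} (h : BMap O u) (n : ℕ) : BMap (O ^ n) (n • u) := by
  induction n with
  | zero => intro v f hf; simpa using hf
  | succ n ih => rw [pow_succ, succ_nsmul]; exact ih.mul h

theorem bmap_gen (g : Fin 3 ⊕ Fin 3) : BMap (rep (gen eps g)) (Finsupp.single g 1) := by
  intro v f hf
  have h1 : X g * f ∈ box F (v + Finsupp.single g 1) := by
    rw [add_comm]
    refine mul_restrictSupport (s := {Finsupp.single g 1}) (t := Set.Iic v) ?_ ?_ hf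
    · rintro a rfl b hb; exact add_le_add le_rfl (Set.mem_Iic.1 hb)
    · rw [X]; exact (monomial_mem_restrictSupport F).2 (Or.inl rfl)
  rcases g with i | i
  · rwa [rep_inl]
  · rw [rep_inr]
    refine add_mem h1 (box_mono le_self_add ?_)
    refine map_restrictSupport (der eps i).toLinearMap _ _ ?_ hf
    intro m hm
    simp only [der, Derivation.coeFn_coe, Derivation.smul_apply, pderiv_monomial]
    refine Submodule.smul_mem _ _ ((monomial_mem_restrictSupport F).2 (Or.inl ?_))
    exact Set.mem_Iic.2 (le_trans tsub_le_self (Set.mem_Iic.1 hm))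

theorem bmap_nmon (m : Fin 3 ⊕ Fin 3 →₀ ℕ) : BMap (rep (nmon eps m)) m := by
  have hp : ∀ g, BMap (rep (gen eps g ^ m g)) (m g • Finsupp.single g 1) := fun g => by
    rw [map_pow]; exact (bmap_gen g).pow _
  have h := (((hp (.inl 0)).mul (hp (.inl 1))).mul (hp (.inl 2))).mul
    (((hp (.inr 0)).mul (hp (.inr 1))).mul (hp (.inr 2)))
  simp only [← map_mul] at h
  have e : m = m (.inl 0) • Finsupp.single (.inl 0) 1 + m (.inl 1) • Finsupp.single (.inl 1) 1 +
      m (.inl 2) • Finsupp.single (.inl 2) 1 + (m (.inr 0) • Finsupp.single (.inr 0) 1 +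
      m (.inr 1) • Finsupp.single (.inr 1) 1 + m (.inr 2) • Finsupp.single (.inr 2) 1) := by
    ext g
    rcases g with i | i <;> fin_cases i <;> simp
  intro v f hf
  have := h v f hf
  rwa [← e] at this

theorem bmap_nord {p f : Sym F} {v w : Fin 3 ⊕ Fin 3 →₀ ℕ} (hp : p ∈ box F w) (hf : f ∈ box F v) :
    rep (nord eps p) f ∈ box F (v + w) := by
  let T : Sym F →ₗ[F] Sym F := (LinearMap.applyₗ f) ∘ₗ rep.toLinearMap ∘ₗ (nord eps)
  refine map_restrictSupport T (Set.Iic w) _ ?_ hp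
  intro m hm
  have h1 := (bmap_nmon (eps := eps) m) v f hf
  have : T (monomial m 1) = rep (nmon eps m) f := by simp [T, nord_monomial]
  rw [this]
  exact box_mono (add_le_add le_rfl hm) h1

variable (F) in
theorem box_finite (v : Fin 3 ⊕ Fin 3 →₀ ℕ) : Module.Finite F (box F v) := by
  have := (Set.finite_Iic v).fintype
  exact Module.Finite.of_basis (basisRestrictSupport F (Set.Iic v))

def cst (n : ℕ) : Fin 3 ⊕ Fin 3 →₀ ℕ := Finsupp.equivFunOnFinite.symm fun _ => n

variable (F) in
theorem finrank_box (n : ℕ) : Module.finrank F (box F (cst n)) = (n + 1) ^ 6 := by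
  rw [box, Module.finrank_eq_nat_card_basis (basisRestrictSupport F (Set.Iic (cst n)))]
  let e : Set.Iic (cst n) ≃ (Fin 3 ⊕ Fin 3 → Fin (n + 1)) :=
    { toFun := fun m g => ⟨m.1 g, Nat.lt_succ_iff.2 (m.2 g)⟩
      invFun := fun h => ⟨Finsupp.equivFunOnFinite.symm fun g => (h g : ℕ),
        fun g => Nat.lt_succ_iff.1 (h g).2⟩
      left_inv := fun m => by ext; simp
      right_inv := fun h => by ext; simp }
  rw [Nat.card_congr e]
  simp

theorem exists_box (f : Sym F) : ∃ k, f ∈ box F (cst k) := by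
  refine ⟨f.totalDegree, (mem_restrictSupport_iff F).2 fun m hm g => ?_⟩
  have := le_totalDegree hm
  refine le_trans ?_ this
  by_cases hg : g ∈ m.support
  · exact Finset.single_le_sum (f := fun g => m g) (fun _ _ => Nat.zero_le _) hg
  · simp [Finsupp.notMem_support_iff.1 hg]

theorem ore_exists (a b : Weyl F eps) (hb : b ≠ 0) : ∃ u v : Weyl F eps, u ≠ 0 ∧ u * a = v * b := by
  obtain ⟨k1, hk1⟩ := exists_box (symb a)
  obtain ⟨k2, hk2⟩ := exists_box (symb b)
  obtain ⟨k, ha, hb'⟩ : ∃ k, symb a ∈ box F (cst k) ∧ symb b ∈ box F (cst k) :=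
    ⟨max k1 k2, box_mono (fun _ => le_max_left _ _) hk1, box_mono (fun _ => le_max_right _ _) hk2⟩
  obtain ⟨n, hn⟩ : ∃ n : ℕ, (n + k + 1) ^ 6 < 2 * (n + 1) ^ 6 := by
    refine ⟨20 * k, ?_⟩
    have h1 : 20 * (20 * k + k + 1) ≤ 21 * (20 * k + 1) := by omega
    have h2 := Nat.pow_le_pow_left h1 6
    rw [mul_pow, mul_pow] at h2
    have h3 : 0 < (20 * k + 1) ^ 6 := by positivity
    omega
  have key : ∀ c : Sym F, c ∈ box F (cst k) → ∀ p ∈ box F (cst n),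
      rep (nord eps p) c ∈ box F (cst (n + k)) := by
    intro c hc p hp
    have := bmap_nord (eps := eps) hp hc
    convert this using 2
    ext g; simp [cst, add_comm]
  let T : (c : Sym F) → c ∈ box F (cst k) → box F (cst n) →ₗ[F] box F (cst (n + k)) :=
    fun c hc => LinearMap.codRestrict _
      ((LinearMap.applyₗ c) ∘ₗ rep.toLinearMap ∘ₗ (nord eps) ∘ₗ (box F (cst n)).subtype)
      (fun p => key c hc p.1 p.2)
  let S : (box F (cst n) × box F (cst n)) →ₗ[F] box F (cst (n + k)) :=
    (T _ ha).coprod (- T _ hb')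
  have := box_finite F (cst n)
  have := box_finite F (cst (n + k))
  have hker : LinearMap.ker S ≠ ⊥ := by
    apply LinearMap.ker_ne_bot_of_finrank_lt
    rw [Module.finrank_prod, finrank_box, finrank_box]
    omega
  obtain ⟨⟨p, r⟩, hpr, hne⟩ := Submodule.exists_mem_ne_zero_of_ne_bot hker
  have h0 : rep (nord eps p.1) (symb a) = rep (nord eps r.1) (symb b) := by
    have := congrArg Subtype.val (LinearMap.mem_ker.1 hpr)
    have h2 : rep (nord eps p.1) (symb a) + -(rep (nord eps r.1) (symb b)) = 0 := this
    rwa [← sub_eq_add_neg, sub_eq_zero] at h2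
  have h1 : nord eps p.1 * a = nord eps r.1 * b := by
    have := congrArg (nord eps) h0
    rwa [nord_rep, nord_rep, nord_symb, nord_symb] at this
  refine ⟨_, _, ?_, h1⟩
  intro hp0
  rw [hp0, zero_mul] at h1
  have hr0 : nord eps r.1 = 0 := by
    rcases mul_eq_zero.1 h1.symm with h | h
    · exact h
    · exact absurd h hb
  apply hne
  have hp' : p.1 = 0 := by by_contra h; exact nord_ne_zero h hp0
  have hr' : r.1 = 0 := by by_contra h; exact nord_ne_zero h hr0
  exact Prod.ext (Subtype.ext hp') (Subtype.ext hr')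

instance : OreLocalization.OreSet (nonZeroDivisors (Weyl F eps)) :=
  Classical.choice (OreLocalization.nonempty_oreSet_iff_of_noZeroDivisors.2 fun a b => by
    obtain ⟨u, v, hu, h⟩ := ore_exists a b.1 (nonZeroDivisors.ne_zero b.2)
    exact ⟨v, ⟨u, mem_nonZeroDivisors_of_ne_zero hu⟩, h⟩)

/-! ### Maps out of the Weyl algebra are injective -/

variable (eps) in
def dl (g : Fin 3 ⊕ Fin 3) : Derivation F (Sym F) (Sym F) :=
  Sum.elim (fun i => (-eps i) • pderiv (Sum.inr i)) (fun i => der eps i) g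

theorem dl_X (g h : Fin 3 ⊕ Fin 3) : ∃ c : F, dl eps g (X h) = C c ∧
    gen eps g * gen eps h = gen eps h * gen eps g + algebraMap F _ c := by
  rcases g with i | i <;> rcases h with j | j
  · exact ⟨0, by simp [dl, pderiv_X], by simpa using (canon_gen eps).pos i j⟩
  · refine ⟨if j = i then - eps i else 0, ?_, ?_⟩
    · simp only [dl, Sum.elim_inl, Derivation.smul_apply, pderiv_X, Pi.single_apply]
      split_ifs with h1 h2 <;> simp_all [smul_eq_C_mul]
    · have := (canon_gen eps).cross j i
      change gen eps (Sum.inl i) * gen eps (Sum.inr j) = gen eps (Sum.inr j) * gen eps (Sum.inl i) + _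
      rw [this]
      split_ifs with h
      · subst h; simp
      · simp
  · exact ⟨_, der_X_inl i j, (canon_gen eps).cross i j⟩
  · exact ⟨0, by simp [dl, der_X_inr], by simpa using (canon_gen eps).mom i j⟩

theorem dl_der (g : Fin 3 ⊕ Fin 3) (i : Fin 3) (f : Sym F) :
    dl eps g (der eps i f) = der eps i (dl eps g f) := by
  rcases g with j | j
  · have h : ⁅(pderiv (Sum.inr j) : Derivation F (Sym F) (Sym F)),
      (pderiv (Sum.inl i) : Derivation F (Sym F) (Sym F))⁆ = 0 := by
      apply MvPolynomial.derivation_ext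
      intro k
      simp only [Derivation.commutator_apply, pderiv_X, Pi.single_apply]
      split_ifs <;> simp
    have := congrArg (fun D : Derivation F (Sym F) (Sym F) => D f) h
    simp only [Derivation.commutator_apply, Derivation.zero_apply, sub_eq_zero] at this
    simp only [dl, der, Sum.elim_inl, Derivation.smul_apply, Derivation.map_smul, this]
    rw [smul_comm]
  · exact der_comm j i f

theorem symb_gen_mul (g : Fin 3 ⊕ Fin 3) (a : Weyl F eps) :
    symb (gen eps g * a) = rep (gen eps g) (symb a) := by simp [symb]

theorem symb_comm (g : Fin 3 ⊕ Fin 3) (a : Weyl F eps) :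
    symb (gen eps g * a - a * gen eps g) = dl eps g (symb a) := by
  induction a using left_induction with
  | one => simp [symb]
  | smul c a ih =>
    rw [mul_smul_comm, smul_mul_assoc, ← smul_sub]
    have : ∀ b : Weyl F eps, symb (c • b) = c • symb b := fun b => by simp [symb]
    rw [this, this, ih, Derivation.map_smul]
  | add a b iha ihb =>
    have : ∀ a b : Weyl F eps, symb (a + b) = symb a + symb b := fun a b => by simp [symb]
    rw [this, map_add, ← iha, ← ihb, ← this]
    congr 1; noncomm_ring
  | mul h a ih =>
    obtain ⟨c, hc, hgh⟩ := dl_X (eps := eps) g h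
    have e : gen eps g * (gen eps h * a) - gen eps h * a * gen eps g =
        gen eps h * (gen eps g * a - a * gen eps g) + c • a := by
      rw [← mul_assoc, hgh, add_mul, ← Algebra.smul_def]; noncomm_ring
    have e2 : symb (gen eps h * (gen eps g * a - a * gen eps g) + c • a) =
        rep (gen eps h) (dl eps g (symb a)) + c • symb a := by
      rw [← ih, ← symb_gen_mul]; simp [symb]
    rw [e, e2, symb_gen_mul]
    rcases h with j | j
    · rw [rep_inl, rep_inl, Derivation.leibniz, hc, smul_eq_mul, smul_eq_mul, smul_eq_C_mul]
      ring
    · rw [rep_inr, rep_inr, map_add, Derivation.leibniz, hc, smul_eq_mul, smul_eq_mul,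
        smul_eq_C_mul, dl_der]
      ring

theorem injective [CharZero F] [he : Fact (∀ i, eps i ≠ 0)] {R : Type*} [Ring R] [Algebra F R] [Nontrivial R] (φ : Weyl F eps →ₐ[F] R) :
    Function.Injective φ := by
  rw [injective_iff_map_eq_zero]
  have main : ∀ n, ∀ a : Weyl F eps, (symb a).totalDegree ≤ n → φ a = 0 → a = 0 := by
    intro n
    induction n with
    | zero =>
      intro a ha h0
      obtain ⟨c, hc⟩ : ∃ c, symb a = C c :=
        ⟨_, totalDegree_eq_zero_iff_eq_C.1 (Nat.le_zero.1 ha)⟩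
      have hac : a = algebraMap F _ c := by
        rw [← nord_symb a, hc, ← mul_one (C c), ← smul_eq_C_mul, map_smul, nord_one,
          Algebra.algebraMap_eq_smul_one]
      rw [hac, AlgHom.commutes] at h0
      rw [hac, (algebraMap F R).injective (h0.trans (map_zero _).symm), map_zero]
    | succ n ih =>
      intro a ha h0
      have hd : ∀ g, dl eps g (symb a) = 0 := by
        intro g
        have h1 : φ (gen eps g * a - a * gen eps g) = 0 := by simp [h0]
        have h2 := ih _ ?_ h1
        · rw [← symb_comm, h2]; simp [symb]
        · rw [symb_comm, ← mem_fil_iff]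
          rw [← mem_fil_iff] at ha
          have hp : ∀ k, pderiv k (symb a) ∈ fil F (n + 1) := by
            intro k
            refine map_restrictSupport (pderiv (R := F) k).toLinearMap _ _ ?_ ha
            intro m hm
            simp only [Derivation.coeFn_coe, pderiv_monomial]
            by_cases hk : m k = 0
            · simp [hk]
            · refine (monomial_mem_restrictSupport F).2 (Or.inl ?_)
              have hle : Finsupp.single k 1 ≤ m := by
                simpa [Nat.one_le_iff_ne_zero] using hk
              have := congrArg Finsupp.degree (tsub_add_cancel_of_le hle)
              simp only [map_add, Finsupp.degree_single, Set.mem_ofPred_eq] at *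
              omega
          rcases g with i | i
          · exact Submodule.smul_mem _ _ (hp _)
          · exact Submodule.smul_mem _ _ (hp _)
      have hd' : ∀ g, pderiv g (symb a) = 0 := by
        intro g
        rcases g with i | i
        · have := hd (Sum.inr i)
          exact (smul_eq_zero.1 this).resolve_left (he.out i)
        · have := hd (Sum.inl i)
          exact (smul_eq_zero.1 this).resolve_left (neg_ne_zero.2 (he.out i))
      refine ih a ?_ h0
      have : symb a = C (coeff 0 (symb a)) := by
        ext m
        rw [coeff_C]
        split_ifs with h
        · rw [← h]
        · obtain ⟨g, hg⟩ : ∃ g, m g ≠ 0 := by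
            by_contra! hc; exact h (Finsupp.ext fun g => (hc g).symm)
          have h1 := congrArg (coeff (m - Finsupp.single g 1)) (hd' g)
          have hle : Finsupp.single g 1 ≤ m := by simpa [Nat.one_le_iff_ne_zero] using hg
          rw [coeff_pderiv, tsub_add_cancel_of_le hle, coeff_zero] at h1
          refine (mul_eq_zero.1 h1).resolve_right ?_
          exact Nat.cast_add_one_ne_zero _
      rw [this, totalDegree_C]; exact Nat.zero_le _
  exact fun a h => main _ a le_rfl h

end Weyl

open Weyl

/-- The skew field of fractions of the Weyl algebra. -/
def Skew : Type u :=
  OreLocalization (nonZeroDivisors (Weyl F eps)) (Weyl F eps)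

instance : DivisionRing (Skew F eps) :=
  inferInstanceAs (DivisionRing (OreLocalization (nonZeroDivisors (Weyl F eps)) (Weyl F eps)))
instance : Algebra F (Skew F eps) :=
  inferInstanceAs (Algebra F (OreLocalization (nonZeroDivisors (Weyl F eps)) (Weyl F eps)))

namespace Skew
variable {F} {eps}

variable (eps) in
/-- The inclusion of the Weyl algebra. -/
def of : Weyl F eps →ₐ[F] Skew F eps where
  toRingHom := OreLocalization.numeratorRingHom
  commutes' _ := rfl

variable (eps) in
/-- The position generators. -/
def pos (i : Fin 3) : Skew F eps := of eps (gen eps (Sum.inl i))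
variable (eps) in
/-- The momentum generators. -/
def mom (i : Fin 3) : Skew F eps := of eps (gen eps (Sum.inr i))

theorem of_injective : Function.Injective (of eps) :=
  OreLocalization.numeratorHom_inj (inf_le_left)

theorem exists_fraction (z : Skew F eps) : ∃ a b : Weyl F eps, b ≠ 0 ∧ of eps b * z = of eps a := by
  induction z using OreLocalization.ind with
  | _ r s =>
    refine ⟨r, s.1, nonZeroDivisors.ne_zero s.2, ?_⟩
    exact OreLocalization.mul_cancel

theorem canon : Canon eps (pos eps) (mom eps) where
  pos i j := by simpa only [pos, mom, map_mul] using congrArg (of eps) ((canon_gen eps).pos i j)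
  mom i j := by simpa only [pos, mom, map_mul] using congrArg (of eps) ((canon_gen eps).mom i j)
  cross i j := by
    simpa only [pos, mom, map_mul, map_add, AlgHom.commutes] using
      congrArg (of eps) ((canon_gen eps).cross i j)

theorem hom_ext {D : Type*} [DivisionRing D] [Algebra F D] {f g : Skew F eps →ₐ[F] D} (hp : ∀ i, f (pos eps i) = g (pos eps i))
    (hm : ∀ i, f (mom eps i) = g (mom eps i)) : f = g := by
  have h : f.comp (of eps) = g.comp (of eps) := by
    apply Weyl.hom_ext
    rintro (i | i)
    · exact hp i
    · exact hm i
  ext z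
  obtain ⟨a, b, hb, hz⟩ := exists_fraction z
  have hb' : of eps b ≠ 0 := fun h0 => hb (of_injective (h0.trans (map_zero _).symm))
  have h1 := congrArg f hz
  have h2 := congrArg g hz
  rw [map_mul] at h1 h2
  have ea : f (of eps a) = g (of eps a) := congrArg (fun k => k a) h
  have eb : f (of eps b) = g (of eps b) := congrArg (fun k => k b) h
  rw [ea, eb, ← h2] at h1
  exact mul_left_cancel₀ ((map_ne_zero g).2 hb') h1

section hom
variable [CharZero F] [he : Fact (∀ i, eps i ≠ 0)]
variable {D : Type*} [DivisionRing D] [Algebra F D] {X Y : Fin 3 → D}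

def unitsHom (h : Canon eps X Y) : nonZeroDivisors (Weyl F eps) →* Dˣ where
  toFun s := Units.mk0 (Weyl.lift h s.1) fun h0 => nonZeroDivisors.ne_zero s.2
    (Weyl.injective (Weyl.lift h) (h0.trans (map_zero _).symm))
  map_one' := by ext; simp
  map_mul' a b := by ext; simp

/-- The algebra map out of the skew field given by elements with the canonical relations. -/
def lift (h : Canon eps X Y) : Skew F eps →ₐ[F] D where
  toRingHom := OreLocalization.universalHom (Weyl.lift h : Weyl F eps →+* D) (unitsHom h)
    fun _ => rfl
  commutes' c := by
    have := OreLocalization.universalHom_commutes (Weyl.lift h : Weyl F eps →+* D) (unitsHom h)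
      (fun _ => rfl) (r := algebraMap F _ c)
    exact this.trans ((Weyl.lift h).commutes c)

theorem lift_of (h : Canon eps X Y) (a : Weyl F eps) : lift h (of eps a) = Weyl.lift h a :=
  OreLocalization.universalHom_commutes (Weyl.lift h : Weyl F eps →+* D) (unitsHom h) fun _ => rfl

@[simp] theorem lift_pos (h : Canon eps X Y) (i : Fin 3) : lift h (pos eps i) = X i := by
  rw [pos, lift_of, Weyl.lift_gen]; rfl
@[simp] theorem lift_mom (h : Canon eps X Y) (i : Fin 3) : lift h (mom eps i) = Y i := by
  rw [mom, lift_of, Weyl.lift_gen]; rfl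

end hom
end Skew

namespace Skew
variable {F} {eps}

theorem pos_ne (i j : Fin 3) : Commute (pos eps i) (pos eps j) := canon.pos i j
theorem mom_ne (i j : Fin 3) : Commute (mom eps i) (mom eps j) := canon.mom i j
theorem cross_ne {i j : Fin 3} (h : i ≠ j) : Commute (mom eps i) (pos eps j) := by
  have := (canon (eps := eps)).cross i j
  rwa [if_neg h, map_zero, add_zero] at this
theorem cross_self (i : Fin 3) :
    mom eps i * pos eps i = pos eps i * mom eps i + algebraMap F _ (eps i) := by
  simpa using (canon (eps := eps)).cross i i
theorem cross_ne' {i j : Fin 3} (h : i ≠ j) : Commute (pos eps j) (mom eps i) := (cross_ne h).symm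

open Function

theorem laplace_canon (i : Fin 3) (s : F) (hs : s * s = 1) :
    Canon eps (update (pos eps) i (-(s • mom eps i))) (update (mom eps) i (s • pos eps i)) where
  pos a b := by
    by_cases ha : a = i <;> by_cases hb : b = i <;>
      simp only [ha, hb, update_self, update_of_ne, ne_eq, not_false_eq_true]
    · exact ((cross_ne (Ne.symm hb)).smul_left s).neg_left
    · exact ((cross_ne (Ne.symm ha)).symm.smul_right s).neg_right
    · exact pos_ne a b
  mom a b := by
    by_cases ha : a = i <;> by_cases hb : b = i <;>
      simp only [ha, hb, update_self, update_of_ne, ne_eq, not_false_eq_true]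
    · exact (cross_ne hb).symm.smul_left s
    · exact (cross_ne ha).smul_right s
    · exact mom_ne a b
  cross a b := by
    by_cases ha : a = i <;> by_cases hb : b = i <;>
      simp only [ha, hb, update_self, update_of_ne, ne_eq, not_false_eq_true, if_true]
    · rw [mul_neg, neg_mul, smul_mul_smul_comm, smul_mul_smul_comm, hs, one_smul, one_smul,
        cross_self]; abel
    · rw [if_neg (Ne.symm hb), map_zero, add_zero]
      exact (pos_ne i b).smul_left s
    · rw [if_false, map_zero, add_zero]
      exact ((mom_ne a i).smul_right s).neg_right
    · simpa using (canon (eps := eps)).cross a b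

theorem gauge_canon (g : Fin 3 → Skew F eps) (h1 : ∀ a b, Commute (g a) (pos eps b))
    (h2 : ∀ a b, Commute (g a) (g b))
    (h3 : ∀ a b, mom eps a * g b - g b * mom eps a = mom eps b * g a - g a * mom eps b) :
    Canon eps (pos eps) (fun a => mom eps a - g a) where
  pos a b := pos_ne a b
  mom a b := by
    have e1 := h3 a b
    have e2 := (h2 a b).eq
    have e3 := (mom_ne (eps := eps) a b).eq
    rw [sub_eq_sub_iff_add_eq_add] at e1
    simp only [sub_mul, mul_sub]
    rw [e2, e3]
    have : mom eps a * g b + g a * mom eps b = mom eps b * g a + g b * mom eps a := e1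
    have e : mom eps a * g b = mom eps b * g a + g b * mom eps a - g a * mom eps b := by
      rw [← this, add_sub_cancel_right]
    rw [e]; abel
  cross a b := by
    rw [sub_mul, mul_sub, (h1 a b).eq, (canon (eps := eps)).cross a b]; abel

theorem negT_canon : Canon eps (update (pos eps) 2 (-pos eps 2)) (update (mom eps) 2 (-mom eps 2)) where
  pos a b := by
    by_cases ha : a = 2 <;> by_cases hb : b = 2 <;>
      simp only [ha, hb, update_self, update_of_ne, ne_eq, not_false_eq_true]
    · exact (pos_ne _ _).neg_left
    · exact (pos_ne _ _).neg_right
    · exact pos_ne _ _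
  mom a b := by
    by_cases ha : a = 2 <;> by_cases hb : b = 2 <;>
      simp only [ha, hb, update_self, update_of_ne, ne_eq, not_false_eq_true]
    · exact (mom_ne _ _).neg_left
    · exact (mom_ne _ _).neg_right
    · exact mom_ne _ _
  cross a b := by
    by_cases ha : a = 2 <;> by_cases hb : b = 2
    · subst ha; subst hb
      simp only [update_self, neg_mul_neg, if_true]
      exact cross_self 2
    · subst ha
      simp only [update_self, update_of_ne hb, if_neg (Ne.symm hb), map_zero, add_zero]
      exact (cross_ne (Ne.symm hb)).neg_left
    · subst hb
      simp only [update_self, update_of_ne ha, if_neg ha, map_zero, add_zero]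
      exact (cross_ne ha).neg_right
    · simpa only [update_of_ne ha, update_of_ne hb] using (canon (eps := eps)).cross a b

theorem pos_ne_zero [he : Fact (∀ i, eps i ≠ 0)] (i : Fin 3) : pos eps i ≠ 0 := fun h => by
  have := cross_self (eps := eps) i
  rw [h, mul_zero, zero_mul, zero_add] at this
  exact he.out i ((algebraMap F (Skew F eps)).injective (this.symm.trans (map_zero _).symm))

theorem shift_canon (i : Fin 3) (c : F) :
    Canon eps (update (pos eps) i (pos eps i - algebraMap F _ c)) (mom eps) where
  pos a b := by
    by_cases ha : a = i <;> by_cases hb : b = i <;>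
      simp only [ha, hb, update_self, update_of_ne, ne_eq, not_false_eq_true]
    · exact (pos_ne _ _).sub_left (Algebra.commute_algebraMap_left _ _)
    · exact (pos_ne _ _).sub_right (Algebra.commute_algebraMap_right _ _)
    · exact pos_ne _ _
  mom a b := mom_ne a b
  cross a b := by
    by_cases hb : b = i
    · subst hb
      rw [update_self, mul_sub, sub_mul, (canon (eps := eps)).cross a b, Algebra.commutes c]; abel
    · rw [update_of_ne hb]; exact (canon (eps := eps)).cross a b

theorem scale_canon (i : Fin 3) (hi : i ≠ 2) (w w' z : Skew F eps) (hw : w' * w = 1)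
    (h1 : ∀ a, Commute w (pos eps a)) (h2 : ∀ a ≠ 2, Commute w (mom eps a))
    (h1' : ∀ a, Commute w' (pos eps a)) (h2' : ∀ a ≠ 2, Commute w' (mom eps a))
    (h1z : ∀ a, Commute z (pos eps a)) (h2z : ∀ a ≠ 2, Commute z (mom eps a))
    (hz : Commute z w) (hz' : Commute z w')
    (d1 : mom eps 2 * w = w * mom eps 2 + algebraMap F _ (eps i) * z * w)
    (d2 : mom eps 2 * w' = w' * mom eps 2 - algebraMap F _ (eps i) * z * w') :
    Canon eps (update (pos eps) i (w * pos eps i))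
      (update (update (mom eps) 2 (mom eps 2 - z * pos eps i * mom eps i)) i (w' * mom eps i)) where
  pos a b := by
    by_cases ha : a = i <;> by_cases hb : b = i <;>
      simp only [ha, hb, update_self, update_of_ne, ne_eq, not_false_eq_true]
    · exact (h1 _).mul_left (pos_ne _ _)
    · exact (h1 _).symm.mul_right (pos_ne _ _)
    · exact pos_ne _ _
  mom a b := by
    have key : (mom eps 2 - z * pos eps i * mom eps i) * (w' * mom eps i) =
        (w' * mom eps i) * (mom eps 2 - z * pos eps i * mom eps i) := by
      have e1 : z * pos eps i * mom eps i * (w' * mom eps i) =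
          w' * (z * (pos eps i * (mom eps i * mom eps i))) := by
        simp only [mul_assoc]
        rw [← mul_assoc (mom eps i) w', ← (h2' i hi).eq, mul_assoc w',
          ← mul_assoc (pos eps i) w', ← (h1' i).eq, mul_assoc w', ← mul_assoc z w', hz'.eq,
          mul_assoc w']
      have e2 : w' * mom eps i * (z * pos eps i * mom eps i) =
          w' * (z * (pos eps i * (mom eps i * mom eps i))) +
            algebraMap F _ (eps i) * z * w' * mom eps i := by
        simp only [mul_assoc]
        rw [← mul_assoc (mom eps i) z, ← (h2z i hi).eq, mul_assoc z,
          ← mul_assoc (mom eps i) (pos eps i), cross_self, add_mul, mul_assoc (pos eps i), mul_add,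
          mul_add, ← mul_assoc z (algebraMap F _ _), ← Algebra.commutes (eps i) z,
          mul_assoc (algebraMap F (Skew F eps) _), ← mul_assoc w' (algebraMap F _ _),
          ← Algebra.commutes (eps i) w', mul_assoc (algebraMap F (Skew F eps) _),
          ← mul_assoc w' z (mom eps i), ← hz'.eq, mul_assoc z w' (mom eps i),
          ← mul_assoc w' z, ← hz'.eq, mul_assoc z]
      rw [sub_mul, mul_sub, e1, e2, ← mul_assoc, d2, sub_mul, mul_assoc w', (mom_ne 2 i).eq,
        mul_assoc w']
      abel
    have k2 : ∀ a, a ≠ 2 → a ≠ i → Commute (mom eps a) (mom eps 2 - z * pos eps i * mom eps i) :=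
      fun a ha hai => (mom_ne a 2).sub_right
        ((((h2z a ha).symm).mul_right (cross_ne hai)).mul_right (mom_ne a i))
    have k3 : ∀ a, a ≠ 2 → Commute (mom eps a) (w' * mom eps i) :=
      fun a ha => ((h2' a ha).symm).mul_right (mom_ne a i)
    by_cases ha : a = i <;> by_cases hb : b = i
    · rw [ha, hb]
    · subst ha; rw [update_self, update_of_ne hb]
      by_cases hb' : b = 2
      · subst hb'; rw [update_self]; exact key.symm
      · rw [update_of_ne hb']; exact (k3 b hb').symm
    · subst hb; rw [update_self, update_of_ne ha]
      by_cases ha' : a = 2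
      · subst ha'; rw [update_self]; exact key
      · rw [update_of_ne ha']; exact k3 a ha'
    · rw [update_of_ne ha, update_of_ne hb]
      by_cases ha' : a = 2 <;> by_cases hb' : b = 2
      · rw [ha', hb']
      · subst ha'; rw [update_self, update_of_ne hb']; exact (k2 b hb' hb).symm
      · subst hb'; rw [update_self, update_of_ne ha']; exact k2 a ha' ha
      · rw [update_of_ne ha', update_of_ne hb']; exact mom_ne a b
  cross a b := by
    by_cases ha : a = i
    · subst ha
      by_cases hb : b = a
      · subst hb
        rw [update_self, update_self, if_pos rfl, mul_assoc w', ← mul_assoc (mom eps b) w,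
          ← (h2 b hi).eq, mul_assoc w, ← mul_assoc w' w, hw, one_mul, cross_self,
          mul_assoc w, ← mul_assoc (pos eps b) w', ← (h1' b).eq, mul_assoc w', ← mul_assoc w w',
          show w * w' = 1 from mul_eq_one_comm.1 hw, one_mul]
      · rw [update_self, update_of_ne hb, if_neg (Ne.symm hb), map_zero, add_zero]
        exact (h1' b).mul_left (cross_ne (Ne.symm hb))
    · rw [update_of_ne ha]
      by_cases ha' : a = 2
      · subst ha'
        rw [update_self]
        by_cases hb : b = i
        · subst hb
          rw [update_self, if_neg hi.symm, map_zero, add_zero]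
          have e1 : z * pos eps b * mom eps b * (w * pos eps b) =
              w * pos eps b * (z * pos eps b * mom eps b) +
                algebraMap F _ (eps b) * z * w * pos eps b := by
            have f1 : z * pos eps b * mom eps b * (w * pos eps b) =
                w * (z * (pos eps b * (mom eps b * pos eps b))) := by
              simp only [mul_assoc]
              rw [← mul_assoc (mom eps b) w, ← (h2 b hi).eq, mul_assoc w,
                ← mul_assoc (pos eps b) w, ← (h1 b).eq, mul_assoc w, ← mul_assoc z w, hz.eq,
                mul_assoc w]
            have f2 : w * pos eps b * (z * pos eps b * mom eps b) =
                w * (z * (pos eps b * (pos eps b * mom eps b))) := by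
              simp only [mul_assoc]
              rw [← mul_assoc (pos eps b) z, ← (h1z b).eq, mul_assoc z]
            have f3 : algebraMap F _ (eps b) * z * w * pos eps b =
                w * (z * (pos eps b * algebraMap F _ (eps b))) := by
              rw [mul_assoc, mul_assoc, Algebra.commutes, ← mul_assoc z w, hz.eq]
              simp only [mul_assoc]
            rw [f1, f2, f3, cross_self, mul_add, mul_add, mul_add]
          rw [sub_mul, mul_sub, e1, ← mul_assoc, d1, add_mul, mul_assoc w, (cross_ne hi.symm).eq]
          simp only [mul_assoc]
          abel
        · rw [update_of_ne hb, sub_mul, mul_sub, (canon (eps := eps)).cross 2 b,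
            (((h1z b).mul_left (pos_ne i b)).mul_left (cross_ne (Ne.symm hb))).eq]
          abel
      · rw [update_of_ne ha']
        by_cases hb : b = i
        · subst hb
          rw [update_self, if_neg ha, map_zero, add_zero]
          exact ((h2 a ha').symm).mul_right (cross_ne ha)
        · rw [update_of_ne hb]; exact (canon (eps := eps)).cross a b

section automorphisms
variable [CharZero F] [he : Fact (∀ i, eps i ≠ 0)]

/-- The automorphism `pos i ↦ X i`, `mom i ↦ Y i` with inverse `pos i ↦ X' i`, `mom i ↦ Y' i`. -/
def auto {X Y X' Y' : Fin 3 → Skew F eps} (h : Canon eps X Y) (h' : Canon eps X' Y')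
    (hX : ∀ i, lift h (X' i) = pos eps i) (hY : ∀ i, lift h (Y' i) = mom eps i)
    (hX' : ∀ i, lift h' (X i) = pos eps i) (hY' : ∀ i, lift h' (Y i) = mom eps i) :
    Skew F eps ≃ₐ[F] Skew F eps :=
  AlgEquiv.ofAlgHom (lift h) (lift h')
    (hom_ext (by simpa using hX) (by simpa using hY))
    (hom_ext (by simpa using hX') (by simpa using hY'))

/-- The Laplace transformation `x_i ↦ -y_i`, `y_i ↦ x_i`. -/
def laplace (i : Fin 3) : Skew F eps ≃ₐ[F] Skew F eps :=
  auto (X := update (pos eps) i (-mom eps i)) (Y := update (mom eps) i (pos eps i))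
    (X' := update (pos eps) i (mom eps i)) (Y' := update (mom eps) i (-pos eps i))
    (by simpa using laplace_canon (eps := eps) i 1 (by simp)) (by simpa using laplace_canon (eps := eps) i (-1) (by simp))
    (fun a => by by_cases ha : a = i <;> [subst ha; skip] <;> simp_all)
    (fun a => by by_cases ha : a = i <;> [subst ha; skip] <;> simp_all)
    (fun a => by by_cases ha : a = i <;> [subst ha; skip] <;> simp_all)
    (fun a => by by_cases ha : a = i <;> [subst ha; skip] <;> simp_all)

/-- The automorphism that fixes the positions and maps the momenta by `mom a ↦ mom a - g a`. -/
def gauge (g : Fin 3 → Skew F eps) (h1 : ∀ a b, Commute (g a) (pos eps b))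
    (h2 : ∀ a b, Commute (g a) (g b))
    (h3 : ∀ a b, mom eps a * g b - g b * mom eps a = mom eps b * g a - g a * mom eps b)
    (h4 : ∀ f : Skew F eps →ₐ[F] Skew F eps, (∀ b, f (pos eps b) = pos eps b) →
      ∀ a, f (g a) = g a) :
    Skew F eps ≃ₐ[F] Skew F eps :=
  have c := gauge_canon g h1 h2 h3
  have c' : Canon eps (pos eps) (fun a => mom eps a + g a) := by
    have := gauge_canon (fun a => - g a) (fun a b => (h1 a b).neg_left)
      (fun a b => (h2 a b).neg_left.neg_right) (fun a b => by
        have := congrArg (fun z => -z) (h3 a b)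
        simp only [neg_sub] at this
        simp only [mul_neg, neg_mul, sub_neg_eq_add, neg_add_eq_sub]
        exact this)
    simpa using this
  auto (X := pos eps) (Y := fun a => mom eps a - g a)
    (X' := pos eps) (Y' := fun a => mom eps a + g a) c c'
    (fun a => lift_pos c a)
    (fun a => by rw [map_add, lift_mom, h4 _ (lift_pos c), sub_add_cancel])
    (fun a => lift_pos c' a)
    (fun a => by rw [map_sub, lift_mom, h4 _ (lift_pos c'), add_sub_cancel_right])

/-- `Ad((x_i - c)^(β / eps i)) : y_i ↦ y_i - β (x_i - c)⁻¹`; the other generators are fixed. -/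
def adPow (i : Fin 3) (c β : F) : Skew F eps ≃ₐ[F] Skew F eps :=
  gauge (update 0 i (algebraMap F _ β * (pos eps i - algebraMap F _ c)⁻¹))
    (fun a b => by
      by_cases ha : a = i
      · subst ha
        rw [update_self]
        exact (Algebra.commute_algebraMap_left β _).mul_left
          (((pos_ne a b).sub_left (Algebra.commute_algebraMap_left c _)).inv_left₀)
      · rw [update_of_ne ha]; exact Commute.zero_left _)
    (fun a b => by
      by_cases ha : a = i <;> by_cases hb : b = i
      · rw [ha, hb]
      · rw [update_of_ne hb]; exact Commute.zero_right _
      · rw [update_of_ne ha]; exact Commute.zero_left _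
      · rw [update_of_ne ha]; exact Commute.zero_left _)
    (fun a b => by
      have key : ∀ a, a ≠ i → mom eps a * (algebraMap F _ β * (pos eps i - algebraMap F _ c)⁻¹) -
          (algebraMap F _ β * (pos eps i - algebraMap F _ c)⁻¹) * mom eps a = 0 := fun a ha =>
        sub_eq_zero.2 (Commute.mul_right (Algebra.commute_algebraMap_right β _)
          ((cross_ne ha).sub_right (Algebra.commute_algebraMap_right c _)).inv_right₀)
      by_cases ha : a = i <;> by_cases hb : b = i
      · rw [ha, hb]
      · subst ha; rw [update_self, update_of_ne hb, key b hb]; simp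
      · subst hb; rw [update_self, update_of_ne ha, key a ha]; simp
      · rw [update_of_ne ha, update_of_ne hb]; simp)
    (fun f hf a => by
      by_cases ha : a = i
      · subst ha; simp [hf]
      · rw [update_of_ne ha]; simp)

/-- `Ad(exp(x_i t / eps i)) : y_i ↦ y_i - t`, `d ↦ d - (eps 2 / eps i) x_i`, where `t`, `d` are the
generators with index `2`; the other generators are fixed. -/
def adExp (i : Fin 3) (hi : i ≠ 2) : Skew F eps ≃ₐ[F] Skew F eps :=
  gauge (update (update 0 2 (algebraMap F _ (eps 2 / eps i) * pos eps i)) i (pos eps 2))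
    (fun a b => by
      by_cases ha : a = i
      · subst ha; rw [update_self]; exact pos_ne _ _
      rw [update_of_ne ha]
      by_cases ha' : a = 2
      · subst ha'; rw [update_self]; exact (Algebra.commute_algebraMap_left _ _).mul_left (pos_ne _ _)
      · rw [update_of_ne ha']; exact Commute.zero_left _)
    (fun a b => by
      have h : ∀ a, ∃ c : F, ∃ j, update (update (0 : Fin 3 → Skew F eps) 2
          (algebraMap F (Skew F eps) (eps 2 / eps i) * pos eps i)) i (pos eps 2) a =
          algebraMap F _ c * pos eps j := by
        intro a
        by_cases ha : a = i
        · subst ha; exact ⟨1, 2, by simp⟩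
        rw [update_of_ne ha]
        by_cases ha' : a = 2
        · subst ha'; exact ⟨_, _, by rw [update_self]⟩
        · exact ⟨0, 0, by simp [ha']⟩
      obtain ⟨c, j, e⟩ := h a
      obtain ⟨c', j', e'⟩ := h b
      rw [e, e']
      exact (Algebra.commute_algebraMap_left c _).mul_left
        ((Algebra.commute_algebraMap_right c' _).mul_right (pos_ne _ _)))
    (fun a b => by
      have k1 : mom eps i * (algebraMap F _ (eps 2 / eps i) * pos eps i) -
          (algebraMap F _ (eps 2 / eps i) * pos eps i) * mom eps i = algebraMap F _ (eps 2) := by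
        rw [← mul_assoc, ← Algebra.commutes, mul_assoc, cross_self, mul_add, ← map_mul,
          div_mul_cancel₀ _ (he.out i), mul_assoc, add_sub_cancel_left]
      have k2 : ∀ a, a ≠ i → mom eps a * (algebraMap F _ (eps 2 / eps i) * pos eps i) -
          (algebraMap F _ (eps 2 / eps i) * pos eps i) * mom eps a = 0 := fun a ha =>
        sub_eq_zero.2 (Commute.mul_right (Algebra.commute_algebraMap_right _ _) (cross_ne ha))
      have k3 : mom eps 2 * pos eps 2 - pos eps 2 * mom eps 2 = algebraMap F _ (eps 2) := by
        rw [cross_self, add_sub_cancel_left]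
      have k4 : ∀ a, a ≠ 2 → mom eps a * pos eps 2 - pos eps 2 * mom eps a = 0 := fun a ha =>
        sub_eq_zero.2 (cross_ne ha)
      have h2 : (2 : Fin 3) ≠ i := hi.symm
      by_cases ha : a = i <;> by_cases hb : b = i
      · rw [ha, hb]
      · subst ha; rw [update_self, update_of_ne hb]
        by_cases hb' : b = 2
        · subst hb'; rw [update_self, k1, k3]
        · rw [update_of_ne hb', k4 b hb']; simp
      · subst hb; rw [update_self, update_of_ne ha]
        by_cases ha' : a = 2
        · subst ha'; rw [update_self, k1, k3]
        · rw [update_of_ne ha', k4 a ha']; simp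
      · rw [update_of_ne ha, update_of_ne hb]
        by_cases ha' : a = 2 <;> by_cases hb' : b = 2
        · rw [ha', hb']
        · subst ha'; rw [update_self, update_of_ne hb', k2 b hb]; simp
        · subst hb'; rw [update_self, update_of_ne ha', k2 a ha]; simp
        · rw [update_of_ne ha', update_of_ne hb']; simp)
    (fun f hf a => by
      by_cases ha : a = i
      · subst ha; rw [update_self, hf]
      rw [update_of_ne ha]
      by_cases ha' : a = 2
      · subst ha'; rw [update_self, map_mul, AlgHom.commutes, hf]
      · rw [update_of_ne ha']; simp)

/-- The substitution `t ↦ -t`, which maps `d ↦ -d`. -/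
def negT : Skew F eps ≃ₐ[F] Skew F eps :=
  auto (X := update (pos eps) 2 (-pos eps 2)) (Y := update (mom eps) 2 (-mom eps 2))
    negT_canon negT_canon
    (fun a => by by_cases ha : a = 2 <;> [subst ha; skip] <;> simp_all)
    (fun a => by by_cases ha : a = 2 <;> [subst ha; skip] <;> simp_all)
    (fun a => by by_cases ha : a = 2 <;> [subst ha; skip] <;> simp_all)
    (fun a => by by_cases ha : a = 2 <;> [subst ha; skip] <;> simp_all)

/-- The substitution `x_i ↦ x_i - c`. -/
def shift (i : Fin 3) (c : F) : Skew F eps ≃ₐ[F] Skew F eps :=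
  auto (X := update (pos eps) i (pos eps i - algebraMap F _ c)) (Y := mom eps)
    (X' := update (pos eps) i (pos eps i + algebraMap F _ c)) (Y' := mom eps)
    (shift_canon i c) (by simpa using shift_canon (eps := eps) i (-c))
    (fun a => by by_cases ha : a = i <;> [subst ha; skip] <;> simp_all)
    (fun a => by simp)
    (fun a => by by_cases ha : a = i <;> [subst ha; skip] <;> simp_all)
    (fun a => by simp)

theorem mom_inv : mom eps 2 * (pos eps 2)⁻¹ = (pos eps 2)⁻¹ * mom eps 2 -
    algebraMap F _ (eps 2) * (pos eps 2)⁻¹ * (pos eps 2)⁻¹ := by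
  have h0 := pos_ne_zero (eps := eps) 2
  apply mul_left_cancel₀ h0
  apply mul_right_cancel₀ h0
  rw [mul_assoc, mul_assoc, inv_mul_cancel₀ h0, mul_one, mul_sub, sub_mul, mul_inv_cancel_left₀ h0,
    ← mul_assoc, mul_assoc (_ * _), inv_mul_cancel₀ h0, mul_one, ← mul_assoc,
    ← Algebra.commutes, mul_assoc (algebraMap F (Skew F eps) _), mul_inv_cancel₀ h0, mul_one,
    cross_self, add_sub_cancel_right]

theorem scale_canon₁ (i : Fin 3) (hi : i ≠ 2) :
    Canon eps (update (pos eps) i (pos eps 2 * pos eps i))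
      (update (update (mom eps) 2 (mom eps 2 -
        algebraMap F _ (eps 2 / eps i) * (pos eps 2)⁻¹ * pos eps i * mom eps i)) i
          ((pos eps 2)⁻¹ * mom eps i)) := by
  have h0 := pos_ne_zero (eps := eps) 2
  have ec : eps i * (eps 2 / eps i) = eps 2 := mul_div_cancel₀ _ (he.out i)
  refine scale_canon i hi _ _ _ (inv_mul_cancel₀ h0) (fun a => pos_ne 2 a)
    (fun a ha => (cross_ne ha).symm) (fun a => (pos_ne 2 a).inv_left₀)
    (fun a ha => (cross_ne ha).symm.inv_left₀)
    (fun a => (Algebra.commute_algebraMap_left _ _).mul_left (pos_ne 2 a).inv_left₀)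
    (fun a ha => (Algebra.commute_algebraMap_left _ _).mul_left (cross_ne ha).symm.inv_left₀)
    ((Algebra.commute_algebraMap_left _ _).mul_left (Commute.refl _).inv_left₀)
    ((Algebra.commute_algebraMap_left _ _).mul_left (Commute.refl _)) ?_ ?_
  · rw [← mul_assoc, ← map_mul, ec, mul_assoc, inv_mul_cancel₀ h0, mul_one, cross_self]
  · rw [← mul_assoc, ← map_mul, ec, mom_inv]

theorem scale_canon₂ (i : Fin 3) (hi : i ≠ 2) :
    Canon eps (update (pos eps) i ((pos eps 2)⁻¹ * pos eps i))
      (update (update (mom eps) 2 (mom eps 2 +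
        algebraMap F _ (eps 2 / eps i) * (pos eps 2)⁻¹ * pos eps i * mom eps i)) i
          (pos eps 2 * mom eps i)) := by
  have h0 := pos_ne_zero (eps := eps) 2
  have ec : eps i * (eps 2 / eps i) = eps 2 := mul_div_cancel₀ _ (he.out i)
  have := scale_canon i hi (pos eps 2)⁻¹ (pos eps 2)
    (-(algebraMap F (Skew F eps) (eps 2 / eps i) * (pos eps 2)⁻¹)) (mul_inv_cancel₀ h0)
    (fun a => (pos_ne 2 a).inv_left₀) (fun a ha => (cross_ne ha).symm.inv_left₀)
    (fun a => pos_ne 2 a) (fun a ha => (cross_ne ha).symm)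
    (fun a => ((Algebra.commute_algebraMap_left _ _).mul_left (pos_ne 2 a).inv_left₀).neg_left)
    (fun a ha =>
      ((Algebra.commute_algebraMap_left _ _).mul_left (cross_ne ha).symm.inv_left₀).neg_left)
    ((Algebra.commute_algebraMap_left _ _).mul_left (Commute.refl _)).neg_left
    ((Algebra.commute_algebraMap_left _ _).mul_left (Commute.refl _).inv_left₀).neg_left
    (by rw [mul_neg, neg_mul, ← mul_assoc, ← map_mul, ec, mom_inv, sub_eq_add_neg])
    (by rw [mul_neg, neg_mul, ← mul_assoc, ← map_mul, ec, mul_assoc (algebraMap F _ _),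
          inv_mul_cancel₀ h0, mul_one, cross_self, sub_neg_eq_add])
  simpa only [neg_mul, sub_neg_eq_add] using this

/-- The substitution `x_i ↦ t x_i`, under which `y_i ↦ t⁻¹ y_i` and
`d ↦ d - (eps 2 / eps i) t⁻¹ x_i y_i`. -/
def scale (i : Fin 3) (hi : i ≠ 2) : Skew F eps ≃ₐ[F] Skew F eps :=
  have h0 := pos_ne_zero (eps := eps) 2
  have h2 : (2 : Fin 3) ≠ i := hi.symm
  have k1 : ∀ z, pos eps 2 * (pos eps i * ((pos eps 2)⁻¹ * z)) = pos eps i * z := fun z => by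
    rw [← mul_assoc (pos eps i), ((pos_ne i 2).inv_right₀).eq, mul_assoc, mul_inv_cancel_left₀ h0]
  have k2 : ∀ z, (pos eps 2)⁻¹ * (pos eps i * (pos eps 2 * z)) = pos eps i * z := fun z => by
    rw [← mul_assoc (pos eps i), (pos_ne i 2).eq, mul_assoc, inv_mul_cancel_left₀ h0]
  auto
    (X := update (pos eps) i (pos eps 2 * pos eps i))
    (Y := update (update (mom eps) 2 (mom eps 2 -
        algebraMap F _ (eps 2 / eps i) * (pos eps 2)⁻¹ * pos eps i * mom eps i)) i
          ((pos eps 2)⁻¹ * mom eps i))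
    (X' := update (pos eps) i ((pos eps 2)⁻¹ * pos eps i))
    (Y' := update (update (mom eps) 2 (mom eps 2 +
        algebraMap F _ (eps 2 / eps i) * (pos eps 2)⁻¹ * pos eps i * mom eps i)) i
          (pos eps 2 * mom eps i))
    (scale_canon₁ i hi) (scale_canon₂ i hi)
    (fun a => by
      by_cases ha : a = i
      · subst ha; simp [update_of_ne h2, inv_mul_cancel_left₀ h0]
      · simp [update_of_ne ha])
    (fun a => by
      by_cases ha : a = i
      · subst ha; simp [update_of_ne h2, mul_inv_cancel_left₀ h0]
      · by_cases ha' : a = 2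
        · subst ha'
          rw [update_of_ne h2, update_self, map_add, map_mul, map_mul, map_mul, AlgHom.commutes,
            map_inv₀, lift_mom, lift_mom, lift_pos, lift_pos, update_self, update_self,
            update_of_ne h2, update_of_ne h2, update_self]
          simp only [mul_assoc]
          rw [k1, sub_add_cancel]
        · simp [update_of_ne ha, update_of_ne ha'])
    (fun a => by
      by_cases ha : a = i
      · subst ha; simp [update_of_ne h2, mul_inv_cancel_left₀ h0]
      · simp [update_of_ne ha])
    (fun a => by
      by_cases ha : a = i
      · subst ha; simp [update_of_ne h2, inv_mul_cancel_left₀ h0]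
      · by_cases ha' : a = 2
        · subst ha'
          rw [update_of_ne h2, update_self, map_sub, map_mul, map_mul, map_mul, AlgHom.commutes,
            map_inv₀, lift_mom, lift_mom, lift_pos, lift_pos, update_self, update_self,
            update_of_ne h2, update_of_ne h2, update_self]
          simp only [mul_assoc]
          rw [k2, add_sub_cancel_right]
        · simp [update_of_ne ha, update_of_ne ha'])

/-- The substitution `x_i ↦ t (x_i - 1)`, under which `y_i ↦ t⁻¹ y_i` and
`d ↦ d - (eps 2 / eps i) t⁻¹ (x_i - 1) y_i`. -/
def affine (i : Fin 3) (hi : i ≠ 2) : Skew F eps ≃ₐ[F] Skew F eps := shift i 1 * scale i hi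

section values
open Function

theorem auto_pos {X Y X' Y' : Fin 3 → Skew F eps} (h : Canon eps X Y) (h' : Canon eps X' Y')
    (hX hY hX' hY') (i : Fin 3) : auto h h' hX hY hX' hY' (pos eps i) = X i := lift_pos h i
theorem auto_mom {X Y X' Y' : Fin 3 → Skew F eps} (h : Canon eps X Y) (h' : Canon eps X' Y')
    (hX hY hX' hY') (i : Fin 3) : auto h h' hX hY hX' hY' (mom eps i) = Y i := lift_mom h i

theorem scale_pos (i : Fin 3) (hi : i ≠ 2) (a : Fin 3) :
    scale i hi (pos eps a) = update (pos eps) i (pos eps 2 * pos eps i) a := by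
  rw [scale, auto_pos]
theorem scale_mom (i : Fin 3) (hi : i ≠ 2) (a : Fin 3) :
    scale i hi (mom eps a) = update (update (mom eps) 2 (mom eps 2 -
        algebraMap F _ (eps 2 / eps i) * (pos eps 2)⁻¹ * pos eps i * mom eps i)) i
          ((pos eps 2)⁻¹ * mom eps i) a := by
  rw [scale, auto_mom]
theorem shift_pos (i : Fin 3) (c : F) (a : Fin 3) :
    shift i c (pos eps a) = update (pos eps) i (pos eps i - algebraMap F _ c) a := by
  rw [shift, auto_pos]
theorem shift_mom (i : Fin 3) (c : F) (a : Fin 3) : shift i c (mom eps a) = mom eps a := by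
  rw [shift, auto_mom]

theorem laplace_pos (i : Fin 3) : laplace i (pos eps i) = -mom eps i := by simp [laplace, auto]
theorem laplace_mom (i : Fin 3) : laplace i (mom eps i) = pos eps i := by simp [laplace, auto]
theorem laplace_pos_ne {i a : Fin 3} (h : a ≠ i) : laplace i (pos eps a) = pos eps a := by
  simp [laplace, auto, h]
theorem laplace_mom_ne {i a : Fin 3} (h : a ≠ i) : laplace i (mom eps a) = mom eps a := by
  simp [laplace, auto, h]

theorem adPow_pos (i : Fin 3) (c β : F) (a : Fin 3) : adPow i c β (pos eps a) = pos eps a := by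
  simp [adPow, gauge, auto]
theorem adPow_mom (i : Fin 3) (c β : F) : adPow i c β (mom eps i) =
    mom eps i - algebraMap F _ β * (pos eps i - algebraMap F _ c)⁻¹ := by
  simp [adPow, gauge, auto]
theorem adPow_mom_ne {i a : Fin 3} (h : a ≠ i) (c β : F) :
    adPow i c β (mom eps a) = mom eps a := by
  simp [adPow, gauge, auto, h]

theorem adExp_pos (i : Fin 3) (hi : i ≠ 2) (a : Fin 3) : adExp i hi (pos eps a) = pos eps a := by
  simp [adExp, gauge, auto]
theorem adExp_mom (i : Fin 3) (hi : i ≠ 2) :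
    adExp i hi (mom eps i) = mom eps i - pos eps 2 := by
  simp [adExp, gauge, auto]
theorem adExp_mom_two (i : Fin 3) (hi : i ≠ 2) :
    adExp i hi (mom eps 2) = mom eps 2 - algebraMap F _ (eps 2 / eps i) * pos eps i := by
  simp [adExp, gauge, auto, update_of_ne hi.symm]
theorem adExp_mom_ne {i a : Fin 3} (hi : i ≠ 2) (h : a ≠ i) (h' : a ≠ 2) :
    adExp i hi (mom eps a) = mom eps a := by
  simp [adExp, gauge, auto, h, h']

theorem negT_pos_two : negT (pos eps 2) = -pos eps 2 := by simp [negT, auto]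
theorem negT_mom_two : negT (mom eps 2) = -mom eps 2 := by simp [negT, auto]
theorem negT_pos_ne {a : Fin 3} (h : a ≠ 2) : negT (pos eps a) = pos eps a := by
  simp [negT, auto, h]
theorem negT_mom_ne {a : Fin 3} (h : a ≠ 2) : negT (mom eps a) = mom eps a := by
  simp [negT, auto, h]

theorem affine_pos (i : Fin 3) (hi : i ≠ 2) :
    affine i hi (pos eps i) = pos eps 2 * (pos eps i - 1) := by
  rw [affine, AlgEquiv.mul_apply, scale_pos, update_self, map_mul, shift_pos, shift_pos,
    update_self, update_of_ne hi.symm, map_one]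
theorem affine_mom (i : Fin 3) (hi : i ≠ 2) :
    affine i hi (mom eps i) = (pos eps 2)⁻¹ * mom eps i := by
  rw [affine, AlgEquiv.mul_apply, scale_mom, update_self, map_mul, map_inv₀, shift_pos, shift_mom,
    update_of_ne hi.symm]
theorem affine_mom_two (i : Fin 3) (hi : i ≠ 2) : affine i hi (mom eps 2) = mom eps 2 -
    algebraMap F _ (eps 2 / eps i) * (pos eps 2)⁻¹ * (pos eps i - 1) * mom eps i := by
  rw [affine, AlgEquiv.mul_apply, scale_mom, update_of_ne hi.symm, update_self, map_sub, map_mul,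
    map_mul, map_mul, AlgEquiv.commutes, map_inv₀, shift_pos, shift_pos, shift_mom, shift_mom,
    update_self, update_of_ne hi.symm, map_one]
theorem affine_pos_ne {i a : Fin 3} (hi : i ≠ 2) (h : a ≠ i) :
    affine i hi (pos eps a) = pos eps a := by
  rw [affine, AlgEquiv.mul_apply, scale_pos, update_of_ne h, shift_pos, update_of_ne h]
theorem affine_mom_ne {i a : Fin 3} (hi : i ≠ 2) (h : a ≠ i) (h' : a ≠ 2) :
    affine i hi (mom eps a) = mom eps a := by
  rw [affine, AlgEquiv.mul_apply, scale_mom, update_of_ne h, update_of_ne h', shift_mom]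

end values

/-- `Ad(u) : z ↦ u z u⁻¹` -/
def ad (u : Skew F eps) (hu : u ≠ 0) : Skew F eps ≃ₐ[F] Skew F eps where
  toFun z := u * z * u⁻¹
  invFun z := u⁻¹ * z * u
  left_inv z := by
    simp only [mul_assoc, inv_mul_cancel₀ hu, mul_one]
    rw [inv_mul_cancel_left₀ hu]
  right_inv z := by
    simp only [mul_assoc, mul_inv_cancel₀ hu, mul_one]
    rw [mul_inv_cancel_left₀ hu]
  map_mul' a b := by simp only [mul_assoc]; rw [inv_mul_cancel_left₀ hu]
  map_add' a b := by rw [mul_add, add_mul]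
  commutes' c := by rw [← Algebra.commutes, mul_assoc, mul_inv_cancel₀ hu, mul_one]

end automorphisms
end Skew

/-- Polynomials in the independent central parameters: `none` stands for `ε₁` and `some i` for
`α_i`. -/
abbrev ParPoly := MvPolynomial (Option (Fin 4)) ℂ

/-- The field `ℂ(α₀, α₁, α₂, α₃, ε₁)` of parameters. -/
def Par : Type := FractionRing ParPoly

instance : Field Par := inferInstanceAs (Field (FractionRing ParPoly))
instance : Algebra ParPoly Par := inferInstanceAs (Algebra ParPoly (FractionRing ParPoly))
instance : Algebra ℂ Par := inferInstanceAs (Algebra ℂ (FractionRing ParPoly))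
instance : IsFractionRing ParPoly Par :=
  inferInstanceAs (IsFractionRing ParPoly (FractionRing ParPoly))
instance : IsScalarTower ℂ ParPoly Par :=
  inferInstanceAs (IsScalarTower ℂ ParPoly (FractionRing ParPoly))
instance : CharZero Par := charZero_of_injective_algebraMap (algebraMap ℂ Par).injective

/-- The parameters `α_i`. -/
def α (i : Fin 4) : Par := algebraMap ParPoly Par (X (some i))
/-- The parameter `ε₁`. -/
def ε₁ : Par := algebraMap ParPoly Par (X none)
/-- The parameter `ε₂`, determined by `α₀ + α₁ + α₂ + α₃ = -ε₁ + ε₂`. -/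
def ε₂ : Par := α 0 + α 1 + α 2 + α 3 + ε₁
/-- `κ = ε₁ - ε₂`. -/
def κ : Par := ε₁ - ε₂

theorem α_sum : α 0 + α 1 + α 2 + α 3 = -ε₁ + ε₂ := by rw [ε₂]; ring

theorem ε₁_ne_zero : ε₁ ≠ 0 := by
  rw [ε₁, Ne, IsFractionRing.to_map_eq_zero_iff]
  exact X_ne_zero _

theorem ε₂_ne_zero : ε₂ ≠ 0 := by
  rw [ε₂, α, α, α, α, ε₁]
  simp only [← map_add]
  rw [Ne, IsFractionRing.to_map_eq_zero_iff]
  intro h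
  have := congrArg (aeval fun o : Option (Fin 4) => if o = none then (1 : ℂ) else 0) h
  simp at this

/-- The values of the commutators `[y, x]`, `[p, q]`, `[d, t]`. -/
def epsV : Fin 3 → Par := ![ε₁, ε₂, 1]

instance : Fact (∀ i, epsV i ≠ 0) := ⟨fun i => by
  fin_cases i
  · exact ε₁_ne_zero
  · exact ε₂_ne_zero
  · exact one_ne_zero⟩

/-! ### The extended affine Weyl group acting on the parameters -/

/-- Substitution `α_i ↦ f i`, `ε₁ ↦ ε₁`. -/
def substPar (f : Fin 4 → ParPoly) : ParPoly →ₐ[ℂ] ParPoly :=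
  aeval fun o => o.elim (X none) f

/-- The images of the `α_j` under the simple reflection `s_i`; indices are read modulo `4`. -/
def reflPoly (i j : Fin 4) : ParPoly :=
  if j = i then -X (some i)
  else if j = i + 1 ∨ j = i - 1 then X (some j) + X (some i) else X (some j)

theorem substPar_reflPoly (i : Fin 4) : (substPar (reflPoly i)).comp (substPar (reflPoly i)) = AlgHom.id ℂ ParPoly := by
  apply MvPolynomial.algHom_ext
  rintro (_ | j)
  · simp [substPar]
  · simp only [AlgHom.comp_apply, substPar, aeval_X, Option.elim, AlgHom.id_apply, reflPoly]
    split_ifs <;> simp_all [reflPoly]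

/-- An automorphism of the polynomial ring acts on the field of fractions. -/
def toPar : (ParPoly ≃ₐ[ℂ] ParPoly) → (Par ≃ₐ[ℂ] Par) :=
  fun e => IsFractionRing.algEquivOfAlgEquiv e

/-- `s_i : α_i ↦ -α_i`, `α_{i±1} ↦ α_{i±1} + α_i`, `α_{i+2} ↦ α_{i+2}`. -/
def s (i : Fin 4) : Par ≃ₐ[ℂ] Par :=
  toPar (AlgEquiv.ofAlgHom (substPar (reflPoly i)) (substPar (reflPoly i)) (substPar_reflPoly i) (substPar_reflPoly i))

/-- `π : α_j ↦ α_{j+1}`. -/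
def π : Par ≃ₐ[ℂ] Par := toPar (renameEquiv ℂ (Equiv.optionCongr (Equiv.addRight 1)))

/-- `σ : α_j ↦ α_{2-j}`, that is `α₀ ↔ α₂`. -/
def σ : Par ≃ₐ[ℂ] Par := toPar (renameEquiv ℂ (Equiv.optionCongr (Equiv.subLeft 2)))

theorem toPar_algebraMap (e : ParPoly ≃ₐ[ℂ] ParPoly) (a : ParPoly) :
    toPar e (algebraMap ParPoly Par a) = algebraMap ParPoly Par (e a) :=
  IsFractionRing.algEquivOfAlgEquiv_algebraMap e a

theorem s_self (i : Fin 4) : s i (α i) = -α i := by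
  rw [α, s, toPar_algebraMap, ← map_neg]; simp [substPar, reflPoly]
theorem s_adj {i j : Fin 4} (h : j = i + 1 ∨ j = i - 1) : s i (α j) = α j + α i := by
  have h' : j ≠ i := by revert h; revert i j; decide
  rw [α, α, s, toPar_algebraMap, ← map_add]; simp [substPar, reflPoly, h, h']
theorem s_far (i : Fin 4) : s i (α (i + 2)) = α (i + 2) := by
  have h' : reflPoly i (i + 2) = X (some (i + 2)) := by
    have h1 : i + 2 ≠ i := by revert i; decide
    have h2 : ¬ (i + 2 = i + 1 ∨ i + 2 = i - 1) := by revert i; decide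
    rw [reflPoly, if_neg h1, if_neg h2]
  rw [α, s, toPar_algebraMap]; simp [substPar, h']
theorem s_ε₁ (i : Fin 4) : s i ε₁ = ε₁ := by
  rw [ε₁, s, toPar_algebraMap]; simp [substPar]
theorem π_α (j : Fin 4) : π (α j) = α (j + 1) := by
  rw [α, α, π, toPar_algebraMap]; simp
theorem π_ε₁ : π ε₁ = ε₁ := by rw [ε₁, π, toPar_algebraMap]; simp
theorem σ_α (j : Fin 4) : σ (α j) = α (2 - j) := by
  rw [α, α, σ, toPar_algebraMap]; simp
theorem σ_ε₁ : σ ε₁ = ε₁ := by rw [ε₁, σ, toPar_algebraMap]; simp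

/-- `w(α) = (w(α₀), w(α₁), w(α₂), w(α₃))`. -/
def act (w : Par ≃ₐ[ℂ] Par) : Fin 4 → Par := fun i => w (α i)

/-! ### The skew field and the Lax operators -/

/-- The skew field generated over `ℂ` by `x, y, q, p, t, d` and the central parameters, with
`[y, x] = ε₁`, `[p, q] = ε₂`, `[d, t] = 1` and all other commutators zero. -/
abbrev K := Skew Par epsV

abbrev x : K := Skew.pos epsV 0
abbrev q : K := Skew.pos epsV 1
abbrev t : K := Skew.pos epsV 2
abbrev y : K := Skew.mom epsV 0
abbrev p : K := Skew.mom epsV 1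
abbrev d : K := Skew.mom epsV 2

/-- The parameters as elements of the skew field. -/
abbrev sc : Par →+* K := algebraMap Par K

theorem comm_yx : y * x - x * y = sc ε₁ := sub_eq_iff_eq_add'.2 (Skew.cross_self 0)
theorem comm_pq : p * q - q * p = sc ε₂ := sub_eq_iff_eq_add'.2 (Skew.cross_self 1)
theorem comm_dt : d * t - t * d = 1 :=
  (sub_eq_iff_eq_add'.2 (Skew.cross_self 2)).trans (map_one sc)

/-- The Hamiltonian of the quantum fifth Painlevé equation: `H 0 a` is `H^x(a)`, and `H 1 a` is
`H^q(a)`. -/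
def H (i : Fin 3) (a : Fin 4 → Par) : K :=
  let X := Skew.pos epsV i
  let Y := Skew.mom epsV i
  (X - 1) * (Y + t) * X * Y - sc (a 1 + a 3 - epsV i) * X * Y + sc (a 1) * Y
    + sc (a 2 + epsV i) * t * X

/-- `(a₀ + κ, a₁, a₂ + κ, a₃)`. -/
def shiftPar (a : Fin 4 → Par) : Fin 4 → Par := ![a 0 + κ, a 1, a 2 + κ, a 3]

/-- The Lax operator `L_V(a)`. -/
def L (a : Fin 4 → Par) : K :=
  H 0 a - H 1 (shiftPar a) - sc κ * (x - q)⁻¹ * (x * (x - 1) * y - q * (q - 1) * p)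

/-- The Lax operator `B_V(a)`. -/
def B (a : Fin 4 → Par) : K :=
  sc ε₂ * H 0 a - sc ε₁ * H 1 (shiftPar a) - sc (κ * ε₁ * ε₂) * t * d

/-- `D(b)`. -/
def D (b : Par) : K :=
  y * p + sc (b + ε₁) * (x - q)⁻¹ * y + sc (b + ε₁) * (q - x)⁻¹ * p

theorem D_ne_zero (b : Par) : D b ≠ 0 := by
  intro h
  set u : K := (x - q)⁻¹ with hu
  set c : K := sc (b + ε₁)
  have hc : ∀ z : K, c * z = z * c := fun z => Algebra.commutes _ z
  have ex : ∀ z : K, sc ε₁ * z = z * sc ε₁ := fun z => Algebra.commutes _ z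
  have hqx : (q - x)⁻¹ = -u := by rw [hu, ← inv_neg, neg_sub]
  have hux : u * x = x * u := (((Commute.refl x).sub_left (Skew.pos_ne 1 0)).inv_left₀).eq
  have huq : u * q = q * u := (((Skew.pos_ne 0 1).sub_left (Commute.refl q)).inv_left₀).eq
  have hpx : p * x = x * p := (Skew.cross_ne (by decide)).eq
  have hyx : y * x = x * y + sc ε₁ := Skew.cross_self 0
  have hpq : p * q = q * p + sc ε₂ := Skew.cross_self 1
  have h1 : D b * x - x * D b = sc ε₁ * (p + c * u) := by
    have e1 : y * p * x = x * y * p + sc ε₁ * p := by rw [mul_assoc, hpx, ← mul_assoc, hyx, add_mul]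
    have e2 : c * u * y * x = x * (c * u * y) + sc ε₁ * (c * u) := by
      rw [mul_assoc (c * u), hyx, mul_add, ex, ← mul_assoc, mul_assoc c u x, hux, ← mul_assoc c,
        hc x]
      simp only [mul_assoc]
    have e3 : c * u * p * x = x * (c * u * p) := by
      rw [mul_assoc (c * u), hpx, ← mul_assoc, mul_assoc c u x, hux, ← mul_assoc c, hc x]
      simp only [mul_assoc]
    rw [D, hqx]
    simp only [mul_neg, neg_mul, add_mul, mul_add]
    rw [e1, e2, e3]
    simp only [mul_assoc]
    abel
  have h2 : sc ε₁ * (p + c * u) = 0 := by rw [← h1, h]; simp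
  have h3 : p + c * u = 0 := by
    rcases mul_eq_zero.1 h2 with h | h
    · exact absurd ((map_eq_zero _).1 h) ε₁_ne_zero
    · exact h
  have h4 : (p + c * u) * q - q * (p + c * u) = sc ε₂ := by
    have e : c * u * q = q * (c * u) := by rw [mul_assoc, huq, ← mul_assoc, hc q, mul_assoc]
    rw [add_mul, mul_add, e, hpq]; abel
  rw [h3, zero_mul, mul_zero, sub_zero] at h4
  exact ε₂_ne_zero ((map_eq_zero _).1 h4.symm)

/-! ### The automorphisms

In the names below, the index `i = 0` gives the automorphism with superscript `x` and `i = 1` the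
one with superscript `q`. All of them fix the parameters. A product `f * g` of automorphisms is the
composite `f ∘ g`. -/

/-- `R^x_{s₁}(b) = Ad(x^(-b/ε₁))`, and likewise for `q`. -/
def Rs1 (i : Fin 3) (b : Par) : K ≃ₐ[Par] K := Skew.adPow i 0 (-b)

/-- `R^x_{s₂}(b) = 𝓛⁻¹ ∘ Ad(x^(-b/ε₁)) ∘ 𝓛`, and likewise for `q`. -/
def Rs2 (i : Fin 3) (b : Par) : K ≃ₐ[Par] K :=
  (Skew.laplace i)⁻¹ * Skew.adPow i 0 (-b) * Skew.laplace i

/-- `R^x_{s₃}(b) = Ad((x-1)^(-b/ε₁))`, and likewise for `q`. -/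
def Rs3 (i : Fin 3) (b : Par) : K ≃ₐ[Par] K := Skew.adPow i 1 (-b)

/-- `R^x_π = (x ↦ t(x-1)) ∘ 𝓛`. -/
def Rxπ : K ≃ₐ[Par] K := Skew.affine 0 (by decide) * Skew.laplace 0

/-- `R^q_π = (q ↦ t(q-1)) ∘ 𝓛`. -/
def Rqπ : K ≃ₐ[Par] K := Skew.affine 1 (by decide) * Skew.laplace 1

/-- `Ad(exp(xt/ε₁))`. -/
def adExpX : K ≃ₐ[Par] K := Skew.adExp 0 (by decide)

/-- `Ad(exp(qt/ε₂))`. -/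
def adExpQ : K ≃ₐ[Par] K := Skew.adExp 1 (by decide)

/-- `t ↦ -t`. -/
def negT : K ≃ₐ[Par] K := Skew.negT

/-- `R_σ`. -/
def Rσ : K ≃ₐ[Par] K := negT * adExpX * adExpQ

/-- `R_{s₁}`. -/
def R1 : K ≃ₐ[Par] K := Rs1 0 (α 1) * Rs1 1 (α 1)

/-- `R_{s₃}`. -/
def R3 : K ≃ₐ[Par] K := Rs3 0 (α 3) * Rs3 1 (α 3)

/-- `R_π`. -/
def Rπ : K ≃ₐ[Par] K := Rxπ * Rqπ

/-- `ᾱ_i = α_i + α₂ + κ`. -/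
def αbar (i : Fin 4) : Par := α i + α 2 + κ

/-- `T_{σ s₁ s₃ s₂}`. -/
def Tσ : K ≃ₐ[Par] K :=
  Rs2 0 (-α 2 - κ) * Rs1 0 (α 1) * Rs3 0 (α 3) * Rσ
    * Rs1 1 (αbar 1) * Rs3 1 (αbar 3) * Rs2 1 (α 2 + κ)

/-- The factors of `T_{s₁ s₂ s₃ π⁻¹}` with superscript `q`. -/
def Tπq : K ≃ₐ[Par] K :=
  Rs1 1 (-α 1 + κ) * Rs2 1 (-s 1 (α 2)) * Rs3 1 (-(s 1 * s 2) (α 3)) * Rqπ⁻¹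

/-- `T_{s₁ s₂ s₃ π⁻¹}`. -/
def Tπ : K ≃ₐ[Par] K :=
  Rxπ * Rs3 0 ((s 1 * s 2) (α 3)) * Rs2 0 (s 1 (α 2)) * Rs1 0 (α 1) * Tπq

/-- `R^x_{s₂}(α₂) R^q_{s₂}(α₂ + κ)`. -/
def RS : K ≃ₐ[Par] K := Rs2 0 (α 2) * Rs2 1 (α 2 + κ)

/-- `S = Ad(D(α₂)⁻¹) R^x_{s₂}(α₂) R^q_{s₂}(α₂ + κ)`. -/
def S : K ≃ₐ[Par] K := Skew.ad (D (α 2))⁻¹ (inv_ne_zero (D_ne_zero _)) * RS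

/-- `(α₀, α₁ + α₂ + ε₁, -α₂ - 2ε₁, α₃ + α₂ + ε₁)`. -/
def αS : Fin 4 → Par := ![α 0, α 1 + α 2 + ε₁, -α 2 - 2 * ε₁, α 3 + α 2 + ε₁]

/-! ### The left multipliers -/

/-- The rational functions of `x`, `q`, `t` and the parameters. -/
def ratFun : Subfield K := Subfield.closure (Set.range sc ∪ {x, q, t})

/-- The left multiplier for `T_{σ s₁ s₃ s₂}`. -/
def lσ : K :=
  let P := p + t + sc (αbar 1) * q⁻¹ + sc (αbar 3) * (q - 1)⁻¹
  ((x - q) * y * P + sc (α 2 + κ) * (y + P))⁻¹ * ((x - q) * P * y)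

/-- `a₀₃p³ - (q-1)/(x-1) yp² + a₀₂p² + (α₃-ε₂+t(1-q)(1+x))/(x-1) yp + a₁₀y + a₀₁p + a₀₀`. -/
def opA (a : ℕ → ℕ → K) : K :=
  a 0 3 * p ^ 3 - (q - 1) * (x - 1)⁻¹ * y * p ^ 2 + a 0 2 * p ^ 2
    + (sc (α 3 - ε₂) + t * (1 - q) * (1 + x)) * (x - 1)⁻¹ * y * p
    + a 1 0 * y + a 0 1 * p + a 0 0

/-- `y³ + b₂₁y²p + b₂₀y² + b₁₁yp + b₁₀y + b₀₁p + b₀₀`. -/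
def opB (b : ℕ → ℕ → K) : K :=
  y ^ 3 + b 2 1 * y ^ 2 * p + b 2 0 * y ^ 2 + b 1 1 * y * p + b 1 0 * y + b 0 1 * p + b 0 0

/-- The left multiplier for `T_{s₁ s₂ s₃ π⁻¹}` attached to the operators `u`, `v`. -/
def lπ (u v : K) : K :=
  (Tπq (v * Rqπ ((q - 1) * Rs3 1 ((s 1 * s 2) (α 3)) p)))⁻¹
    * Tπq (u * Rxπ ((x - 1) * Rs3 0 ((s 1 * s 2) (α 3)) y))

end QW

end

open QW

set_option linter.unusedSectionVars false
set_option linter.unusedSimpArgs false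
set_option linter.unusedVariables false
set_option linter.unnecessarySeqFocus false
set_option linter.unreachableTactic false
set_option linter.unusedTactic false

noncomputable section
namespace QW

/-! The rational functions of `x`, `q`, `t` and the parameters form a commutative field `RatFun`,
and the skew field is a left vector space over it. Moving a coefficient to the left across `y`, `p`
or `d` costs a derivative of that coefficient. Hence every element that is polynomial in the momenta
is a sum of terms `r • (y^i p^j d^k)`, and two such elements are equal as soon as their coefficients
agree, which is commutative algebra in `RatFun`. This reduction (`inv_rules`, `atom_rules`,
`order_rules`, `der_rules`, then `match_scalars`) settles the claims on `s₁`, `s₃`, `σ` and on the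
squares of the rotations directly.

The reflection `s₂` is not of this kind, since it sends `x` to `x - b y⁻¹`. For the Hamiltonian the
inverse momentum cancels, because the coefficient of `t x` is tied to the parameter of the
reflection (`Ham_sub_inv`); so the claims on `B` for the long words follow by tracking the
parameters of the Hamiltonians through the factors. For `(x - q) L` the term with factor `κ` keeps
`y⁻¹`, and a left factor `y` removes it (`mom_mul_sub_mul`).

For a word `T`, the factors in `x` commute with those in `q` (`OnlyX.commute`), although both kinds
move `d`. Applying a suitable automorphism to the claim therefore leaves the `x` factors on one side
and the `q` factors on the other (`Ψσ_mul_Tσ`, `Θπ_mul_Tπ`). For `σ s₁ s₃ s₂` the result is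
`σ_identity`, a comparison of polynomial operators, and `Ψσ_lσ` translates the multiplier.

For `s₁ s₂ s₃ π⁻¹` the cleared sides are, up to sign, `t⁻¹` times two operators `num` and `num'` of
order four, written in the shifted coordinates `x - 1`, `q - 1`, `y + t`, `p + t`, and a common left
multiple of the two has to be exhibited. The combination of `num` and `num'` that cancels the
leading terms (`rel₃`) is an `R`-combination of two operators `syz₁`, `syz₂`. So are suitable
corrections of its left multiples by `y` and by `p` (`rel₁`, `rel₂`). Three vectors in a span of two
elements are dependent, with the minors as coefficients, and this dependence is the required
relation `mulNum_num`. The `Frame` structure permits the relations to be used both with `x` and `q`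
interchanged and in the shifted coordinates.

For `S`, the conjugation by `D` is multiplied out. Powers of `x - q` on the left and on the right
then turn both claims into identities between operators without denominators. -/

/-- Two commuting momenta `y`, `p` acting on a field `R` of coefficients by derivations, inside a
ring `K` which is a left vector space over `R`. -/
structure Frame (C R K : Type*) [Field C] [Field R] [Algebra C R] [Ring K] [Module R K]
    [IsScalarTower R K K] where
  x : R
  q : R
  t : R
  y : K
  p : K
  e₁ : C
  e₂ : C
  D₁ : Derivation C R R
  D₂ : Derivation C R R
  y_smul : ∀ (r : R) (k : K), y * (r • k) = r • (y * k) + D₁ r • k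
  p_smul : ∀ (r : R) (k : K), p * (r • k) = r • (p * k) + D₂ r • k
  p_y : p * y = y * p
  D₁_x : D₁ x = algebraMap C R e₁
  D₁_q : D₁ q = 0
  D₁_t : D₁ t = 0
  D₂_x : D₂ x = 0
  D₂_q : D₂ q = algebraMap C R e₂
  D₂_t : D₂ t = 0

namespace Frame
variable {C R K : Type*} [Field C] [Field R] [Algebra C R] [Ring K] [Module R K]
    [IsScalarTower R K K]

theorem p_y_assoc (F : Frame C R K) (k : K) : F.p * (F.y * k) = F.y * (F.p * k) := by
  rw [← mul_assoc, F.p_y, mul_assoc]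

/-- The frame with `x` and `q` as well as `y` and `p` interchanged. -/
@[simps] def swap (F : Frame C R K) : Frame C R K where
  x := F.q
  q := F.x
  t := F.t
  y := F.p
  p := F.y
  e₁ := F.e₂
  e₂ := F.e₁
  D₁ := F.D₂
  D₂ := F.D₁
  y_smul := F.p_smul
  p_smul := F.y_smul
  p_y := F.p_y.symm
  D₁_x := F.D₂_q
  D₁_q := F.D₂_x
  D₁_t := F.D₂_t
  D₂_x := F.D₁_q
  D₂_q := F.D₁_x
  D₂_t := F.D₁_t

/-- The frame with positions `x - 1`, `q - 1` and momenta `y + t`, `p + t`. -/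
@[simps] def shifted (F : Frame C R K) : Frame C R K where
  x := F.x - 1
  q := F.q - 1
  t := F.t
  y := F.y + F.t • (1 : K)
  p := F.p + F.t • (1 : K)
  e₁ := F.e₁
  e₂ := F.e₂
  D₁ := F.D₁
  D₂ := F.D₂
  y_smul r k := by
    simp only [add_mul, F.y_smul, smul_mul_assoc, one_mul, smul_add, smul_smul, mul_comm]; abel
  p_smul r k := by
    simp only [add_mul, F.p_smul, smul_mul_assoc, one_mul, smul_add, smul_smul, mul_comm]; abel
  p_y := by
    simp only [add_mul, mul_add, F.p_smul, F.y_smul, F.p_y, smul_mul_assoc, one_mul, mul_one,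
      F.D₁_t, F.D₂_t, zero_smul]; abel
  D₁_x := by simp [F.D₁_x]
  D₁_q := by simp [F.D₁_q]
  D₁_t := F.D₁_t
  D₂_x := by simp [F.D₂_x]
  D₂_q := by simp [F.D₂_q]
  D₂_t := F.D₂_t

end Frame

/-! ### The field of rational functions -/

/-- The generators commute in pairs, and commuting with a fixed element is inherited by the subfield
generated by a set. -/
theorem ratFun_comm {a b : K} (ha : a ∈ ratFun) (hb : b ∈ ratFun) : a * b = b * a := by
  have gen : ∀ a ∈ Set.range sc ∪ {x, q, t}, ∀ b ∈ Set.range sc ∪ {x, q, t}, Commute a b := by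
    rintro a (⟨c, rfl⟩ | ha) b hb
    · exact Algebra.commutes c b
    rcases hb with ⟨c, rfl⟩ | hb
    · exact (Algebra.commutes c a).symm
    · rcases ha with rfl | rfl | rfl <;> rcases hb with rfl | rfl | rfl <;> exact Skew.pos_ne _ _
  have step : ∀ {s : Set K} {b : K}, (∀ a ∈ s, Commute a b) → ∀ a ∈ Subfield.closure s,
      Commute a b := by
    intro s b h a ha
    induction ha using Subfield.closure_induction with
    | mem x hx => exact h x hx
    | one => exact Commute.one_left b
    | add x y _ _ hx hy => exact hx.add_left hy
    | neg x _ hx => exact hx.neg_left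
    | inv x _ hx => exact hx.inv_left₀
    | mul x y _ _ hx hy => exact hx.mul_left hy
  -- The passage from generators to the subfield is made once in each argument.
  exact step (fun a ha => (step (fun b hb => (gen a ha b hb).symm) b hb).symm) a ha

/-- The rational functions of `x`, `q`, `t` and the parameters, as a field. -/
def RatFun : Type := ratFun

instance : DivisionRing RatFun := inferInstanceAs (DivisionRing ratFun)

instance : Field RatFun :=
  { (inferInstance : DivisionRing RatFun) with
    mul_comm := fun a b => Subtype.ext (ratFun_comm a.2 b.2) }

/-- The inclusion of the rational functions. -/
def toK : RatFun →+* K := ratFun.subtype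

instance : Module RatFun K := Module.compHom K toK

theorem ratFun_smul_def (r : RatFun) (k : K) : r • k = toK r * k := rfl

/-- Scalars act by left multiplication only. They may be pulled out of the left factor of a product;
pulling them out of the right factor produces the derivative terms of `mom_smul`. -/
instance : IsScalarTower RatFun K K := ⟨fun r a b => by
  simp only [ratFun_smul_def, smul_eq_mul, mul_assoc]⟩

theorem sc_mem (c : Par) : sc c ∈ ratFun := Subfield.subset_closure (Or.inl ⟨c, rfl⟩)
theorem x_mem : x ∈ ratFun := Subfield.subset_closure (Or.inr (by simp))
theorem q_mem : q ∈ ratFun := Subfield.subset_closure (Or.inr (by simp))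
theorem t_mem : t ∈ ratFun := Subfield.subset_closure (Or.inr (by simp))

instance : Algebra Par RatFun := RingHom.toAlgebra
  { toFun := fun c => (⟨sc c, sc_mem c⟩ : ratFun)
    map_one' := Subtype.ext (map_one sc)
    map_mul' := fun a b => Subtype.ext (map_mul sc a b)
    map_zero' := Subtype.ext (map_zero sc)
    map_add' := fun a b => Subtype.ext (map_add sc a b) }

instance : CharZero RatFun := charZero_of_injective_algebraMap (algebraMap Par RatFun).injective

/-- The parameters as rational functions. -/
abbrev cR : Par →+* RatFun := algebraMap Par RatFun

def xR : RatFun := (⟨x, x_mem⟩ : ratFun)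
def qR : RatFun := (⟨q, q_mem⟩ : ratFun)
def tR : RatFun := (⟨t, t_mem⟩ : ratFun)

theorem toK_cR (c : Par) : toK (cR c) = sc c := rfl
theorem toK_xR : toK xR = x := rfl
theorem toK_qR : toK qR = q := rfl
theorem toK_tR : toK tR = t := rfl
theorem toK_mem (r : RatFun) : toK r ∈ ratFun := r.2
theorem toK_injective : Function.Injective toK := toK.injective

/-- The derivation `[u, ·]` of the field of rational functions. -/
def adDer (u : K) (h : ∀ r ∈ ratFun, u * r - r * u ∈ ratFun) : Derivation Par RatFun RatFun :=
  Derivation.mk'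
    { toFun := fun r => (⟨u * toK r - toK r * u, h _ r.2⟩ : ratFun)
      map_add' := fun a b => toK_injective (by
        change u * toK (a + b) - toK (a + b) * u =
          (u * toK a - toK a * u) + (u * toK b - toK b * u)
        rw [map_add]; noncomm_ring)
      map_smul' := fun c a => toK_injective (by
        change u * toK (c • a) - toK (c • a) * u = sc c * (u * toK a - toK a * u)
        rw [Algebra.smul_def, map_mul, toK_cR, ← mul_assoc, ← Algebra.commutes c u, mul_sub]
        simp only [mul_assoc]) }
    (fun a b => toK_injective (by
      change u * toK (a * b) - toK (a * b) * u =
        toK a * (u * toK b - toK b * u) + toK b * (u * toK a - toK a * u)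
      have hc : toK b * (u * toK a - toK a * u) = (u * toK a - toK a * u) * toK b :=
        ratFun_comm b.2 (h _ a.2)
      rw [hc, map_mul]; noncomm_ring))

theorem toK_adDer (u : K) (h : ∀ r ∈ ratFun, u * r - r * u ∈ ratFun) (r : RatFun) :
    toK (adDer u h r) = u * toK r - toK r * u := rfl

/-- Since `[u, ·]` is a derivation, and `[u, a⁻¹] = -a⁻¹ [u, a] a⁻¹`, it preserves a subfield once
it maps the generators into it. -/
theorem mem_of_gen {u : K} (hx : u * x - x * u ∈ ratFun) (hq : u * q - q * u ∈ ratFun)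
    (ht : u * t - t * u ∈ ratFun) : ∀ r ∈ ratFun, u * r - r * u ∈ ratFun := by
  intro r hr
  induction hr using Subfield.closure_induction with
  | mem z hz =>
    rcases hz with ⟨c, rfl⟩ | rfl | rfl | rfl
    · rw [← Algebra.commutes c u, sub_self]; exact zero_mem _
    · exact hx
    · exact hq
    · exact ht
  | one => rw [mul_one, one_mul, sub_self]; exact zero_mem _
  | add a b _ _ ha hb =>
    have : u * (a + b) - (a + b) * u = (u * a - a * u) + (u * b - b * u) := by noncomm_ring
    rw [this]; exact add_mem ha hb
  | neg a _ ha =>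
    have : u * (-a) - (-a) * u = -(u * a - a * u) := by noncomm_ring
    rw [this]; exact neg_mem ha
  | inv a h ha =>
    rcases eq_or_ne a 0 with rfl | h0
    · simp
    have : u * a⁻¹ - a⁻¹ * u = -(a⁻¹ * (u * a - a * u) * a⁻¹) := by
      rw [mul_sub, sub_mul, ← mul_assoc, ← mul_assoc, inv_mul_cancel₀ h0, one_mul, mul_assoc _ a,
        mul_inv_cancel₀ h0, mul_one, neg_sub]
    rw [this]; exact neg_mem (mul_mem (mul_mem (inv_mem h) ha) (inv_mem h))
  | mul a b h h' ha hb =>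
    have : u * (a * b) - a * b * u = (u * a - a * u) * b + a * (u * b - b * u) := by noncomm_ring
    rw [this]; exact add_mem (mul_mem ha h') (mul_mem h hb)

theorem commutator_mem {i : Fin 3} (j : Fin 3) :
    Skew.mom epsV i * Skew.pos epsV j - Skew.pos epsV j * Skew.mom epsV i ∈ ratFun := by
  rw [(Skew.canon (eps := epsV)).cross i j, add_sub_cancel_left]
  exact sc_mem _

theorem mom_mem (i : Fin 3) : ∀ r ∈ ratFun, Skew.mom epsV i * r - r * Skew.mom epsV i ∈ ratFun :=
  mem_of_gen (commutator_mem 0) (commutator_mem 1) (commutator_mem 2)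

/-- The derivations `[y, ·]`, `[p, ·]`, `[d, ·]`. -/
def der (i : Fin 3) : Derivation Par RatFun RatFun := adDer (Skew.mom epsV i) (mom_mem i)

theorem mom_smul (i : Fin 3) (r : RatFun) (k : K) :
    Skew.mom epsV i * (r • k) = r • (Skew.mom epsV i * k) + der i r • k := by
  simp only [ratFun_smul_def, der, toK_adDer]; noncomm_ring

theorem der_gen (i j : Fin 3) (r : RatFun) (hr : toK r = Skew.pos epsV j) :
    der i r = cR (if i = j then epsV i else 0) := toK_injective (by
  rw [der, toK_adDer, hr, (Skew.canon (eps := epsV)).cross i j, add_sub_cancel_left]; rfl)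

theorem der_ne (i j : Fin 3) (h : i ≠ j) (r : RatFun) (hr : toK r = Skew.pos epsV j) :
    der i r = 0 := by rw [der_gen i j r hr, if_neg h, map_zero]

/-- The frame given by `x`, `q`, `t`, `y`, `p`. -/
def fr : Frame Par RatFun K where
  x := xR
  q := qR
  t := tR
  y := y
  p := p
  e₁ := ε₁
  e₂ := ε₂
  D₁ := der 0
  D₂ := der 1
  y_smul := mom_smul 0
  p_smul := mom_smul 1
  p_y := Skew.mom_ne 1 0
  D₁_x := der_gen 0 0 xR rfl
  D₁_q := der_ne 0 1 (by decide) qR rfl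
  D₁_t := der_ne 0 2 (by decide) tR rfl
  D₂_x := der_ne 1 0 (by decide) xR rfl
  D₂_q := der_gen 1 1 qR rfl
  D₂_t := der_ne 1 2 (by decide) tR rfl

/-! ### Cancellations between the two numerators -/

namespace Frame
variable {C R K : Type*} [Field C] [Field R] [Algebra C R] [Ring K] [Module R K]
    [IsScalarTower R K K]

theorem derivation_ofNat (D : Derivation C R R) (n : ℕ) [n.AtLeastTwo] :
    D (ofNat(n) : R) = 0 := D.map_natCast n

/-! In the following operators, `e` and `e'` stand for the values of the commutators `[y, x]` and
`[p, q]`, and `a`, `b`, `c` are parameters. -/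

/-- The common quadratic factor of the leading terms. -/
def quad (F : Frame C R K) (e b c : R) : K :=
    (F.x) • (F.y * F.y) +
    (e - c + b + F.x*F.q*F.t) • F.y +
    (F.q*F.t*e - F.q*F.t*c) • (1 : K)

/-- The correction of first order in `p`. -/
def corr (F : Frame C R K) (e a b c : R) : K :=
    (-F.x*c + F.x*b - F.x*a - F.x*F.x*F.q*F.t) • (F.y * F.y) +
    (-F.x*F.q*F.q*F.t - F.x*F.q*F.t) • (F.y * F.p) +
    (-c*e + b*e - a*e - 2*F.x*F.q*F.t*e + c*c - 2*b*c + a*c + F.x*F.q*F.t*c + F.x*F.t*c + b*b -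
      a*b + F.x*F.q*F.q*F.t*F.t + F.x*F.x*F.q*F.t*F.t + F.x*F.q*F.t*F.t) • F.y +
    (-F.q*F.q*F.t*e - F.q*F.t*e + F.q*F.q*F.t*c + F.q*F.t*c) • F.p +
    (F.t*c*e + F.q*F.q*F.t*F.t*e + 2*F.x*F.q*F.t*F.t*e + F.q*F.t*F.t*e - F.t*c*c + F.t*b*c -
      F.q*F.q*F.t*F.t*c - F.x*F.q*F.t*F.t*c - F.q*F.t*F.t*c) • (1 : K)

/-- The Hamiltonian in shifted coordinates. -/
def ham (F : Frame C R K) (e e' a b c : R) : K :=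
    (F.x*F.x + F.x) • (F.y * F.y) +
    (2*F.x*e + e - F.x*c - c + F.x*b + b - F.x*a - F.x*e' - F.x*F.x*F.t - F.x*F.t) • F.y +
    (-2*F.x*F.t*e - F.t*e + F.x*F.t*c + F.t*c - F.t*a + F.x*F.t*e') • (1 : K)

/-- The difference of the two Hamiltonians. -/
def dham (F : Frame C R K) (e e' a b c : R) : K :=
  F.ham e e' a b c - F.swap.ham e' e a b c

/-- The numerator of the transformed Lax operator. -/
def num (F : Frame C R K) (e e' a b c : R) : K :=
  F.quad e b c * F.dham e e' a b c + (e - e') • F.corr e a b c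

/-- The numerator of the inversely transformed Lax operator, with the roles of `x` and `q`
interchanged. -/
def num' (F : Frame C R K) (e e' a b c : R) : K :=
  F.swap.quad e' b c * F.dham e e' a b c + (e - e') • F.swap.corr e' a b c

/-- Together with `syz₂` it spans over `R` the space that contains every cancellation between `num`
and `num'` used below. It has order four in the momenta, whereas `syz₂` has order three. -/
def syz₁ (F : Frame C R K) (e e' a b c : R) : K :=
  (F.t * F.q) • ((F.x • (F.y * F.p) + (F.x * F.q * F.t + b - c) • F.p + (F.x * F.t * (e' - c)) • (1 : K)) *
    F.dham e e' a b c - (e - e') • (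
    (F.x*c - F.x*b + F.x*a + F.x*F.x*F.q*F.t) • (F.y * F.p) +
    (F.x*F.q*F.q*F.t + F.x*F.q*F.t) • (F.p * F.p) +
    (-F.x*F.x*F.t*c - F.x*F.t*c + F.x*F.x*F.t*e') • F.y +
    (-c*c + 2*b*c - a*c - F.x*F.q*F.t*c - F.x*F.t*c - b*b + a*b + 2*F.x*F.q*F.t*e' + F.x*F.t*e' -
      F.x*F.q*F.q*F.t*F.t - F.x*F.x*F.q*F.t*F.t - F.x*F.q*F.t*F.t) • F.p +
    (F.t*c*c - F.t*b*c + F.x*F.q*F.t*F.t*c + F.x*F.x*F.t*F.t*c + F.x*F.t*F.t*c -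
      2*F.x*F.q*F.t*F.t*e' - F.x*F.x*F.t*F.t*e' - F.x*F.t*F.t*e') • (1 : K)))

/-- The grouping makes the symmetry under interchange of `x` and `q` visible: both factors of each
product change sign. -/
def syz₂ (F : Frame C R K) (e e' a b c : R) : K :=
  F.t • ((F.x • F.y - F.q • F.p) * (F.dham e e' a b c - ((e - e') * (a - b + c)) • (1 : K)) +
    (e - e') • ((F.x * F.q * F.t) • (F.y - F.p) + (F.t * c * (F.x - F.q)) • (1 : K)))

/-- A linear coefficient of the relations between the numerators. -/
def lin (F : Frame C R K) (e e' b c : R) : R :=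
  e' * (F.x * F.q * F.t) + e' * b - e * e' + e * c

/-- A quadratic coefficient of the relations between the numerators. -/
def cubic (F : Frame C R K) (e e' b c : R) : R :=
  -e' * (F.x * F.q * F.t)^2 - 2 * (F.x * F.q * F.t) * e' * (b - e) - e' * b^2 + e' * b * c
    + e * e' * b - e * e' * c - e * b * c + e * c^2

/-- The coordinate of the relation `rel₂` along `syz₂`, as `cubic` is for `rel₁`. -/
def quadr (F : Frame C R K) (e e' b c : R) : R :=
  F.x * F.q * F.t * (e' * c + e * e' - e * c)

/-- The hypotheses that `r` is a constant of the frame. -/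
structure Cst (F : Frame C R K) (r : R) : Prop where
  D₁ : F.D₁ r = 0
  D₂ : F.D₂ r = 0

set_option maxHeartbeats 4000000 in
set_option maxRecDepth 100000 in
-- The terms of order six cancel because the leading parts of `quad` and of its mirror image, `x y²`
-- and `q p²`, commute. What remains has order at most four and lies in the span of `syz₁` and
-- `syz₂`.
theorem rel₃ (F : Frame C R K) {e e' a b c : R} (he : F.Cst e) (he' : F.Cst e') (ha : F.Cst a) (hb : F.Cst b)
    (hc : F.Cst c) (h₁ : algebraMap C R F.e₁ = e) (h₂ : algebraMap C R F.e₂ = e') :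
    F.swap.quad e' b c * F.num e e' a b c - F.quad e b c * F.num' e e' a b c =
      F.lin e e' b c • F.syz₂ e e' a b c - (e - e') • F.syz₁ e e' a b c := by
  -- Distributivity is specialized to `K`, so that products of operators are expanded while the
  -- coefficients in `R` are left to `ring1`.
  have k₁ := @mul_add K _ _ _
  have k₂ := @add_mul K _ _ _
  have k₃ := @mul_sub K _
  have k₄ := @sub_mul K _
  simp only [num, num', syz₁, syz₂, quad, corr, dham, ham, lin, cubic, quadr, swap_x, swap_y, swap_q, swap_p, swap_t,
    k₁, k₂, k₃, k₄, smul_mul_assoc, one_mul, mul_one, mul_assoc, F.y_smul, F.p_smul, F.p_y, F.p_y_assoc]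
  simp only [map_add, map_sub, map_neg, Derivation.leibniz, derivation_ofNat, he.D₁, he.D₂, he'.D₁, he'.D₂, ha.D₁, ha.D₂, hb.D₁, hb.D₂,
    hc.D₁, hc.D₂, F.D₁_x, F.D₂_x, F.D₁_q, F.D₂_q, F.D₁_t, F.D₂_t, h₁, h₂, smul_zero, zero_smul, add_zero, zero_add, smul_eq_mul, sub_zero, neg_zero, mul_zero, map_zero]
  match_scalars
  all_goals ring1

set_option maxHeartbeats 4000000 in
set_option maxRecDepth 100000 in
-- Multiplying the combination of `rel₃` by `y` gives order five. Its leading part is a multiple of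
-- `p` times that of `num`, and adding the matching multiple of `num` brings the result back into
-- the span of `syz₁` and `syz₂`.
theorem rel₁ (F : Frame C R K) {e e' a b c : R} (he : F.Cst e) (he' : F.Cst e') (ha : F.Cst a) (hb : F.Cst b)
    (hc : F.Cst c) (h₁ : algebraMap C R F.e₁ = e) (h₂ : algebraMap C R F.e₂ = e') :
    F.x • (F.y * (F.lin e e' b c • F.syz₂ e e' a b c - (e - e') • F.syz₁ e e' a b c) +
      (((e - e') * F.q * F.t) • F.p - (F.t * F.lin e e' b c) • (1 : K)) * F.num e e' a b c) =
    F.cubic e e' b c • F.syz₂ e e' a b c - F.lin e e' b c • F.syz₁ e e' a b c := by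
  have k₁ := @mul_add K _ _ _
  have k₂ := @add_mul K _ _ _
  have k₃ := @mul_sub K _
  have k₄ := @sub_mul K _
  simp only [num, num', syz₁, syz₂, quad, corr, dham, ham, lin, cubic, quadr, swap_x, swap_y, swap_q, swap_p, swap_t,
    k₁, k₂, k₃, k₄, smul_mul_assoc, one_mul, mul_one, mul_assoc, F.y_smul, F.p_smul, F.p_y, F.p_y_assoc]
  simp only [map_add, map_sub, map_neg, Derivation.leibniz, derivation_ofNat, he.D₁, he.D₂, he'.D₁, he'.D₂, ha.D₁, ha.D₂, hb.D₁, hb.D₂,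
    hc.D₁, hc.D₂, F.D₁_x, F.D₂_x, F.D₁_q, F.D₂_q, F.D₁_t, F.D₂_t, h₁, h₂, smul_zero, zero_smul, add_zero, zero_add, smul_eq_mul, sub_zero, neg_zero, mul_zero, map_zero]
  match_scalars
  all_goals ring1

theorem syz₂_swap (F : Frame C R K) {e e' a b c : R} (he : F.Cst e) (he' : F.Cst e') (ha : F.Cst a) (hb : F.Cst b)
    (hc : F.Cst c) (h₁ : algebraMap C R F.e₁ = e) (h₂ : algebraMap C R F.e₂ = e') :
    F.swap.syz₂ e' e a b c = F.syz₂ e e' a b c := by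
  have k₁ := @mul_add K _ _ _
  have k₂ := @add_mul K _ _ _
  have k₃ := @mul_sub K _
  have k₄ := @sub_mul K _
  simp only [num, num', syz₁, syz₂, quad, corr, dham, ham, lin, cubic, quadr, swap_x, swap_y, swap_q, swap_p, swap_t,
    k₁, k₂, k₃, k₄, smul_mul_assoc, one_mul, mul_one, mul_assoc, F.y_smul, F.p_smul, F.p_y, F.p_y_assoc]
  simp only [map_add, map_sub, map_neg, Derivation.leibniz, derivation_ofNat, he.D₁, he.D₂, he'.D₁, he'.D₂, ha.D₁, ha.D₂, hb.D₁, hb.D₂,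
    hc.D₁, hc.D₂, F.D₁_x, F.D₂_x, F.D₁_q, F.D₂_q, F.D₁_t, F.D₂_t, h₁, h₂, smul_zero, zero_smul, add_zero, zero_add, smul_eq_mul, sub_zero, neg_zero, mul_zero, map_zero]
  match_scalars
  all_goals ring1

set_option maxHeartbeats 1000000 in
set_option maxRecDepth 100000 in
-- Needed to transport `rel₁` to the momentum `p`: the interchange of `x` and `q` maps the span of
-- `syz₁` and `syz₂` to itself, and this is its nontrivial matrix row.
theorem syz₁_swap (F : Frame C R K) {e e' a b c : R} (he : F.Cst e) (he' : F.Cst e') (ha : F.Cst a) (hb : F.Cst b)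
    (hc : F.Cst c) (h₁ : algebraMap C R F.e₁ = e) (h₂ : algebraMap C R F.e₂ = e') :
    F.swap.syz₁ e' e a b c = -(F.x * F.q * F.t + b - c) • F.syz₂ e e' a b c - F.syz₁ e e' a b c := by
  have k₁ := @mul_add K _ _ _
  have k₂ := @add_mul K _ _ _
  have k₃ := @mul_sub K _
  have k₄ := @sub_mul K _
  simp only [num, num', syz₁, syz₂, quad, corr, dham, ham, lin, cubic, quadr, swap_x, swap_y, swap_q, swap_p, swap_t,
    k₁, k₂, k₃, k₄, smul_mul_assoc, one_mul, mul_one, mul_assoc, F.y_smul, F.p_smul, F.p_y, F.p_y_assoc]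
  simp only [map_add, map_sub, map_neg, Derivation.leibniz, derivation_ofNat, he.D₁, he.D₂, he'.D₁, he'.D₂, ha.D₁, ha.D₂, hb.D₁, hb.D₂,
    hc.D₁, hc.D₂, F.D₁_x, F.D₂_x, F.D₁_q, F.D₂_q, F.D₁_t, F.D₂_t, h₁, h₂, smul_zero, zero_smul, add_zero, zero_add, smul_eq_mul, sub_zero, neg_zero, mul_zero, map_zero]
  match_scalars
  all_goals ring1
end Frame

/-! ### A common left multiple of the two numerators -/

namespace Frame
variable {C R K : Type*} [Field C] [Field R] [Algebra C R] [Ring K] [Module R K]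
    [IsScalarTower R K K]

/-- The coefficient of `x • y` in the common first order factor of the multipliers. -/
def wt₁ (F : Frame C R K) (e e' b c : R) : R :=
  (e - e') * F.quadr e e' b c + F.lin e e' b c * F.swap.lin e' e b c

/-- The coefficient of `q • p` in the common first order factor of the multipliers. -/
def wt₂ (F : Frame C R K) (e e' b c : R) : R :=
  F.lin e e' b c * F.lin e e' b c - (e - e') * F.cubic e e' b c

/-- The constant coefficient in the common first order factor of the multipliers. -/
def wt₀ (F : Frame C R K) (e e' b c : R) : R :=
  -(F.cubic e e' b c * F.swap.lin e' e b c + F.quadr e e' b c * F.lin e e' b c)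

/-- The multiplier of `num`. -/
def mulNum (F : Frame C R K) (e e' b c : R) : K :=
  ((F.x * F.wt₁ e e' b c) • F.y + (F.q * F.wt₂ e e' b c) • F.p + F.wt₀ e e' b c • (1 : K)) *
      F.swap.quad e' b c +
    (F.x * F.wt₁ e e' b c) • (((e - e') * F.q * F.t) • F.p - (F.t * F.lin e e' b c) • (1 : K))

/-- The multiplier of `num'`. -/
def mulNum' (F : Frame C R K) (e e' b c : R) : K :=
  ((F.x * F.wt₁ e e' b c) • F.y + (F.q * F.wt₂ e e' b c) • F.p + F.wt₀ e e' b c • (1 : K)) *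
      F.quad e b c -
    (F.q * F.wt₂ e e' b c) • (((e - e') * F.x * F.t) • F.y +
      (F.t * F.swap.lin e' e b c) • (1 : K))

theorem Cst.swap {F : Frame C R K} {r : R} (h : F.Cst r) : F.swap.Cst r := ⟨h.D₂, h.D₁⟩

/-- The difference of the Hamiltonians and the factor `e - e'` are both odd under the interchange.
-/
theorem num_swap (F : Frame C R K) (e e' a b c : R) :
    F.swap.num e' e a b c = -F.num' e e' a b c := by
  have h : F.swap.dham e' e a b c = -F.dham e e' a b c := (neg_sub _ _).symm
  rw [num, num', h, mul_neg]
  module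

/-- This is the mirror image of `rel₁`, expressed again in terms of the original `syz₁` and `syz₂`.
-/
theorem rel₂ (F : Frame C R K) {e e' a b c : R} (he : F.Cst e) (he' : F.Cst e') (ha : F.Cst a)
    (hb : F.Cst b) (hc : F.Cst c) (h₁ : algebraMap C R F.e₁ = e) (h₂ : algebraMap C R F.e₂ = e') :
    F.q • (F.p * (F.lin e e' b c • F.syz₂ e e' a b c - (e - e') • F.syz₁ e e' a b c) +
      (((e - e') * F.x * F.t) • F.y + (F.t * F.swap.lin e' e b c) • (1 : K)) * F.num' e e' a b c) =
    F.quadr e e' b c • F.syz₂ e e' a b c + F.swap.lin e' e b c • F.syz₁ e e' a b c := by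
  have h := F.swap.rel₁ (a := a) he'.swap he.swap ha.swap hb.swap hc.swap h₂ h₁
  rw [num_swap, F.syz₂_swap he he' ha hb hc h₁ h₂, F.syz₁_swap he he' ha hb hc h₁ h₂] at h
  -- The combination of `rel₃` is invariant under the interchange, since `num` and `num'` are
  -- exchanged up to sign.
  have e1 : F.lin e e' b c • F.syz₂ e e' a b c - (e - e') • F.syz₁ e e' a b c =
      F.swap.lin e' e b c • F.syz₂ e e' a b c - (e' - e) •
        (-(F.x * F.q * F.t + b - c) • F.syz₂ e e' a b c - F.syz₁ e e' a b c) := by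
    simp only [lin, swap_x, swap_q, swap_t]
    module
  have e2 : F.quadr e e' b c • F.syz₂ e e' a b c + F.swap.lin e' e b c • F.syz₁ e e' a b c =
      F.swap.cubic e' e b c • F.syz₂ e e' a b c - F.swap.lin e' e b c •
        (-(F.x * F.q * F.t + b - c) • F.syz₂ e e' a b c - F.syz₁ e e' a b c) := by
    simp only [lin, cubic, quadr, swap_x, swap_q, swap_t]
    module
  rw [e1, e2, ← h]
  simp only [swap_x, swap_q, swap_t, swap_y, swap_p]
  congr 2
  rw [mul_neg, ← neg_mul]
  congr 1
  module

/-- The relation between the numerators of the two transforms of the Lax operator. -/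
theorem mulNum_num (F : Frame C R K) {e e' a b c : R} (he : F.Cst e) (he' : F.Cst e')
    (ha : F.Cst a) (hb : F.Cst b) (hc : F.Cst c) (h₁ : algebraMap C R F.e₁ = e)
    (h₂ : algebraMap C R F.e₂ = e') :
    F.mulNum e e' b c * F.num e e' a b c = F.mulNum' e e' b c * F.num' e e' a b c := by
  have r₁ := F.rel₁ he he' ha hb hc h₁ h₂
  have r₂ := F.rel₂ he he' ha hb hc h₁ h₂
  have r₃ := F.rel₃ he he' ha hb hc h₁ h₂
  rw [← sub_eq_zero]
  -- The multipliers are read off from a weighted sum of the left sides of `rel₁`, `rel₂`, `rel₃`: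
  -- the first two contribute `x y` and `q p` times the combination of `rel₃`, plus a correction in
  -- `num` or `num'`.
  have key : F.mulNum e e' b c * F.num e e' a b c - F.mulNum' e e' b c * F.num' e e' a b c =
      F.wt₁ e e' b c • (F.x • (F.y * (F.lin e e' b c • F.syz₂ e e' a b c -
          (e - e') • F.syz₁ e e' a b c) +
        (((e - e') * F.q * F.t) • F.p - (F.t * F.lin e e' b c) • (1 : K)) * F.num e e' a b c)) +
      F.wt₂ e e' b c • (F.q • (F.p * (F.lin e e' b c • F.syz₂ e e' a b c -
          (e - e') • F.syz₁ e e' a b c) +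
        (((e - e') * F.x * F.t) • F.y + (F.t * F.swap.lin e' e b c) • (1 : K)) *
          F.num' e e' a b c)) +
      F.wt₀ e e' b c • (F.lin e e' b c • F.syz₂ e e' a b c - (e - e') • F.syz₁ e e' a b c) := by
    rw [← r₃, mulNum, mulNum']
    generalize F.num e e' a b c = n
    generalize F.num' e e' a b c = n'
    simp only [add_mul, sub_mul, mul_sub, smul_mul_assoc, mul_assoc, one_mul]
    module
  -- In the coordinates `(syz₂, syz₁)` the three right sides are `(cubic, -lin)`, `(quadr,
  -- swap.lin)` and `(lin, -(e - e'))`. The weights are, up to a common sign, their two by two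
  -- minors, so the weighted sum vanishes.
  rw [key, r₁, r₂]
  simp only [wt₀, wt₁, wt₂]
  module

end Frame

/-! ### Reduction of elements of the skew field to normal form -/

theorem x_eq : x = xR • (1 : K) := (mul_one _).symm
theorem q_eq : q = qR • (1 : K) := (mul_one _).symm
theorem t_eq : t = tR • (1 : K) := (mul_one _).symm
theorem sc_eq (c : Par) : sc c = cR c • (1 : K) := (mul_one _).symm
theorem inv_toK (r : RatFun) (z : K) (h : z = toK r) : z⁻¹ = r⁻¹ • (1 : K) := by
  rw [h, ratFun_smul_def, mul_one, map_inv₀]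
theorem inv_x : x⁻¹ = xR⁻¹ • (1 : K) := inv_toK _ _ rfl
theorem inv_q : q⁻¹ = qR⁻¹ • (1 : K) := inv_toK _ _ rfl
theorem inv_t : t⁻¹ = tR⁻¹ • (1 : K) := inv_toK _ _ rfl
theorem inv_x_sub_one : (x - 1)⁻¹ = (xR - 1)⁻¹ • (1 : K) := inv_toK _ _ (by simp [toK_xR])
theorem inv_q_sub_one : (q - 1)⁻¹ = (qR - 1)⁻¹ • (1 : K) := inv_toK _ _ (by simp [toK_qR])
theorem inv_x_sub_q : (x - q)⁻¹ = (xR - qR)⁻¹ • (1 : K) :=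
  inv_toK _ _ (by simp [toK_xR, toK_qR])
-- Written with the inverse of `xR - qR`, so that only one of the two opposite denominators occurs
-- in normal forms.
theorem inv_q_sub_x : (q - x)⁻¹ = (-(xR - qR)⁻¹) • (1 : K) := by
  rw [← neg_sub x q, inv_neg, inv_x_sub_q, neg_smul]
theorem inv_x_sub_q_sq : ((x - q) ^ 2)⁻¹ = ((xR - qR)⁻¹ * (xR - qR)⁻¹) • (1 : K) := by
  rw [← mul_inv]; exact inv_toK _ _ (by simp [toK_xR, toK_qR, pow_two])

theorem der_x₀ : der 0 xR = cR ε₁ := der_gen 0 0 xR rfl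
theorem der_q₀ : der 0 qR = 0 := der_ne 0 1 (by decide) qR rfl
theorem der_t₀ : der 0 tR = 0 := der_ne 0 2 (by decide) tR rfl
theorem der_x₁ : der 1 xR = 0 := der_ne 1 0 (by decide) xR rfl
theorem der_q₁ : der 1 qR = cR ε₂ := der_gen 1 1 qR rfl
theorem der_t₁ : der 1 tR = 0 := der_ne 1 2 (by decide) tR rfl
theorem der_x₂ : der 2 xR = 0 := der_ne 2 0 (by decide) xR rfl
theorem der_q₂ : der 2 qR = 0 := der_ne 2 1 (by decide) qR rfl
theorem der_t₂ : der 2 tR = 1 := (der_gen 2 2 tR rfl).trans (map_one cR)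
theorem der_cR (i : Fin 3) (c : Par) : der i (cR c) = 0 := (der i).map_algebraMap c
theorem der_one (i : Fin 3) : der i 1 = 0 := (der i).map_one_eq_zero

theorem p_y : p * y = y * p := Skew.mom_ne 1 0
theorem d_y : d * y = y * d := Skew.mom_ne 2 0
theorem d_p : d * p = p * d := Skew.mom_ne 2 1
theorem p_y_assoc (k : K) : p * (y * k) = y * (p * k) := by rw [← mul_assoc, p_y, mul_assoc]
theorem d_y_assoc (k : K) : d * (y * k) = y * (d * k) := by rw [← mul_assoc, d_y, mul_assoc]
theorem d_p_assoc (k : K) : d * (p * k) = p * (d * k) := by rw [← mul_assoc, d_p, mul_assoc]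

/-- Otherwise the momentum with index `i` would commute with its own position, contrary to the
nonzero commutator. -/
theorem pos_ne_pos {i j : Fin 3} (h : i ≠ j) : Skew.pos epsV i ≠ Skew.pos epsV j := fun e => by
  have h1 := Skew.cross_self (eps := epsV) i
  have h2 := (Skew.cross_ne (eps := epsV) h).eq
  rw [e, h2, left_eq_add] at h1
  exact (inferInstance : Fact (∀ i, epsV i ≠ 0)).out i ((map_eq_zero _).1 h1)

theorem pos_ne_sc (i : Fin 3) (c : Par) : Skew.pos epsV i ≠ sc c := fun e => by
  have h1 := Skew.cross_self (eps := epsV) i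
  rw [e, Algebra.commutes c, left_eq_add] at h1
  exact (inferInstance : Fact (∀ i, epsV i ≠ 0)).out i ((map_eq_zero _).1 h1)

theorem x_ne : xR ≠ 0 := fun h => Skew.pos_ne_zero (eps := epsV) 0 (congrArg toK h)
theorem q_ne : qR ≠ 0 := fun h => Skew.pos_ne_zero (eps := epsV) 1 (congrArg toK h)
theorem t_ne : tR ≠ 0 := fun h => Skew.pos_ne_zero (eps := epsV) 2 (congrArg toK h)
theorem x_sub_q_ne : xR - qR ≠ 0 := fun h =>
  pos_ne_pos (i := 0) (j := 1) (by decide) (congrArg toK (sub_eq_zero.1 h))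
theorem x_sub_one_ne : xR - 1 ≠ 0 := fun h =>
  pos_ne_sc 0 1 ((congrArg toK (sub_eq_zero.1 h)).trans (map_one sc).symm)
theorem q_sub_one_ne : qR - 1 ≠ 0 := fun h =>
  pos_ne_sc 1 1 ((congrArg toK (sub_eq_zero.1 h)).trans (map_one sc).symm)
theorem cR_ε₁_ne : cR ε₁ ≠ 0 := (map_ne_zero _).2 ε₁_ne_zero
theorem cR_ε₂_ne : cR ε₂ ≠ 0 := (map_ne_zero _).2 ε₂_ne_zero

/-- Rules that write inverses as multiples of `1` by rational functions. -/
theorem inv_rules : (x⁻¹ = xR⁻¹ • (1 : K) ∧ q⁻¹ = qR⁻¹ • (1 : K) ∧ t⁻¹ = tR⁻¹ • (1 : K)) ∧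
    ((x - 1)⁻¹ = (xR - 1)⁻¹ • (1 : K) ∧ (q - 1)⁻¹ = (qR - 1)⁻¹ • (1 : K)) ∧
    (x - q)⁻¹ = (xR - qR)⁻¹ • (1 : K) ∧ (q - x)⁻¹ = (-(xR - qR)⁻¹) • (1 : K) ∧
    ((x - q) ^ 2)⁻¹ = ((xR - qR)⁻¹ * (xR - qR)⁻¹) • (1 : K) :=
  ⟨⟨inv_x, inv_q, inv_t⟩, ⟨inv_x_sub_one, inv_q_sub_one⟩, inv_x_sub_q, inv_q_sub_x, inv_x_sub_q_sq⟩

/-- Rules that write positions and parameters as multiples of `1` by rational functions. -/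
theorem atom_rules : x = xR • (1 : K) ∧ q = qR • (1 : K) ∧ t = tR • (1 : K) ∧
    ∀ c, sc c = cR c • (1 : K) :=
  ⟨x_eq, q_eq, t_eq, sc_eq⟩

/-- Rules that expand products and move rational functions to the left of momenta. -/
theorem order_rules : (∀ a b c : K, a * (b + c) = a * b + a * c) ∧
    (∀ a b c : K, (a + b) * c = a * c + b * c) ∧ (∀ a b c : K, a * (b - c) = a * b - a * c) ∧
    (∀ a b c : K, (a - b) * c = a * c - b * c) ∧ (∀ a b : K, -a * b = -(a * b)) ∧
    (∀ a b : K, a * -b = -(a * b)) ∧ (∀ a b c : K, a * b * c = a * (b * c)) ∧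
    (∀ (r : RatFun) (a b : K), r • a * b = r • (a * b)) ∧
    (∀ a : K, 1 * a = a) ∧ (∀ a : K, a * 1 = a) ∧
    (∀ (i : Fin 3) (r : RatFun) (k : K),
      Skew.mom epsV i * (r • k) = r • (Skew.mom epsV i * k) + der i r • k) ∧
    (p * y = y * p ∧ d * y = y * d ∧ d * p = p * d) ∧
    (∀ k : K, p * (y * k) = y * (p * k)) ∧ (∀ k : K, d * (y * k) = y * (d * k)) ∧
    ∀ k : K, d * (p * k) = p * (d * k) :=
  ⟨mul_add, add_mul, mul_sub, sub_mul, neg_mul, mul_neg, mul_assoc, smul_mul_assoc, one_mul,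
    mul_one, mom_smul, ⟨p_y, d_y, d_p⟩, p_y_assoc, d_y_assoc, d_p_assoc⟩

/-- Values of the derivations of the field of rational functions. -/
theorem der_rules : (der 0 xR = cR ε₁ ∧ der 0 qR = 0 ∧ der 0 tR = 0) ∧
    (der 1 xR = 0 ∧ der 1 qR = cR ε₂ ∧ der 1 tR = 0) ∧
    (der 2 xR = 0 ∧ der 2 qR = 0 ∧ der 2 tR = 1) ∧ (∀ i c, der i (cR c) = 0) ∧
    (∀ i, der i 1 = 0) ∧ (∀ i, der i 0 = 0) ∧ (∀ i, der i 2 = 0) ∧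
    (∀ i r s, der i (r + s) = der i r + der i s) ∧ (∀ i r s, der i (r - s) = der i r - der i s) ∧
    (∀ i r, der i (-r) = -der i r) ∧ (∀ i r s, der i (r * s) = r • der i s + s • der i r) ∧
    (∀ i r, der i r⁻¹ = -(r⁻¹ * r⁻¹ * der i r)) :=
  ⟨⟨der_x₀, der_q₀, der_t₀⟩, ⟨der_x₁, der_q₁, der_t₁⟩, ⟨der_x₂, der_q₂, der_t₂⟩, der_cR, der_one,
    fun i => map_zero _, fun i => Frame.derivation_ofNat (der i) 2, fun i => map_add _, fun i => map_sub _,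
    fun i => map_neg _, fun i => (der i).leibniz,
    fun i r => by rw [(der i).leibniz_inv, smul_eq_mul]; ring⟩

/-- Rules for the parameters in the field of rational functions. -/
theorem param_rules : (∀ a b, cR (a + b) = cR a + cR b) ∧ (∀ a b, cR (a - b) = cR a - cR b) ∧
    (∀ a, cR (-a) = -cR a) ∧ (∀ a b, cR (a * b) = cR a * cR b) ∧ cR 1 = 1 ∧ cR 0 = 0 ∧
    (∀ a b, cR (a / b) = cR a / cR b) ∧ cR 2 = 2 :=
  ⟨map_add _, map_sub _, map_neg _, map_mul _, map_one _, map_zero _, map_div₀ _,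
    map_ofNat _ 2⟩

/-- These are the denominators that survive in the coefficients; `field_simp` clears them in each
comparison. -/
theorem denom_ne_zero : (xR ≠ 0 ∧ xR - 1 ≠ 0 ∧ qR ≠ 0 ∧ qR - 1 ≠ 0 ∧ tR ≠ 0) ∧ xR - qR ≠ 0 ∧
    cR ε₁ ≠ 0 ∧ cR ε₂ ≠ 0 :=
  ⟨⟨x_ne, x_sub_one_ne, q_ne, q_sub_one_ne, t_ne⟩, x_sub_q_ne, cR_ε₁_ne, cR_ε₂_ne⟩

/-! ### Values of the automorphisms -/

theorem Rs1_pos (i a : Fin 3) (b : Par) : Rs1 i b (Skew.pos epsV a) = Skew.pos epsV a :=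
  Skew.adPow_pos _ _ _ _
theorem Rs1_mom (i a : Fin 3) (b : Par) : Rs1 i b (Skew.mom epsV a) =
    if a = i then Skew.mom epsV a + sc b * (Skew.pos epsV a)⁻¹ else Skew.mom epsV a := by
  split_ifs with h
  · subst h; rw [Rs1, Skew.adPow_mom, map_neg, map_zero, sub_zero, neg_mul, sub_neg_eq_add]
  · exact Skew.adPow_mom_ne h _ _
theorem Rs3_pos (i a : Fin 3) (b : Par) : Rs3 i b (Skew.pos epsV a) = Skew.pos epsV a :=
  Skew.adPow_pos _ _ _ _
theorem Rs3_mom (i a : Fin 3) (b : Par) : Rs3 i b (Skew.mom epsV a) =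
    if a = i then Skew.mom epsV a + sc b * (Skew.pos epsV a - 1)⁻¹ else Skew.mom epsV a := by
  split_ifs with h
  · subst h; rw [Rs3, Skew.adPow_mom, map_neg, map_one, neg_mul, sub_neg_eq_add]
  · exact Skew.adPow_mom_ne h _ _

theorem laplace_pos_if (i a : Fin 3) : Skew.laplace i (Skew.pos epsV a) =
    if a = i then -Skew.mom epsV a else Skew.pos epsV a := by
  split_ifs with h
  · subst h; exact Skew.laplace_pos _
  · exact Skew.laplace_pos_ne h
theorem laplace_mom_if (i a : Fin 3) : Skew.laplace i (Skew.mom epsV a) =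
    if a = i then Skew.pos epsV a else Skew.mom epsV a := by
  split_ifs with h
  · subst h; exact Skew.laplace_mom _
  · exact Skew.laplace_mom_ne h
theorem laplace_inv_pos (i a : Fin 3) : (Skew.laplace i)⁻¹ (Skew.pos epsV a) =
    if a = i then Skew.mom epsV a else Skew.pos epsV a := by
  apply (Skew.laplace (eps := epsV) i).injective
  rw [← AlgEquiv.mul_apply, mul_inv_cancel, AlgEquiv.one_apply]
  split_ifs with h
  · subst h; rw [Skew.laplace_mom]
  · rw [Skew.laplace_pos_ne h]
theorem laplace_inv_mom (i a : Fin 3) : (Skew.laplace i)⁻¹ (Skew.mom epsV a) =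
    if a = i then -Skew.pos epsV a else Skew.mom epsV a := by
  apply (Skew.laplace (eps := epsV) i).injective
  rw [← AlgEquiv.mul_apply, mul_inv_cancel, AlgEquiv.one_apply]
  split_ifs with h
  · subst h; rw [map_neg, Skew.laplace_pos, neg_neg]
  · rw [Skew.laplace_mom_ne h]

theorem Rs2_mom (i a : Fin 3) (b : Par) : Rs2 i b (Skew.mom epsV a) = Skew.mom epsV a := by
  rw [Rs2, AlgEquiv.mul_apply, AlgEquiv.mul_apply, laplace_mom_if]
  split_ifs with h
  · rw [Skew.adPow_pos, laplace_inv_pos, if_pos h]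
  · rw [Skew.adPow_mom_ne h, laplace_inv_mom, if_neg h]
-- The Laplace transformation exchanges position and momentum, so the gauge transformation by a
-- power of `x` becomes one in the momentum: the position moves by a multiple of the inverse
-- momentum and the momenta are fixed.
theorem Rs2_pos (i a : Fin 3) (b : Par) : Rs2 i b (Skew.pos epsV a) =
    if a = i then Skew.pos epsV a - sc b * (Skew.mom epsV a)⁻¹ else Skew.pos epsV a := by
  rw [Rs2, AlgEquiv.mul_apply, AlgEquiv.mul_apply, laplace_pos_if]
  split_ifs with h
  · subst h
    rw [map_neg, Skew.adPow_mom, map_zero, sub_zero, map_neg, map_sub, laplace_inv_mom, if_pos rfl,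
      map_mul, AlgEquiv.commutes, map_inv₀, laplace_inv_pos, if_pos rfl, map_neg]
    noncomm_ring
  · rw [Skew.adPow_pos, laplace_inv_pos, if_neg h]

theorem Rxπ_x : Rxπ x = -(t⁻¹ * y) := by
  rw [Rxπ, AlgEquiv.mul_apply, Skew.laplace_pos, map_neg, Skew.affine_mom]
theorem Rxπ_y : Rxπ y = t * (x - 1) := by
  rw [Rxπ, AlgEquiv.mul_apply, Skew.laplace_mom, Skew.affine_pos]
theorem Rxπ_q : Rxπ q = q := by
  rw [Rxπ, AlgEquiv.mul_apply, Skew.laplace_pos_ne (by decide), Skew.affine_pos_ne _ (by decide)]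
theorem Rxπ_p : Rxπ p = p := by
  rw [Rxπ, AlgEquiv.mul_apply, Skew.laplace_mom_ne (by decide),
    Skew.affine_mom_ne _ (by decide) (by decide)]
theorem Rxπ_t : Rxπ t = t := by
  rw [Rxπ, AlgEquiv.mul_apply, Skew.laplace_pos_ne (by decide), Skew.affine_pos_ne _ (by decide)]
theorem Rxπ_d : Rxπ d = d - sc (1 / ε₁) * t⁻¹ * (x - 1) * y := by
  rw [Rxπ, AlgEquiv.mul_apply, Skew.laplace_mom_ne (by decide), Skew.affine_mom_two]; rfl
theorem Rqπ_q : Rqπ q = -(t⁻¹ * p) := by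
  rw [Rqπ, AlgEquiv.mul_apply, Skew.laplace_pos, map_neg, Skew.affine_mom]
theorem Rqπ_p : Rqπ p = t * (q - 1) := by
  rw [Rqπ, AlgEquiv.mul_apply, Skew.laplace_mom, Skew.affine_pos]
theorem Rqπ_x : Rqπ x = x := by
  rw [Rqπ, AlgEquiv.mul_apply, Skew.laplace_pos_ne (by decide), Skew.affine_pos_ne _ (by decide)]
theorem Rqπ_y : Rqπ y = y := by
  rw [Rqπ, AlgEquiv.mul_apply, Skew.laplace_mom_ne (by decide),
    Skew.affine_mom_ne _ (by decide) (by decide)]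
theorem Rqπ_t : Rqπ t = t := by
  rw [Rqπ, AlgEquiv.mul_apply, Skew.laplace_pos_ne (by decide), Skew.affine_pos_ne _ (by decide)]
theorem Rqπ_d : Rqπ d = d - sc (1 / ε₂) * t⁻¹ * (q - 1) * p := by
  rw [Rqπ, AlgEquiv.mul_apply, Skew.laplace_mom_ne (by decide), Skew.affine_mom_two]; rfl

theorem adExpX_pos (a : Fin 3) : adExpX (Skew.pos epsV a) = Skew.pos epsV a := Skew.adExp_pos _ _ _
theorem adExpX_y : adExpX y = y - t := Skew.adExp_mom _ _
theorem adExpX_p : adExpX p = p := Skew.adExp_mom_ne _ (by decide) (by decide)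
theorem adExpX_d : adExpX d = d - sc (1 / ε₁) * x := Skew.adExp_mom_two _ _
theorem adExpQ_pos (a : Fin 3) : adExpQ (Skew.pos epsV a) = Skew.pos epsV a := Skew.adExp_pos _ _ _
theorem adExpQ_y : adExpQ y = y := Skew.adExp_mom_ne _ (by decide) (by decide)
theorem adExpQ_p : adExpQ p = p - t := Skew.adExp_mom _ _
theorem adExpQ_d : adExpQ d = d - sc (1 / ε₂) * q := Skew.adExp_mom_two _ _
theorem negT_x : negT x = x := Skew.negT_pos_ne (by decide)
theorem negT_q : negT q = q := Skew.negT_pos_ne (by decide)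
theorem negT_t : negT t = -t := Skew.negT_pos_two
theorem negT_y : negT y = y := Skew.negT_mom_ne (by decide)
theorem negT_p : negT p = p := Skew.negT_mom_ne (by decide)
theorem negT_d : negT d = -d := Skew.negT_mom_two

/-! ### Values of the group action on the parameters -/

theorem π_inv_α (j : Fin 4) : π⁻¹ (α j) = α (j - 1) := by
  apply π.injective
  rw [← AlgEquiv.mul_apply, mul_inv_cancel, AlgEquiv.one_apply, π_α, sub_add_cancel]

theorem eq_vec₄ {f : Fin 4 → Par} {a b c d : Par} (h₀ : f 0 = a) (h₁ : f 1 = b) (h₂ : f 2 = c)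
    (h₃ : f 3 = d) : f = ![a, b, c, d] := by
  subst h₀ h₁ h₂ h₃
  funext j; fin_cases j <;> rfl

theorem s_one_α_zero : s 1 (α 0) = α 0 + α 1 := s_adj (by decide)
theorem s_one_α_one : s 1 (α 1) = -α 1 := s_self 1
theorem s_one_α_two : s 1 (α 2) = α 2 + α 1 := s_adj (by decide)
theorem s_one_α_three : s 1 (α 3) = α 3 := s_far 1
theorem s_two_α_zero : s 2 (α 0) = α 0 := s_far 2
theorem s_two_α_one : s 2 (α 1) = α 1 + α 2 := s_adj (by decide)
theorem s_two_α_two : s 2 (α 2) = -α 2 := s_self 2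
theorem s_two_α_three : s 2 (α 3) = α 3 + α 2 := s_adj (by decide)
theorem s_three_α_zero : s 3 (α 0) = α 0 + α 3 := s_adj (by decide)
theorem s_three_α_one : s 3 (α 1) = α 1 := s_far 3
theorem s_three_α_two : s 3 (α 2) = α 2 + α 3 := s_adj (by decide)
theorem s_three_α_three : s 3 (α 3) = -α 3 := s_self 3
theorem σ_α_zero : σ (α 0) = α 2 := σ_α 0
theorem π_α_zero : π (α 0) = α 1 := π_α 0
theorem π_inv_α_zero : π⁻¹ (α 0) = α 3 := π_inv_α 0
theorem σ_α_one : σ (α 1) = α 1 := σ_α 1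
theorem π_α_one : π (α 1) = α 2 := π_α 1
theorem π_inv_α_one : π⁻¹ (α 1) = α 0 := π_inv_α 1
theorem σ_α_two : σ (α 2) = α 0 := σ_α 2
theorem π_α_two : π (α 2) = α 3 := π_α 2
theorem π_inv_α_two : π⁻¹ (α 2) = α 1 := π_inv_α 2
theorem σ_α_three : σ (α 3) = α 3 := σ_α 3
theorem π_α_three : π (α 3) = α 0 := π_α 3
theorem π_inv_α_three : π⁻¹ (α 3) = α 2 := π_inv_α 3

theorem act_s_one : act (s 1) = ![α 0 + α 1, -α 1, α 2 + α 1, α 3] :=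
  eq_vec₄ s_one_α_zero s_one_α_one s_one_α_two s_one_α_three

theorem act_s_three : act (s 3) = ![α 0 + α 3, α 1, α 2 + α 3, -α 3] :=
  eq_vec₄ s_three_α_zero s_three_α_one s_three_α_two s_three_α_three

theorem act_σ : act σ = ![α 2, α 1, α 0, α 3] :=
  eq_vec₄ σ_α_zero σ_α_one σ_α_two σ_α_three

theorem act_apply (w : Par ≃ₐ[ℂ] Par) (i : Fin 4) : act w i = w (α i) := rfl

/-- The right factor acts first on the `α_i`, and the left factor then acts on the resulting
expressions; words are thus expanded from their last letter. -/
theorem act_mul {w w' : Par ≃ₐ[ℂ] Par} {a b c d : Par} (h : act w' = ![a, b, c, d]) :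
    act (w * w') = ![w a, w b, w c, w d] := by
  apply eq_vec₄ <;> rw [act_apply, AlgEquiv.mul_apply, ← act_apply w', h] <;> rfl

theorem vec₄_congr {a b c d a' b' c' d' : Par} (h₀ : a = a') (h₁ : b = b') (h₂ : c = c')
    (h₃ : d = d') : ![a, b, c, d] = ![a', b', c', d'] := by rw [h₀, h₁, h₂, h₃]

theorem act_π : act π = ![α 1, α 2, α 3, α 0] := eq_vec₄ π_α_zero π_α_one π_α_two π_α_three

theorem act_π_sq : act (π ^ 2) = ![α 2, α 3, α 0, α 1] := by
  rw [pow_two, act_mul act_π, π_α_zero, π_α_one, π_α_two, π_α_three]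

theorem act_s_two : act (s 2) = ![α 0, α 1 + α 2, -α 2, α 3 + α 2] :=
  eq_vec₄ s_two_α_zero s_two_α_one s_two_α_two s_two_α_three

theorem act_σ_word : act (σ * s 1 * s 3 * s 2) =
    ![α 1 + α 2 + α 3, α 0 + α 3, -α 0 - α 1 - α 3, α 0 + α 1] := by
  rw [mul_assoc, mul_assoc, act_mul (act_mul (act_mul act_s_two))]
  simp only [map_add, map_neg, σ_α_zero, σ_α_one, σ_α_two, σ_α_three, s_one_α_zero, s_one_α_one,
    s_one_α_two, s_one_α_three, s_three_α_zero, s_three_α_one, s_three_α_two, s_three_α_three]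
  apply vec₄_congr <;> ring

theorem act_π_inv : act π⁻¹ = ![α 3, α 0, α 1, α 2] :=
  eq_vec₄ π_inv_α_zero π_inv_α_one π_inv_α_two π_inv_α_three

theorem act_π_word : act (s 1 * s 2 * s 3 * π⁻¹) =
    ![-α 1 - α 2 - α 3, α 0 + 2 * α 1 + α 2 + α 3, α 2, α 3] := by
  rw [mul_assoc, mul_assoc, act_mul (act_mul (act_mul act_π_inv))]
  simp only [map_add, map_neg, s_one_α_zero, s_one_α_one, s_one_α_two, s_one_α_three, s_two_α_zero,
    s_two_α_one, s_two_α_two, s_two_α_three, s_three_α_zero, s_three_α_one, s_three_α_two,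
    s_three_α_three]
  apply vec₄_congr <;> ring

/-! ### The Lax operators in coordinates -/

theorem α_zero : α 0 = ε₂ - ε₁ - α 1 - α 2 - α 3 := by rw [ε₂]; ring

theorem shiftPar_zero (a : Fin 4 → Par) : shiftPar a 0 = a 0 + κ := rfl
theorem shiftPar_one (a : Fin 4 → Par) : shiftPar a 1 = a 1 := rfl
theorem shiftPar_two (a : Fin 4 → Par) : shiftPar a 2 = a 2 + κ := rfl
theorem shiftPar_three (a : Fin 4 → Par) : shiftPar a 3 = a 3 := rfl

theorem H_zero (a : Fin 4 → Par) : H 0 a = (x - 1) * (y + t) * x * y -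
    sc (a 1 + a 3 - ε₁) * x * y + sc (a 1) * y + sc (a 2 + ε₁) * t * x := rfl
theorem H_one (a : Fin 4 → Par) : H 1 a = (q - 1) * (p + t) * q * p -
    sc (a 1 + a 3 - ε₂) * q * p + sc (a 1) * p + sc (a 2 + ε₂) * t * q := rfl

/-- The left factor `x - q` cancels the only denominator of the Lax operator, since `κ` is central.
-/
theorem x_sub_q_mul_L (a : Fin 4 → Par) : (x - q) * L a =
    (x - q) * (H 0 a - H 1 (shiftPar a)) -
      sc κ * (x * (x - 1) * y - q * (q - 1) * p) := by
  have h : x - q ≠ 0 := sub_ne_zero.2 (pos_ne_pos (by decide))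
  rw [L, mul_sub, ← mul_assoc, ← mul_assoc, ← Algebra.commutes κ (x - q), mul_assoc (sc κ),
    mul_inv_cancel₀ h, mul_one]

/-! ### The automorphisms attached to `s₁`, `s₃` and `σ` -/

set_option maxHeartbeats 4000000 in
theorem R1_L : R1 (L α) = L (act (s 1)) := by
  simp only [R1, L, B, H_zero, H_one, AlgEquiv.mul_apply, map_mul, map_sub, map_add, map_neg, map_inv₀, map_one,
    AlgEquiv.commutes, Rs1_pos, Rs1_mom, act_s_one,
    Fin.reduceEq, ↓reduceIte, Fin.isValue, shiftPar_zero, shiftPar_one, shiftPar_two, shiftPar_three, Matrix.cons_val, α_zero, κ]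
  -- Inverses come first: their patterns mention `x` and `q`, which the next rewriting replaces by
  -- multiples of `1`.
  simp only [inv_rules]
  simp only [atom_rules]
  try simp only [order_rules]
  try simp only [der_rules, param_rules, smul_eq_mul, mul_zero, add_zero, zero_add, sub_zero, neg_zero,
    zero_smul]
  obtain ⟨⟨hx, hx1, hq, hq1, ht⟩, hxq, he, he'⟩ := denom_ne_zero
  -- Both sides are now combinations of ordered monomials in the momenta, and equality of
  -- coefficients in `RatFun` suffices. The parameter `α 0` has been eliminated beforehand, so no
  -- relation between the parameters is left for `ring` to use.
  match_scalars <;> (field_simp <;> ring)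

set_option maxHeartbeats 4000000 in
theorem R1_B : R1 (B α) = B (act (s 1)) + sc (κ * α 1) * (sc (α 3) + t) := by
  simp only [R1, L, B, H_zero, H_one, AlgEquiv.mul_apply, map_mul, map_sub, map_add, map_neg, map_inv₀, map_one,
    AlgEquiv.commutes, Rs1_pos, Rs1_mom, act_s_one,
    Fin.reduceEq, ↓reduceIte, Fin.isValue, shiftPar_zero, shiftPar_one, shiftPar_two, shiftPar_three, Matrix.cons_val, α_zero, κ]
  simp only [inv_rules]
  simp only [atom_rules]
  try simp only [order_rules]
  try simp only [der_rules, param_rules, smul_eq_mul, mul_zero, add_zero, zero_add, sub_zero, neg_zero,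
    zero_smul]
  obtain ⟨⟨hx, hx1, hq, hq1, ht⟩, hxq, he, he'⟩ := denom_ne_zero
  match_scalars <;> (field_simp <;> ring)

set_option maxHeartbeats 4000000 in
theorem R3_L : R3 (L α) = L (act (s 3)) := by
  simp only [R3, L, B, H_zero, H_one, AlgEquiv.mul_apply, map_mul, map_sub, map_add, map_neg, map_inv₀, map_one,
    AlgEquiv.commutes, Rs3_pos, Rs3_mom, act_s_three,
    Fin.reduceEq, ↓reduceIte, Fin.isValue, shiftPar_zero, shiftPar_one, shiftPar_two, shiftPar_three, Matrix.cons_val, α_zero, κ]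
  simp only [inv_rules]
  simp only [atom_rules]
  try simp only [order_rules]
  try simp only [der_rules, param_rules, smul_eq_mul, mul_zero, add_zero, zero_add, sub_zero, neg_zero,
    zero_smul]
  obtain ⟨⟨hx, hx1, hq, hq1, ht⟩, hxq, he, he'⟩ := denom_ne_zero
  match_scalars <;> (field_simp <;> ring)

set_option maxHeartbeats 4000000 in
theorem R3_B : R3 (B α) = B (act (s 3)) + sc (κ * α 1 * α 3) := by
  simp only [R3, L, B, H_zero, H_one, AlgEquiv.mul_apply, map_mul, map_sub, map_add, map_neg, map_inv₀, map_one,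
    AlgEquiv.commutes, Rs3_pos, Rs3_mom, act_s_three,
    Fin.reduceEq, ↓reduceIte, Fin.isValue, shiftPar_zero, shiftPar_one, shiftPar_two, shiftPar_three, Matrix.cons_val, α_zero, κ]
  simp only [inv_rules]
  simp only [atom_rules]
  try simp only [order_rules]
  try simp only [der_rules, param_rules, smul_eq_mul, mul_zero, add_zero, zero_add, sub_zero, neg_zero,
    zero_smul]
  obtain ⟨⟨hx, hx1, hq, hq1, ht⟩, hxq, he, he'⟩ := denom_ne_zero
  match_scalars <;> (field_simp <;> ring)

set_option maxHeartbeats 4000000 in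
theorem Rσ_L : Rσ (L α) = L (act σ) := by
  simp only [Rσ, L, B, H_zero, H_one, AlgEquiv.mul_apply, map_mul, map_sub, map_add, map_neg, map_inv₀, map_one,
    AlgEquiv.commutes, adExpX_pos, adExpX_y, adExpX_p, adExpX_d, adExpQ_pos, adExpQ_y, adExpQ_p, adExpQ_d,
    negT_x, negT_y, negT_q, negT_p, negT_t, negT_d, act_σ,
    Fin.reduceEq, ↓reduceIte, Fin.isValue, shiftPar_zero, shiftPar_one, shiftPar_two, shiftPar_three, Matrix.cons_val, α_zero, κ]
  simp only [inv_rules]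
  simp only [atom_rules]
  try simp only [order_rules]
  try simp only [der_rules, param_rules, smul_eq_mul, mul_zero, add_zero, zero_add, sub_zero, neg_zero,
    zero_smul]
  obtain ⟨⟨hx, hx1, hq, hq1, ht⟩, hxq, he, he'⟩ := denom_ne_zero
  match_scalars <;> (field_simp <;> ring)

set_option maxHeartbeats 4000000 in
theorem Rσ_B : Rσ (B α) = B (act σ) - sc (κ * α 1) * t := by
  simp only [Rσ, L, B, H_zero, H_one, AlgEquiv.mul_apply, map_mul, map_sub, map_add, map_neg, map_inv₀, map_one,
    AlgEquiv.commutes, adExpX_pos, adExpX_y, adExpX_p, adExpX_d, adExpQ_pos, adExpQ_y, adExpQ_p, adExpQ_d,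
    negT_x, negT_y, negT_q, negT_p, negT_t, negT_d, act_σ,
    Fin.reduceEq, ↓reduceIte, Fin.isValue, shiftPar_zero, shiftPar_one, shiftPar_two, shiftPar_three, Matrix.cons_val, α_zero, κ]
  simp only [atom_rules]
  try simp only [order_rules]
  try simp only [der_rules, param_rules, smul_eq_mul, mul_zero, add_zero, zero_add, sub_zero, neg_zero,
    zero_smul]
  obtain ⟨⟨hx, hx1, hq, hq1, ht⟩, hxq, he, he'⟩ := denom_ne_zero
  match_scalars <;> (field_simp <;> ring)

/-! ### The squares of the rotations -/

theorem Rqπ_inv_of {a b : K} (h : Rqπ b = a) : Rqπ⁻¹ a = b := by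
  rw [← h, ← AlgEquiv.mul_apply, inv_mul_cancel, AlgEquiv.one_apply]

theorem sq_apply (w : K ≃ₐ[Par] K) (z : K) : (w ^ 2) z = w (w z) := by
  rw [pow_two, AlgEquiv.mul_apply]

theorem mul_sq_apply (v w : K ≃ₐ[Par] K) (z : K) : ((v * w) ^ 2) z = v (w (v (w z))) := by
  rw [pow_two, AlgEquiv.mul_apply, AlgEquiv.mul_apply, AlgEquiv.mul_apply]

theorem Rπ_apply (z : K) : Rπ z = Rxπ (Rqπ z) := by rw [Rπ, AlgEquiv.mul_apply]

theorem Rqπ_inv_x : Rqπ⁻¹ x = x := Rqπ_inv_of Rqπ_x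
theorem Rqπ_inv_y : Rqπ⁻¹ y = y := Rqπ_inv_of Rqπ_y
theorem Rqπ_inv_t : Rqπ⁻¹ t = t := Rqπ_inv_of Rqπ_t
theorem Rqπ_inv_q : Rqπ⁻¹ q = t⁻¹ * p + 1 := by
  apply Rqπ_inv_of
  simp only [map_mul, map_sub, map_add, map_neg, map_inv₀, map_one,
    AlgEquiv.commutes,
    Rxπ_x, Rxπ_y, Rxπ_q, Rxπ_p, Rxπ_t, Rxπ_d, Rqπ_x, Rqπ_y, Rqπ_q, Rqπ_p, Rqπ_t, Rqπ_d]
  simp only [inv_rules]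
  simp only [atom_rules]
  try simp only [order_rules]
  try simp only [der_rules, param_rules, smul_eq_mul, mul_zero, add_zero, zero_add, sub_zero, neg_zero,
    zero_smul]
  obtain ⟨⟨hx, hx1, hq, hq1, ht⟩, hxq, he, he'⟩ := denom_ne_zero
  match_scalars <;> (field_simp <;> ring)

theorem Rqπ_inv_p : Rqπ⁻¹ p = -(t * q) := by
  apply Rqπ_inv_of
  simp only [map_mul, map_sub, map_add, map_neg, map_inv₀, map_one,
    AlgEquiv.commutes,
    Rxπ_x, Rxπ_y, Rxπ_q, Rxπ_p, Rxπ_t, Rxπ_d, Rqπ_x, Rqπ_y, Rqπ_q, Rqπ_p, Rqπ_t, Rqπ_d]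
  simp only [inv_rules]
  simp only [atom_rules]
  try simp only [order_rules]
  try simp only [der_rules, param_rules, smul_eq_mul, mul_zero, add_zero, zero_add, sub_zero, neg_zero,
    zero_smul]
  obtain ⟨⟨hx, hx1, hq, hq1, ht⟩, hxq, he, he'⟩ := denom_ne_zero
  match_scalars <;> (field_simp <;> ring)

theorem Rqπ_inv_d : Rqπ⁻¹ d = d - sc (1 / ε₂) * t⁻¹ * p * q := by
  apply Rqπ_inv_of
  simp only [map_mul, map_sub, map_add, map_neg, map_inv₀, map_one,
    AlgEquiv.commutes,
    Rxπ_x, Rxπ_y, Rxπ_q, Rxπ_p, Rxπ_t, Rxπ_d, Rqπ_x, Rqπ_y, Rqπ_q, Rqπ_p, Rqπ_t, Rqπ_d]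
  simp only [inv_rules]
  simp only [atom_rules]
  try simp only [order_rules]
  try simp only [der_rules, param_rules, smul_eq_mul, mul_zero, add_zero, zero_add, sub_zero, neg_zero,
    zero_smul]
  obtain ⟨⟨hx, hx1, hq, hq1, ht⟩, hxq, he, he'⟩ := denom_ne_zero
  match_scalars <;> (field_simp <;> ring)

theorem Rπ_sq_x : (Rπ ^ 2) x = 1 - x := by
  simp only [sq_apply, Rπ_apply, map_mul, map_sub, map_add, map_neg, map_inv₀, map_one,
    AlgEquiv.commutes,
    Rxπ_x, Rxπ_y, Rxπ_q, Rxπ_p, Rxπ_t, Rxπ_d, Rqπ_x, Rqπ_y, Rqπ_q, Rqπ_p, Rqπ_t, Rqπ_d]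
  simp only [inv_rules]
  simp only [atom_rules]
  try simp only [order_rules]
  try simp only [der_rules, param_rules, smul_eq_mul, mul_zero, add_zero, zero_add, sub_zero, neg_zero,
    zero_smul]
  obtain ⟨⟨hx, hx1, hq, hq1, ht⟩, hxq, he, he'⟩ := denom_ne_zero
  match_scalars <;> (field_simp <;> ring)

theorem Rπ_sq_y : (Rπ ^ 2) y = -y - t := by
  simp only [sq_apply, Rπ_apply, map_mul, map_sub, map_add, map_neg, map_inv₀, map_one,
    AlgEquiv.commutes,
    Rxπ_x, Rxπ_y, Rxπ_q, Rxπ_p, Rxπ_t, Rxπ_d, Rqπ_x, Rqπ_y, Rqπ_q, Rqπ_p, Rqπ_t, Rqπ_d]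
  simp only [inv_rules]
  simp only [atom_rules]
  try simp only [order_rules]
  try simp only [der_rules, param_rules, smul_eq_mul, mul_zero, add_zero, zero_add, sub_zero, neg_zero,
    zero_smul]
  obtain ⟨⟨hx, hx1, hq, hq1, ht⟩, hxq, he, he'⟩ := denom_ne_zero
  match_scalars <;> (field_simp <;> ring)

theorem Rπ_sq_q : (Rπ ^ 2) q = 1 - q := by
  simp only [sq_apply, Rπ_apply, map_mul, map_sub, map_add, map_neg, map_inv₀, map_one,
    AlgEquiv.commutes,
    Rxπ_x, Rxπ_y, Rxπ_q, Rxπ_p, Rxπ_t, Rxπ_d, Rqπ_x, Rqπ_y, Rqπ_q, Rqπ_p, Rqπ_t, Rqπ_d]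
  simp only [inv_rules]
  simp only [atom_rules]
  try simp only [order_rules]
  try simp only [der_rules, param_rules, smul_eq_mul, mul_zero, add_zero, zero_add, sub_zero, neg_zero,
    zero_smul]
  obtain ⟨⟨hx, hx1, hq, hq1, ht⟩, hxq, he, he'⟩ := denom_ne_zero
  match_scalars <;> (field_simp <;> ring)

theorem Rπ_sq_p : (Rπ ^ 2) p = -p - t := by
  simp only [sq_apply, Rπ_apply, map_mul, map_sub, map_add, map_neg, map_inv₀, map_one,
    AlgEquiv.commutes,
    Rxπ_x, Rxπ_y, Rxπ_q, Rxπ_p, Rxπ_t, Rxπ_d, Rqπ_x, Rqπ_y, Rqπ_q, Rqπ_p, Rqπ_t, Rqπ_d]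
  simp only [inv_rules]
  simp only [atom_rules]
  try simp only [order_rules]
  try simp only [der_rules, param_rules, smul_eq_mul, mul_zero, add_zero, zero_add, sub_zero, neg_zero,
    zero_smul]
  obtain ⟨⟨hx, hx1, hq, hq1, ht⟩, hxq, he, he'⟩ := denom_ne_zero
  match_scalars <;> (field_simp <;> ring)

theorem Rπ_sq_t : (Rπ ^ 2) t = t := by
  simp only [sq_apply, Rπ_apply, Rxπ_t, Rqπ_t]

/-- The term `2 t⁻¹` is the source of the constant `-2κε₁ε₂` in the formula for `B`. For `Rxπ *
Rqπ⁻¹` it is absent, and `q` stands in place of `q - 1`, which accounts for the different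
coefficient of `t` there. -/
theorem Rπ_sq_d : (Rπ ^ 2) d = d + sc 2 * t⁻¹ + sc (1 / ε₁) * (x - 1) + sc (1 / ε₂) * (q - 1) := by
  simp only [sq_apply, Rπ_apply, map_mul, map_sub, map_add, map_neg, map_inv₀, map_one,
    AlgEquiv.commutes,
    Rxπ_x, Rxπ_y, Rxπ_q, Rxπ_p, Rxπ_t, Rxπ_d, Rqπ_x, Rqπ_y, Rqπ_q, Rqπ_p, Rqπ_t, Rqπ_d]
  simp only [inv_rules]
  simp only [atom_rules]
  try simp only [order_rules]
  try simp only [der_rules, param_rules, smul_eq_mul, mul_zero, add_zero, zero_add, sub_zero, neg_zero,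
    zero_smul]
  obtain ⟨⟨hx, hx1, hq, hq1, ht⟩, hxq, he, he'⟩ := denom_ne_zero
  match_scalars <;> (field_simp <;> ring)

theorem Rπ_inv_sq_x : ((Rxπ * Rqπ⁻¹) ^ 2) x = 1 - x := by
  simp only [mul_sq_apply, map_mul, map_sub, map_add, map_neg, map_inv₀, map_one,
    AlgEquiv.commutes,
    Rqπ_inv_x, Rqπ_inv_y, Rqπ_inv_q, Rqπ_inv_p, Rqπ_inv_t, Rqπ_inv_d,
    Rxπ_x, Rxπ_y, Rxπ_q, Rxπ_p, Rxπ_t, Rxπ_d, Rqπ_x, Rqπ_y, Rqπ_q, Rqπ_p, Rqπ_t, Rqπ_d]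
  simp only [inv_rules]
  simp only [atom_rules]
  try simp only [order_rules]
  try simp only [der_rules, param_rules, smul_eq_mul, mul_zero, add_zero, zero_add, sub_zero, neg_zero,
    zero_smul]
  obtain ⟨⟨hx, hx1, hq, hq1, ht⟩, hxq, he, he'⟩ := denom_ne_zero
  match_scalars <;> (field_simp <;> ring)

theorem Rπ_inv_sq_y : ((Rxπ * Rqπ⁻¹) ^ 2) y = -y - t := by
  simp only [mul_sq_apply, map_mul, map_sub, map_add, map_neg, map_inv₀, map_one,
    AlgEquiv.commutes,
    Rqπ_inv_x, Rqπ_inv_y, Rqπ_inv_q, Rqπ_inv_p, Rqπ_inv_t, Rqπ_inv_d,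
    Rxπ_x, Rxπ_y, Rxπ_q, Rxπ_p, Rxπ_t, Rxπ_d, Rqπ_x, Rqπ_y, Rqπ_q, Rqπ_p, Rqπ_t, Rqπ_d]
  simp only [inv_rules]
  simp only [atom_rules]
  try simp only [order_rules]
  try simp only [der_rules, param_rules, smul_eq_mul, mul_zero, add_zero, zero_add, sub_zero, neg_zero,
    zero_smul]
  obtain ⟨⟨hx, hx1, hq, hq1, ht⟩, hxq, he, he'⟩ := denom_ne_zero
  match_scalars <;> (field_simp <;> ring)

theorem Rπ_inv_sq_q : ((Rxπ * Rqπ⁻¹) ^ 2) q = 1 - q := by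
  simp only [mul_sq_apply, map_mul, map_sub, map_add, map_neg, map_inv₀, map_one,
    AlgEquiv.commutes,
    Rqπ_inv_x, Rqπ_inv_y, Rqπ_inv_q, Rqπ_inv_p, Rqπ_inv_t, Rqπ_inv_d,
    Rxπ_x, Rxπ_y, Rxπ_q, Rxπ_p, Rxπ_t, Rxπ_d, Rqπ_x, Rqπ_y, Rqπ_q, Rqπ_p, Rqπ_t, Rqπ_d]
  simp only [inv_rules]
  simp only [atom_rules]
  try simp only [order_rules]
  try simp only [der_rules, param_rules, smul_eq_mul, mul_zero, add_zero, zero_add, sub_zero, neg_zero,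
    zero_smul]
  obtain ⟨⟨hx, hx1, hq, hq1, ht⟩, hxq, he, he'⟩ := denom_ne_zero
  match_scalars <;> (field_simp <;> ring)

theorem Rπ_inv_sq_p : ((Rxπ * Rqπ⁻¹) ^ 2) p = -p - t := by
  simp only [mul_sq_apply, map_mul, map_sub, map_add, map_neg, map_inv₀, map_one,
    AlgEquiv.commutes,
    Rqπ_inv_x, Rqπ_inv_y, Rqπ_inv_q, Rqπ_inv_p, Rqπ_inv_t, Rqπ_inv_d,
    Rxπ_x, Rxπ_y, Rxπ_q, Rxπ_p, Rxπ_t, Rxπ_d, Rqπ_x, Rqπ_y, Rqπ_q, Rqπ_p, Rqπ_t, Rqπ_d]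
  simp only [inv_rules]
  simp only [atom_rules]
  try simp only [order_rules]
  try simp only [der_rules, param_rules, smul_eq_mul, mul_zero, add_zero, zero_add, sub_zero, neg_zero,
    zero_smul]
  obtain ⟨⟨hx, hx1, hq, hq1, ht⟩, hxq, he, he'⟩ := denom_ne_zero
  match_scalars <;> (field_simp <;> ring)

theorem Rπ_inv_sq_t : ((Rxπ * Rqπ⁻¹) ^ 2) t = t := by
  simp only [mul_sq_apply, Rxπ_t, Rqπ_t, Rqπ_inv_t]

theorem Rπ_inv_sq_d : ((Rxπ * Rqπ⁻¹) ^ 2) d = d + sc (1 / ε₁) * (x - 1) + sc (1 / ε₂) * q := by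
  simp only [mul_sq_apply, map_mul, map_sub, map_add, map_neg, map_inv₀, map_one,
    AlgEquiv.commutes,
    Rqπ_inv_x, Rqπ_inv_y, Rqπ_inv_q, Rqπ_inv_p, Rqπ_inv_t, Rqπ_inv_d,
    Rxπ_x, Rxπ_y, Rxπ_q, Rxπ_p, Rxπ_t, Rxπ_d, Rqπ_x, Rqπ_y, Rqπ_q, Rqπ_p, Rqπ_t, Rqπ_d]
  simp only [inv_rules]
  simp only [atom_rules]
  try simp only [order_rules]
  try simp only [der_rules, param_rules, smul_eq_mul, mul_zero, add_zero, zero_add, sub_zero, neg_zero,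
    zero_smul]
  obtain ⟨⟨hx, hx1, hq, hq1, ht⟩, hxq, he, he'⟩ := denom_ne_zero
  match_scalars <;> (field_simp <;> ring)

set_option maxHeartbeats 4000000 in
-- The squares of `Rπ` and of `Rxπ * Rqπ⁻¹` differ only on `d`, which does not occur in the Lax
-- operator `L`; both act as the reflection `x ↦ 1 - x`, `q ↦ 1 - q`. One computation serves for
-- both.
theorem refl_L (φ : K ≃ₐ[Par] K) (hx : φ x = 1 - x) (hy : φ y = -y - t) (hq : φ q = 1 - q)
    (hp : φ p = -p - t) (ht : φ t = t) :
    φ ((x - q) * L α) = (q - x) * L (act (π ^ 2)) := by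
  rw [← neg_sub x q, neg_mul]
  simp only [x_sub_q_mul_L, H_zero, H_one, map_mul, map_sub, map_add, map_neg, map_inv₀, map_one,
    AlgEquiv.commutes, hx, hy, hq, hp, ht, shiftPar_zero, shiftPar_one, shiftPar_two, shiftPar_three, Matrix.cons_val, act_π_sq,
    α_zero, κ]
  clear hx hy hq hp ht
  simp only [atom_rules]
  try simp only [order_rules]
  try simp only [der_rules, param_rules, smul_eq_mul, mul_zero, add_zero, zero_add, sub_zero, neg_zero,
    zero_smul]
  obtain ⟨⟨hx, hx1, hq, hq1, ht⟩, hxq, he, he'⟩ := denom_ne_zero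
  match_scalars <;> (field_simp <;> ring)

theorem Rπ_sq_L : (Rπ ^ 2) ((x - q) * L α) = (q - x) * L (act (π ^ 2)) :=
  refl_L _ Rπ_sq_x Rπ_sq_y Rπ_sq_q Rπ_sq_p Rπ_sq_t

set_option maxHeartbeats 4000000 in
theorem Rπ_sq_B : (Rπ ^ 2) (B α) = B (act (π ^ 2)) - sc (κ * (α 2 + α 3 - ε₂)) * t -
    sc (2 * κ * ε₁ * ε₂) := by
  simp only [B, H_zero, H_one, map_mul, map_sub, map_add, map_neg, map_inv₀, map_one,
    AlgEquiv.commutes, Rπ_sq_x, Rπ_sq_y, Rπ_sq_q, Rπ_sq_p, Rπ_sq_t, Rπ_sq_d, shiftPar_zero, shiftPar_one, shiftPar_two, shiftPar_three, Matrix.cons_val, act_π_sq,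
    α_zero, κ]
  simp only [inv_rules]
  simp only [atom_rules]
  try simp only [order_rules]
  try simp only [der_rules, param_rules, smul_eq_mul, mul_zero, add_zero, zero_add, sub_zero, neg_zero,
    zero_smul]
  obtain ⟨⟨hx, hx1, hq, hq1, ht⟩, hxq, he, he'⟩ := denom_ne_zero
  match_scalars <;> (field_simp <;> ring)

theorem Rπ_inv_sq_L : ((Rxπ * Rqπ⁻¹) ^ 2) ((x - q) * L α) = (q - x) * L (act (π ^ 2)) :=
  refl_L _ Rπ_inv_sq_x Rπ_inv_sq_y Rπ_inv_sq_q Rπ_inv_sq_p Rπ_inv_sq_t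

set_option maxHeartbeats 4000000 in
theorem Rπ_inv_sq_B : ((Rxπ * Rqπ⁻¹) ^ 2) (B α) = B (act (π ^ 2)) -
    sc (κ * (α 2 + α 3 + κ)) * t := by
  simp only [B, H_zero, H_one, map_mul, map_sub, map_add, map_neg, map_inv₀, map_one,
    AlgEquiv.commutes, Rπ_inv_sq_x, Rπ_inv_sq_y, Rπ_inv_sq_q, Rπ_inv_sq_p, Rπ_inv_sq_t, Rπ_inv_sq_d, shiftPar_zero, shiftPar_one, shiftPar_two, shiftPar_three, Matrix.cons_val, act_π_sq,
    α_zero, κ]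
  simp only [atom_rules]
  try simp only [order_rules]
  try simp only [der_rules, param_rules, smul_eq_mul, mul_zero, add_zero, zero_add, sub_zero, neg_zero,
    zero_smul]
  obtain ⟨⟨hx, hx1, hq, hq1, ht⟩, hxq, he, he'⟩ := denom_ne_zero
  match_scalars <;> (field_simp <;> ring)

/-! ### The Hamiltonians under the individual factors -/

/-- The Hamiltonian with `t` replaced by `u * t`, as a function of the parameters it depends on. -/
def Ham (i : Fin 3) (u a₁ a₂ a₃ : Par) : K :=
  let X := Skew.pos epsV i
  let Y := Skew.mom epsV i
  (X - 1) * (Y + sc u * t) * X * Y - sc (a₁ + a₃ - epsV i) * X * Y + sc a₁ * Y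
    + sc (a₂ + epsV i) * (sc u * t) * X

theorem H_eq_Ham (i : Fin 3) (a : Fin 4 → Par) : H i a = Ham i 1 (a 1) (a 2) (a 3) := by
  rw [H, Ham, map_one, one_mul]

theorem Ham_zero (u a₁ a₂ a₃ : Par) : Ham 0 u a₁ a₂ a₃ = (x - 1) * (y + sc u * t) * x * y -
    sc (a₁ + a₃ - ε₁) * x * y + sc a₁ * y + sc (a₂ + ε₁) * (sc u * t) * x := rfl
theorem Ham_one (u a₁ a₂ a₃ : Par) : Ham 1 u a₁ a₂ a₃ = (q - 1) * (p + sc u * t) * q * p -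
    sc (a₁ + a₃ - ε₂) * q * p + sc a₁ * p + sc (a₂ + ε₂) * (sc u * t) * q := rfl

theorem map_Ham (φ : K ≃ₐ[Par] K) {i : Fin 3} (hX : φ (Skew.pos epsV i) = Skew.pos epsV i)
    (hY : φ (Skew.mom epsV i) = Skew.mom epsV i) {u v : Par} (hT : φ t = sc v * t)
    (a₁ a₂ a₃ : Par) : φ (Ham i u a₁ a₂ a₃) = Ham i (u * v) a₁ a₂ a₃ := by
  simp only [Ham, map_mul, map_add, map_sub, map_one, AlgEquiv.commutes, hX, hY, hT, mul_assoc]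

theorem fix_Ham (φ : K ≃ₐ[Par] K) {i : Fin 3} (hX : φ (Skew.pos epsV i) = Skew.pos epsV i)
    (hY : φ (Skew.mom epsV i) = Skew.mom epsV i) (hT : φ t = t) (u a₁ a₂ a₃ : Par) :
    φ (Ham i u a₁ a₂ a₃) = Ham i u a₁ a₂ a₃ := by
  simp only [Ham, map_mul, map_add, map_sub, map_one, AlgEquiv.commutes, hX, hY, hT]

theorem Rs1_fix {i j : Fin 3} (h : j ≠ i) (b u a₁ a₂ a₃ : Par) :
    Rs1 i b (Ham j u a₁ a₂ a₃) = Ham j u a₁ a₂ a₃ :=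
  fix_Ham _ (Rs1_pos _ _ _) (by rw [Rs1_mom, if_neg h]) (Rs1_pos _ _ _) _ _ _ _
theorem Rs3_fix {i j : Fin 3} (h : j ≠ i) (b u a₁ a₂ a₃ : Par) :
    Rs3 i b (Ham j u a₁ a₂ a₃) = Ham j u a₁ a₂ a₃ :=
  fix_Ham _ (Rs3_pos _ _ _) (by rw [Rs3_mom, if_neg h]) (Rs3_pos _ _ _) _ _ _ _
theorem Rs2_fix {i j : Fin 3} (h : j ≠ i) (hi : i ≠ 2) (b u a₁ a₂ a₃ : Par) :
    Rs2 i b (Ham j u a₁ a₂ a₃) = Ham j u a₁ a₂ a₃ :=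
  fix_Ham _ (by rw [Rs2_pos, if_neg h]) (Rs2_mom _ _ _) (by rw [Rs2_pos, if_neg hi.symm]) _ _ _ _

theorem Rs1_Ham_zero (u a₁ a₂ a₃ : Par) : Rs1 0 a₁ (Ham 0 u a₁ a₂ a₃) =
    Ham 0 u (-a₁) (a₂ + a₁) a₃ - sc a₁ * (sc u * t + sc (a₃ - ε₁)) := by
  simp only [Ham_zero, map_mul, map_sub, map_add, map_neg, map_inv₀, map_one,
    AlgEquiv.commutes, Rs1_pos, Rs1_mom, Fin.reduceEq, ↓reduceIte, Fin.isValue]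
  simp only [inv_rules]
  simp only [atom_rules]
  try simp only [order_rules]
  try simp only [der_rules, param_rules, smul_eq_mul, mul_zero, add_zero, zero_add, sub_zero, neg_zero,
    zero_smul]
  obtain ⟨⟨hx, hx1, hq, hq1, ht⟩, hxq, he, he'⟩ := denom_ne_zero
  match_scalars <;> (field_simp <;> ring)

theorem Rs3_Ham_zero (u a₁ a₂ a₃ : Par) : Rs3 0 a₃ (Ham 0 u a₁ a₂ a₃) =
    Ham 0 u a₁ (a₂ + a₃) (-a₃) - sc (a₃ * (a₁ - ε₁)) := by
  simp only [Ham_zero, map_mul, map_sub, map_add, map_neg, map_inv₀, map_one,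
    AlgEquiv.commutes, Rs3_pos, Rs3_mom, Fin.reduceEq, ↓reduceIte, Fin.isValue]
  simp only [inv_rules]
  simp only [atom_rules]
  try simp only [order_rules]
  try simp only [der_rules, param_rules, smul_eq_mul, mul_zero, add_zero, zero_add, sub_zero, neg_zero,
    zero_smul]
  obtain ⟨⟨hx, hx1, hq, hq1, ht⟩, hxq, he, he'⟩ := denom_ne_zero
  match_scalars <;> (field_simp <;> ring)

/-- The factors `y + t` and `y` become `y` and `y - t`. They have changed places, with `t` replaced
by `-t`, and reordering them accounts for the new second parameter and the multiple of `t`. -/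
theorem adExpX_Ham (a₁ a₂ a₃ : Par) : adExpX (Ham 0 1 a₁ a₂ a₃) =
    Ham 0 (-1) a₁ (-a₁ - a₂ - a₃) a₃ - sc (a₁ - ε₁) * t := by
  simp only [Ham_zero, map_mul, map_sub, map_add, map_neg, map_inv₀, map_one,
    AlgEquiv.commutes, adExpX_pos, adExpX_y]
  simp only [atom_rules]
  try simp only [order_rules]
  try simp only [der_rules, param_rules, smul_eq_mul, mul_zero, add_zero, zero_add, sub_zero, neg_zero,
    zero_smul]
  obtain ⟨⟨hx, hx1, hq, hq1, ht⟩, hxq, he, he'⟩ := denom_ne_zero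
  match_scalars <;> (field_simp <;> ring)

theorem Rs1_Ham_one (u a₁ a₂ a₃ : Par) : Rs1 1 a₁ (Ham 1 u a₁ a₂ a₃) =
    Ham 1 u (-a₁) (a₂ + a₁) a₃ - sc a₁ * (sc u * t + sc (a₃ - ε₂)) := by
  simp only [Ham_one, map_mul, map_sub, map_add, map_neg, map_inv₀, map_one,
    AlgEquiv.commutes, Rs1_pos, Rs1_mom, Fin.reduceEq, ↓reduceIte, Fin.isValue]
  simp only [inv_rules]
  simp only [atom_rules]
  try simp only [order_rules]
  try simp only [der_rules, param_rules, smul_eq_mul, mul_zero, add_zero, zero_add, sub_zero, neg_zero,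
    zero_smul]
  obtain ⟨⟨hx, hx1, hq, hq1, ht⟩, hxq, he, he'⟩ := denom_ne_zero
  match_scalars <;> (field_simp <;> ring)

theorem Rs3_Ham_one (u a₁ a₂ a₃ : Par) : Rs3 1 a₃ (Ham 1 u a₁ a₂ a₃) =
    Ham 1 u a₁ (a₂ + a₃) (-a₃) - sc (a₃ * (a₁ - ε₂)) := by
  simp only [Ham_one, map_mul, map_sub, map_add, map_neg, map_inv₀, map_one,
    AlgEquiv.commutes, Rs3_pos, Rs3_mom, Fin.reduceEq, ↓reduceIte, Fin.isValue]
  simp only [inv_rules]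
  simp only [atom_rules]
  try simp only [order_rules]
  try simp only [der_rules, param_rules, smul_eq_mul, mul_zero, add_zero, zero_add, sub_zero, neg_zero,
    zero_smul]
  obtain ⟨⟨hx, hx1, hq, hq1, ht⟩, hxq, he, he'⟩ := denom_ne_zero
  match_scalars <;> (field_simp <;> ring)

theorem adExpQ_Ham (a₁ a₂ a₃ : Par) : adExpQ (Ham 1 1 a₁ a₂ a₃) =
    Ham 1 (-1) a₁ (-a₁ - a₂ - a₃) a₃ - sc (a₁ - ε₂) * t := by
  simp only [Ham_one, map_mul, map_sub, map_add, map_neg, map_inv₀, map_one,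
    AlgEquiv.commutes, adExpQ_pos, adExpQ_p]
  simp only [atom_rules]
  try simp only [order_rules]
  try simp only [der_rules, param_rules, smul_eq_mul, mul_zero, add_zero, zero_add, sub_zero, neg_zero,
    zero_smul]
  obtain ⟨⟨hx, hx1, hq, hq1, ht⟩, hxq, he, he'⟩ := denom_ne_zero
  match_scalars <;> (field_simp <;> ring)

theorem sub_inv_mul {X Y c : K} (hY : Y ≠ 0) : (X - c * Y⁻¹) * Y = X * Y - c := by
  rw [sub_mul, mul_assoc, inv_mul_cancel₀ hY, mul_one]

theorem mul_sub_inv {X Y c : K} (hY : Y ≠ 0) (hc : ∀ z, c * z = z * c) :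
    Y * (X - c * Y⁻¹) = Y * X - c := by
  rw [mul_sub, hc, ← mul_assoc, mul_inv_cancel₀ hY, one_mul]

theorem mom_ne_zero (i : Fin 3) : Skew.mom epsV i ≠ 0 := fun h => by
  have h1 := Skew.cross_self (eps := epsV) i
  rw [h, zero_mul, mul_zero, zero_add] at h1
  exact (inferInstance : Fact (∀ i, epsV i ≠ 0)).out i ((map_eq_zero _).1 h1.symm)

/-- Put `W = X - c Y⁻¹` and `N = X Y - c`. Then `W Y = N`, and the commutation relation gives `N = Y
X - (c + e)`. The only terms in which `W` meets no `Y` are `W T N` and the linear one, whose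
coefficient `c + e` is exactly such that they add up to `W T Y X = T N X`. Hence the inverse
disappears. -/
theorem Ham_sub_inv {X Y T c e b a : K} (hY : Y ≠ 0) (hc : ∀ z, c * z = z * c)
    (he : ∀ z, e * z = z * e) (hX : T * X = X * T) (hTY : T * Y = Y * T)
    (h : Y * X = X * Y + e) :
    (X - c * Y⁻¹ - 1) * (Y + T) * (X - c * Y⁻¹) * Y - b * (X - c * Y⁻¹) * Y + a * Y +
      (c + e) * T * (X - c * Y⁻¹) =
    (X * Y - c) * (X * Y - c) + T * (X * Y - c) * X - (Y + T) * (X * Y - c) -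
      b * (X * Y - c) + a * Y := by
  have hTW : T * (X - c * Y⁻¹) = (X - c * Y⁻¹) * T :=
    ((show Commute T X from hX).sub_right
      ((show Commute T c from (hc T).symm).mul_right (show Commute T Y from hTY).inv_right₀)).eq
  have hW := sub_inv_mul (X := X) (c := c) hY
  generalize X - c * Y⁻¹ = W at hTW hW ⊢
  have hN : X * Y - c = Y * X - (c + e) := by rw [h]; abel
  have hce : (c + e) * T * W = W * T * (c + e) := by
    rw [mul_assoc, add_mul, hc, he, ← mul_add, hTW]
  rw [mul_assoc _ W Y, mul_assoc b, hW, hce]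
  -- The cancellation of the inverse: `N + (c + e) = Y X`, after which `W` meets `Y`.
  have h2 : W * T * (X * Y - c) + W * T * (c + e) = T * (X * Y - c) * X := by
    rw [← mul_add, hN, sub_add_cancel, ← hN, ← hW, ← hTW]
    simp only [mul_assoc]
  rw [← h2, sub_mul W 1, mul_add W, hW, one_mul]
  generalize X * Y - c = N
  simp only [add_mul, sub_mul]
  abel

theorem Rs2_Ham_zero (u a₁ a₂ a₃ : Par) : Rs2 0 a₂ (Ham 0 u a₁ a₂ a₃) =
    Ham 0 u (a₁ + a₂) (-a₂) (a₃ + a₂) + sc a₂ * (sc u * t + sc (a₁ + a₂ + a₃ - ε₁)) := by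
  rw [Ham_zero, map_add sc a₂]
  simp only [map_mul, map_sub (Rs2 _ _), map_add (Rs2 _ _), map_one, AlgEquiv.commutes, Rs2_pos,
    Rs2_mom, Fin.reduceEq, ↓reduceIte, Fin.isValue]
  rw [Ham_sub_inv (e := sc ε₁) (mom_ne_zero 0) (Algebra.commutes a₂) (Algebra.commutes _)
    (by rw [mul_assoc, Skew.pos_ne, ← mul_assoc, Algebra.commutes u, mul_assoc])
    (by rw [mul_assoc, ← (Skew.cross_ne (by decide)).eq, ← mul_assoc, Algebra.commutes u, mul_assoc])
    (Skew.cross_self 0), Ham_zero]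
  simp only [atom_rules]
  try simp only [order_rules]
  try simp only [der_rules, param_rules, smul_eq_mul, mul_zero, add_zero, zero_add, sub_zero, neg_zero,
    zero_smul]
  obtain ⟨⟨hx, hx1, hq, hq1, ht⟩, hxq, he, he'⟩ := denom_ne_zero
  match_scalars <;> (field_simp <;> ring)

theorem Rs2_Ham_one (u a₁ a₂ a₃ : Par) : Rs2 1 a₂ (Ham 1 u a₁ a₂ a₃) =
    Ham 1 u (a₁ + a₂) (-a₂) (a₃ + a₂) + sc a₂ * (sc u * t + sc (a₁ + a₂ + a₃ - ε₂)) := by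
  rw [Ham_one, map_add sc a₂]
  simp only [map_mul, map_sub (Rs2 _ _), map_add (Rs2 _ _), map_one, AlgEquiv.commutes, Rs2_pos,
    Rs2_mom, Fin.reduceEq, ↓reduceIte, Fin.isValue]
  rw [Ham_sub_inv (e := sc ε₂) (mom_ne_zero 1) (Algebra.commutes a₂) (Algebra.commutes _)
    (by rw [mul_assoc, Skew.pos_ne, ← mul_assoc, Algebra.commutes u, mul_assoc])
    (by rw [mul_assoc, ← (Skew.cross_ne (by decide)).eq, ← mul_assoc, Algebra.commutes u, mul_assoc])
    (Skew.cross_self 1), Ham_one]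
  simp only [atom_rules]
  try simp only [order_rules]
  try simp only [der_rules, param_rules, smul_eq_mul, mul_zero, add_zero, zero_add, sub_zero, neg_zero,
    zero_smul]
  obtain ⟨⟨hx, hx1, hq, hq1, ht⟩, hxq, he, he'⟩ := denom_ne_zero
  match_scalars <;> (field_simp <;> ring)

/-! ### The Hamiltonians along the long words -/

theorem ne_facts : (0 : Fin 3) ≠ 1 ∧ (1 : Fin 3) ≠ 0 ∧ (0 : Fin 3) ≠ 2 ∧ (1 : Fin 3) ≠ 2 := by decide

theorem B_eq_Ham (a : Fin 4 → Par) : B a = sc ε₂ * Ham 0 1 (a 1) (a 2) (a 3) -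
    sc ε₁ * Ham 1 1 (a 1) (a 2 + κ) (a 3) - sc (κ * ε₁ * ε₂) * t * d := by
  rw [B, H_eq_Ham, H_eq_Ham, shiftPar_one, shiftPar_two, shiftPar_three]

theorem αbar_eq (i : Fin 4) : αbar i = α i + (α 2 + κ) := add_assoc _ _ _

theorem Rσ_apply (z : K) : Rσ z = negT (adExpX (adExpQ z)) := by
  rw [Rσ, AlgEquiv.mul_apply, AlgEquiv.mul_apply]

theorem mul_mul_apply (f g h k : K ≃ₐ[Par] K) (z : K) : (f * g * h * k) z = f (g (h (k z))) := by
  rw [AlgEquiv.mul_apply, AlgEquiv.mul_apply, AlgEquiv.mul_apply]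

theorem Tσ_apply (z : K) : Tσ z = Rs2 0 (-α 2 - κ) (Rs1 0 (α 1) (Rs3 0 (α 3) (Rσ
    (Rs1 1 (αbar 1) (Rs3 1 (αbar 3) (Rs2 1 (α 2 + κ) z)))))) := by
  rw [Tσ, mul_mul_apply, mul_mul_apply]

theorem adExpQ_fix (u a₁ a₂ a₃ : Par) : adExpQ (Ham 0 u a₁ a₂ a₃) = Ham 0 u a₁ a₂ a₃ :=
  fix_Ham _ (adExpQ_pos _) adExpQ_y (adExpQ_pos _) _ _ _ _
theorem adExpX_fix (u a₁ a₂ a₃ : Par) : adExpX (Ham 1 u a₁ a₂ a₃) = Ham 1 u a₁ a₂ a₃ :=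
  fix_Ham _ (adExpX_pos _) adExpX_p (adExpX_pos _) _ _ _ _
theorem negT_Ham_zero (u a₁ a₂ a₃ : Par) : negT (Ham 0 u a₁ a₂ a₃) = Ham 0 (-u) a₁ a₂ a₃ := by
  rw [map_Ham negT negT_x negT_y (v := -1) (by rw [negT_t, map_neg, map_one, neg_one_mul]),
    mul_neg_one]
theorem negT_Ham_one (u a₁ a₂ a₃ : Par) : negT (Ham 1 u a₁ a₂ a₃) = Ham 1 (-u) a₁ a₂ a₃ := by
  rw [map_Ham negT negT_q negT_p (v := -1) (by rw [negT_t, map_neg, map_one, neg_one_mul]),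
    mul_neg_one]

theorem Rσ_Ham_zero (a₁ a₂ a₃ : Par) : Rσ (Ham 0 1 a₁ a₂ a₃) =
    Ham 0 1 a₁ (-a₁ - a₂ - a₃) a₃ + sc (a₁ - ε₁) * t := by
  rw [Rσ_apply, adExpQ_fix, adExpX_Ham, map_sub, negT_Ham_zero, map_mul, AlgEquiv.commutes, negT_t,
    neg_neg, mul_neg, sub_neg_eq_add]
theorem Rσ_Ham_one (a₁ a₂ a₃ : Par) : Rσ (Ham 1 1 a₁ a₂ a₃) =
    Ham 1 1 a₁ (-a₁ - a₂ - a₃) a₃ + sc (a₁ - ε₂) * t := by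
  rw [Rσ_apply, adExpQ_Ham, map_sub, adExpX_fix, map_sub, negT_Ham_one, map_mul, map_mul,
    AlgEquiv.commutes, AlgEquiv.commutes, adExpX_pos, negT_t, neg_neg, mul_neg, sub_neg_eq_add]
theorem Rσ_t : Rσ t = -t := by rw [Rσ_apply, adExpQ_pos, adExpX_pos, negT_t]
theorem Rσ_d : Rσ d = -d - sc (1 / ε₁) * x - sc (1 / ε₂) * q := by
  simp only [Rσ_apply, adExpQ_d, adExpX_d, adExpX_pos, negT_d, negT_x, negT_q, map_sub, map_mul,
    AlgEquiv.commutes]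

/-- The Hamiltonian factors alone would end with second parameters `-α 2` and `α 2 + κ`. The image
of `t d` under `Rσ` contributes terms in `t x` and `t q` that shift these to `-α 2 - κ` and `α 2 + κ
+ κ`. The first shift is what makes the remaining factor, `s₂` with parameter `-α 2 - κ`, applicable
to the Hamiltonian in `x`. -/
theorem Tσ_B_aux : Rs1 0 (α 1) (Rs3 0 (α 3) (Rσ
    (Rs1 1 (αbar 1) (Rs3 1 (αbar 3) (Rs2 1 (α 2 + κ) (B α)))))) =
    sc ε₂ * Ham 0 1 (-α 1) (-α 2 - κ) (-α 3) - sc ε₁ * Ham 1 1 (-αbar 1) (α 2 + κ + κ) (-αbar 3) -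
      sc (κ * ε₁ * ε₂) * t * d + sc (ε₁ * (α 2 + κ)) * (t - sc (α 1 + α 2 + α 3 + ε₁)) := by
  simp only [B_eq_Ham, αbar_eq, map_mul, map_sub, map_add, map_neg, map_inv₀, map_one,
    AlgEquiv.commutes, Rs1_fix, Rs3_fix, Rs2_fix, Rσ_Ham_zero, Rσ_Ham_one,
    Rs1_Ham_zero, Rs1_Ham_one, Rs2_Ham_one, Rs3_Ham_zero, Rs3_Ham_one, ne_facts, ne_eq,
    not_false_eq_true, Rs1_pos, Rs3_pos, Rs2_pos, Rs2_mom, Rs1_mom, Rs3_mom, Rσ_t, Rσ_d,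
    Fin.reduceEq, ↓reduceIte, Fin.isValue]
  simp only [Ham_zero, Ham_one, κ]
  simp only [atom_rules]
  try simp only [order_rules]
  try simp only [der_rules, param_rules, smul_eq_mul, mul_zero, add_zero, zero_add, sub_zero, neg_zero,
    zero_smul]
  obtain ⟨⟨hx, hx1, hq, hq1, ht⟩, hxq, he, he'⟩ := denom_ne_zero
  match_scalars <;> (field_simp <;> ring)

theorem Tσ_B : Tσ (B α) = B (act (σ * s 1 * s 3 * s 2)) + sc (κ * (α 2 + κ)) * (sc (α 0) + t) := by
  rw [Tσ_apply, Tσ_B_aux, B_eq_Ham, act_σ_word]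
  simp only [map_mul, map_sub, map_add, map_neg, map_inv₀, map_one,
    AlgEquiv.commutes, Rs2_Ham_zero, Rs2_fix, ne_facts, ne_eq, not_false_eq_true, Rs2_pos, Rs2_mom,
    Fin.reduceEq, ↓reduceIte, Fin.isValue]
  simp only [Matrix.cons_val, Ham_zero, Ham_one, αbar_eq, α_zero, κ]
  simp only [atom_rules]
  try simp only [order_rules]
  try simp only [der_rules, param_rules, smul_eq_mul, mul_zero, add_zero, zero_add, sub_zero, neg_zero,
    zero_smul]
  obtain ⟨⟨hx, hx1, hq, hq1, ht⟩, hxq, he, he'⟩ := denom_ne_zero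
  match_scalars <;> (field_simp <;> ring)

/-- Each reflection carries the parameter that its predecessor has produced: `(α₁, α₂, α₃)` becomes
`(-α₁, α₁ + α₂, α₃)`, then `(α₂, -α₁ - α₂, α₁ + α₂ + α₃)`, then `(α₂, α₃, -α₁ - α₂ - α₃)`. The
rotation brings this back to the original form up to terms with the factor `κ`. -/
theorem x_chain : Rxπ (Rs3 0 (α 3 + (α 2 + α 1)) (Rs2 0 (α 2 + α 1) (Rs1 0 (α 1)
    (Ham 0 1 (α 1) (α 2) (α 3))))) = Ham 0 1 (α 1 - κ) (α 2) (α 3) - sc κ * (x - 1) * y := by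
  simp only [map_mul, map_sub, map_add, map_neg, map_inv₀, map_one,
    AlgEquiv.commutes, Rs1_Ham_zero, Rs2_Ham_zero, Rs3_Ham_zero, ne_facts, ne_eq,
    not_false_eq_true, Rs1_pos, Rs3_pos, Rs2_pos, Fin.reduceEq, ↓reduceIte, Fin.isValue]
  simp only [Ham_zero, κ, map_mul, map_sub, map_add, map_neg, map_inv₀, map_one,
    AlgEquiv.commutes, Rxπ_x, Rxπ_y, Rxπ_q, Rxπ_p, Rxπ_t, Rxπ_d]
  simp only [inv_rules]
  simp only [atom_rules]
  try simp only [order_rules]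
  try simp only [der_rules, param_rules, smul_eq_mul, mul_zero, add_zero, zero_add, sub_zero, neg_zero,
    zero_smul]
  obtain ⟨⟨hx, hx1, hq, hq1, ht⟩, hxq, he, he'⟩ := denom_ne_zero
  match_scalars <;> (field_simp <;> ring)

/-- After the first reflection the shifts by `κ` cancel in the second parameter, so the later
reflections have the same parameters as for `x`. The final correction has the opposite sign. -/
theorem q_chain : Rqπ (Rs3 1 (α 3 + (α 2 + α 1)) (Rs2 1 (α 2 + α 1) (Rs1 1 (α 1 - κ)
    (Ham 1 1 (α 1 - κ) (α 2 + κ) (α 3))))) = Ham 1 1 (α 1) (α 2 + κ) (α 3) + sc κ * (q - 1) * p := by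
  rw [Rs1_Ham_one, show α 2 + κ + (α 1 - κ) = α 2 + α 1 by ring]
  simp only [map_mul, map_sub, map_add, map_neg, map_inv₀, map_one,
    AlgEquiv.commutes, Rs2_Ham_one, Rs3_Ham_one, ne_facts, ne_eq,
    not_false_eq_true, Rs1_pos, Rs3_pos, Rs2_pos, Fin.reduceEq, ↓reduceIte, Fin.isValue]
  simp only [Ham_one, κ, map_mul, map_sub, map_add, map_neg, map_inv₀, map_one,
    AlgEquiv.commutes, Rqπ_x, Rqπ_y, Rqπ_q, Rqπ_p, Rqπ_t, Rqπ_d]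
  simp only [inv_rules]
  simp only [atom_rules]
  try simp only [order_rules]
  try simp only [der_rules, param_rules, smul_eq_mul, mul_zero, add_zero, zero_add, sub_zero, neg_zero,
    zero_smul]
  obtain ⟨⟨hx, hx1, hq, hq1, ht⟩, hxq, he, he'⟩ := denom_ne_zero
  match_scalars <;> (field_simp <;> ring)

/-! ### Inverses and commutation of the factors -/

theorem fin_three {P : Fin 3 → Prop} (h₀ : P 0) (h₁ : P 1) (h₂ : P 2) : ∀ i, P i := by
  intro i; fin_cases i <;> assumption

theorem equiv_ext {f g : K ≃ₐ[Par] K} (hp : ∀ i, f (Skew.pos epsV i) = g (Skew.pos epsV i))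
    (hm : ∀ i, f (Skew.mom epsV i) = g (Skew.mom epsV i)) : f = g := by
  have h : f.toAlgHom = g.toAlgHom := Skew.hom_ext hp hm
  exact AlgEquiv.ext fun z => DFunLike.congr_fun h z

theorem Rs1_neg_mul (i : Fin 3) (b : Par) : Rs1 i (-b) * Rs1 i b = 1 := by
  apply equiv_ext <;> intro a <;> rw [AlgEquiv.mul_apply, AlgEquiv.one_apply]
  · rw [Rs1_pos, Rs1_pos]
  · rw [Rs1_mom i a b]
    split_ifs with h
    · rw [map_add, map_mul, AlgEquiv.commutes, map_inv₀, Rs1_pos, Rs1_mom, if_pos h, map_neg]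
      noncomm_ring
    · rw [Rs1_mom, if_neg h]
theorem Rs3_neg_mul (i : Fin 3) (b : Par) : Rs3 i (-b) * Rs3 i b = 1 := by
  apply equiv_ext <;> intro a <;> rw [AlgEquiv.mul_apply, AlgEquiv.one_apply]
  · rw [Rs3_pos, Rs3_pos]
  · rw [Rs3_mom i a b]
    split_ifs with h
    · rw [map_add, map_mul, AlgEquiv.commutes, map_inv₀, map_sub, map_one, Rs3_pos, Rs3_mom,
        if_pos h, map_neg]
      noncomm_ring
    · rw [Rs3_mom, if_neg h]
theorem Rs2_neg_mul (i : Fin 3) (b : Par) : Rs2 i (-b) * Rs2 i b = 1 := by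
  apply equiv_ext <;> intro a <;> rw [AlgEquiv.mul_apply, AlgEquiv.one_apply]
  · rw [Rs2_pos i a b]
    split_ifs with h
    · rw [map_sub, map_mul, AlgEquiv.commutes, map_inv₀, Rs2_mom, Rs2_pos, if_pos h, map_neg]
      noncomm_ring
    · rw [Rs2_pos, if_neg h]
  · rw [Rs2_mom, Rs2_mom]
theorem commute_Rs1_Rs3 (i : Fin 3) (b c : Par) : Commute (Rs1 i b) (Rs3 i c) := by
  apply equiv_ext <;> intro a <;> rw [AlgEquiv.mul_apply, AlgEquiv.mul_apply]
  · rw [Rs1_pos, Rs3_pos, Rs1_pos]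
  · rw [Rs1_mom, Rs3_mom]
    split_ifs with h
    · simp only [map_add, map_sub, map_one, map_mul, AlgEquiv.commutes, map_inv₀, Rs1_pos, Rs3_pos,
        Rs1_mom, Rs3_mom, if_pos h]
      abel
    · rw [Rs1_mom, Rs3_mom, if_neg h, if_neg h]

/-- The automorphism only involves the variables `x`, `y`, `t`, `d`. -/
def OnlyX (f : K ≃ₐ[Par] K) : Prop := (f q = q ∧ f p = p ∧ f t = t) ∧
  ∀ g : K ≃ₐ[Par] K, g x = x → g y = y → g t = t →
    g (f x) = f x ∧ g (f y) = f y ∧ g (f d - d) = f d - d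

/-- The automorphism only involves the variables `q`, `p`, `t`, `d`. -/
def OnlyQ (f : K ≃ₐ[Par] K) : Prop := (f x = x ∧ f y = y ∧ f t = t) ∧
  ∀ g : K ≃ₐ[Par] K, g q = q → g p = p → g t = t →
    g (f q) = f q ∧ g (f p) = f p ∧ g (f d - d) = f d - d

/-- On `x`, `y`, `q`, `p`, `t` one of the two automorphisms does nothing. Both may move `d`, but
each changes it by a term that the other fixes, so the two changes add up in either order. -/
theorem OnlyX.commute {f g : K ≃ₐ[Par] K} (hf : OnlyX f) (hg : OnlyQ g) : Commute f g := by
  obtain ⟨⟨fq, fp, ft⟩, hf⟩ := hf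
  obtain ⟨⟨gx, gy, gt⟩, hg⟩ := hg
  obtain ⟨hx, hy, hd⟩ := hf g gx gy gt
  obtain ⟨hq, hp, hd'⟩ := hg f fq fp ft
  apply equiv_ext <;> apply fin_three <;> rw [AlgEquiv.mul_apply, AlgEquiv.mul_apply]
  · exact (congrArg f gx).trans hx.symm
  · exact hq.trans (congrArg g fq).symm
  · exact (congrArg f gt).trans (ft.trans (gt.symm.trans (congrArg g ft.symm)))
  · exact (congrArg f gy).trans hy.symm
  · exact hp.trans (congrArg g fp).symm
  -- Both composites send `d` to `d` plus the sum of the two increments.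
  · rw [map_sub] at hd hd'
    change f (g d) = g (f d)
    rw [sub_eq_iff_eq_add.1 hd, sub_eq_iff_eq_add.1 hd']
    abel

theorem onlyX_Rs1 (b : Par) : OnlyX (Rs1 0 b) := by
  refine ⟨?_, fun g h₁ h₂ h₃ => ?_⟩
  · simp only [Rs1_pos, Rs1_mom, Fin.reduceEq, ↓reduceIte, Fin.isValue, and_self]
  · simp only [Rs1_pos, Rs1_mom, map_mul, map_sub, map_add, map_neg, map_inv₀, map_one, AlgEquiv.commutes, h₁, h₂, h₃,
      sub_self, map_zero, sub_sub_cancel_left, Fin.reduceEq, ↓reduceIte, Fin.isValue, and_self]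
theorem onlyX_Rs2 (b : Par) : OnlyX (Rs2 0 b) := by
  refine ⟨?_, fun g h₁ h₂ h₃ => ?_⟩
  · simp only [Rs2_pos, Rs2_mom, Fin.reduceEq, ↓reduceIte, Fin.isValue, and_self]
  · simp only [Rs2_pos, Rs2_mom, map_mul, map_sub, map_add, map_neg, map_inv₀, map_one, AlgEquiv.commutes, h₁, h₂, h₃,
      sub_self, map_zero, sub_sub_cancel_left, Fin.reduceEq, ↓reduceIte, Fin.isValue, and_self]
theorem onlyX_Rs3 (b : Par) : OnlyX (Rs3 0 b) := by
  refine ⟨?_, fun g h₁ h₂ h₃ => ?_⟩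
  · simp only [Rs3_pos, Rs3_mom, Fin.reduceEq, ↓reduceIte, Fin.isValue, and_self]
  · simp only [Rs3_pos, Rs3_mom, map_mul, map_sub, map_add, map_neg, map_inv₀, map_one, AlgEquiv.commutes, h₁, h₂, h₃,
      sub_self, map_zero, sub_sub_cancel_left, Fin.reduceEq, ↓reduceIte, Fin.isValue, and_self]
theorem onlyX_Rxπ : OnlyX (Rxπ) := by
  refine ⟨?_, fun g h₁ h₂ h₃ => ?_⟩
  · simp only [Rxπ_x, Rxπ_y, Rxπ_q, Rxπ_p, Rxπ_t, Rxπ_d, Fin.reduceEq, ↓reduceIte, Fin.isValue, and_self]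
  · simp only [Rxπ_x, Rxπ_y, Rxπ_q, Rxπ_p, Rxπ_t, Rxπ_d, map_mul, map_sub, map_add, map_neg, map_inv₀, map_one, AlgEquiv.commutes, h₁, h₂, h₃,
      sub_self, map_zero, sub_sub_cancel_left, Fin.reduceEq, ↓reduceIte, Fin.isValue, and_self]
theorem onlyX_adExpX : OnlyX (adExpX) := by
  refine ⟨?_, fun g h₁ h₂ h₃ => ?_⟩
  · simp only [adExpX_pos, adExpX_y, adExpX_p, adExpX_d, Fin.reduceEq, ↓reduceIte, Fin.isValue, and_self]
  · simp only [adExpX_pos, adExpX_y, adExpX_p, adExpX_d, map_mul, map_sub, map_add, map_neg, map_inv₀, map_one, AlgEquiv.commutes, h₁, h₂, h₃,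
      sub_self, map_zero, sub_sub_cancel_left, Fin.reduceEq, ↓reduceIte, Fin.isValue, and_self]
theorem onlyQ_Rs1 (b : Par) : OnlyQ (Rs1 1 b) := by
  refine ⟨?_, fun g h₁ h₂ h₃ => ?_⟩
  · simp only [Rs1_pos, Rs1_mom, Fin.reduceEq, ↓reduceIte, Fin.isValue, and_self]
  · simp only [Rs1_pos, Rs1_mom, map_mul, map_sub, map_add, map_neg, map_inv₀, map_one, AlgEquiv.commutes, h₁, h₂, h₃,
      sub_self, map_zero, sub_sub_cancel_left, Fin.reduceEq, ↓reduceIte, Fin.isValue, and_self]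
theorem onlyQ_Rs2 (b : Par) : OnlyQ (Rs2 1 b) := by
  refine ⟨?_, fun g h₁ h₂ h₃ => ?_⟩
  · simp only [Rs2_pos, Rs2_mom, Fin.reduceEq, ↓reduceIte, Fin.isValue, and_self]
  · simp only [Rs2_pos, Rs2_mom, map_mul, map_sub, map_add, map_neg, map_inv₀, map_one, AlgEquiv.commutes, h₁, h₂, h₃,
      sub_self, map_zero, sub_sub_cancel_left, Fin.reduceEq, ↓reduceIte, Fin.isValue, and_self]
theorem onlyQ_Rs3 (b : Par) : OnlyQ (Rs3 1 b) := by
  refine ⟨?_, fun g h₁ h₂ h₃ => ?_⟩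
  · simp only [Rs3_pos, Rs3_mom, Fin.reduceEq, ↓reduceIte, Fin.isValue, and_self]
  · simp only [Rs3_pos, Rs3_mom, map_mul, map_sub, map_add, map_neg, map_inv₀, map_one, AlgEquiv.commutes, h₁, h₂, h₃,
      sub_self, map_zero, sub_sub_cancel_left, Fin.reduceEq, ↓reduceIte, Fin.isValue, and_self]
theorem onlyQ_Rqπ : OnlyQ (Rqπ) := by
  refine ⟨?_, fun g h₁ h₂ h₃ => ?_⟩
  · simp only [Rqπ_x, Rqπ_y, Rqπ_q, Rqπ_p, Rqπ_t, Rqπ_d, Fin.reduceEq, ↓reduceIte, Fin.isValue, and_self]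
  · simp only [Rqπ_x, Rqπ_y, Rqπ_q, Rqπ_p, Rqπ_t, Rqπ_d, map_mul, map_sub, map_add, map_neg, map_inv₀, map_one, AlgEquiv.commutes, h₁, h₂, h₃,
      sub_self, map_zero, sub_sub_cancel_left, Fin.reduceEq, ↓reduceIte, Fin.isValue, and_self]
theorem onlyQ_adExpQ : OnlyQ (adExpQ) := by
  refine ⟨?_, fun g h₁ h₂ h₃ => ?_⟩
  · simp only [adExpQ_pos, adExpQ_y, adExpQ_p, adExpQ_d, Fin.reduceEq, ↓reduceIte, Fin.isValue, and_self]
  · simp only [adExpQ_pos, adExpQ_y, adExpQ_p, adExpQ_d, map_mul, map_sub, map_add, map_neg, map_inv₀, map_one, AlgEquiv.commutes, h₁, h₂, h₃,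
      sub_self, map_zero, sub_sub_cancel_left, Fin.reduceEq, ↓reduceIte, Fin.isValue, and_self]

theorem negT_commute {f : K ≃ₐ[Par] K} (h : ∀ i, negT (f (Skew.pos epsV i)) = f (negT (Skew.pos epsV i)))
    (h' : ∀ i, negT (f (Skew.mom epsV i)) = f (negT (Skew.mom epsV i))) : Commute negT f :=
  equiv_ext h h'

theorem commute_negT_Rs1 (b : Par) : Commute negT (Rs1 0 b) := by
  apply negT_commute <;> apply fin_three <;>
    simp only [Rs1_pos, Rs1_mom, negT_x, negT_y, negT_q, negT_p, negT_t, negT_d, map_mul, map_sub, map_add, map_neg, map_inv₀, map_one, AlgEquiv.commutes, Fin.reduceEq,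
      ↓reduceIte, Fin.isValue]
theorem commute_negT_Rs3 (b : Par) : Commute negT (Rs3 0 b) := by
  apply negT_commute <;> apply fin_three <;>
    simp only [Rs3_pos, Rs3_mom, negT_x, negT_y, negT_q, negT_p, negT_t, negT_d, map_mul, map_sub, map_add, map_neg, map_inv₀, map_one, AlgEquiv.commutes, Fin.reduceEq,
      ↓reduceIte, Fin.isValue]
theorem commute_negT_Rs2 (b : Par) : Commute negT (Rs2 0 b) := by
  apply negT_commute <;> apply fin_three <;>
    simp only [Rs2_pos, Rs2_mom, negT_x, negT_y, negT_q, negT_p, negT_t, negT_d, map_mul, map_sub, map_add, map_neg, map_inv₀, map_one, AlgEquiv.commutes, Fin.reduceEq,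
      ↓reduceIte, Fin.isValue]
-- The substitution `t ↦ -t` conjugates the exponential gauge transformation into its inverse.
theorem adExpQ_negT : adExpQ * negT * adExpQ = negT := by
  apply equiv_ext <;> apply fin_three <;> rw [AlgEquiv.mul_apply, AlgEquiv.mul_apply] <;>
    simp only [adExpQ_pos, adExpQ_y, adExpQ_p, adExpQ_d, negT_x, negT_y, negT_q, negT_p, negT_t,
      negT_d, map_mul, map_sub, map_add, map_neg, map_inv₀, map_one, AlgEquiv.commutes] <;> abel
theorem negT_mul_negT : negT * negT = 1 := by
  apply equiv_ext <;> apply fin_three <;> rw [AlgEquiv.mul_apply, AlgEquiv.one_apply] <;>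
    simp only [negT_x, negT_y, negT_q, negT_p, negT_t, negT_d, map_neg, neg_neg]

/-- The factors of `Tσ` with superscript `x`. -/
def Xσ : K ≃ₐ[Par] K := Rs2 0 (-α 2 - κ) * Rs1 0 (α 1) * Rs3 0 (α 3)

/-- The automorphism on the right hand side of the identity for `Tσ`. -/
def Ψσ : K ≃ₐ[Par] K :=
  Rs2 1 (-α 2 - κ) * Rs1 1 (-αbar 1) * Rs3 1 (-αbar 3) * negT * adExpQ

theorem Xσ_commute {g : K ≃ₐ[Par] K} (hg : OnlyQ g) : Commute Xσ g :=
  (((onlyX_Rs2 _).commute hg).mul_left ((onlyX_Rs1 _).commute hg)).mul_left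
    ((onlyX_Rs3 _).commute hg)

theorem Xσ_commute_negT : Commute negT Xσ :=
  ((commute_negT_Rs2 _).mul_right (commute_negT_Rs1 _)).mul_right (commute_negT_Rs3 _)

theorem q_factors_mul : Rs2 1 (-α 2 - κ) * Rs1 1 (-αbar 1) * Rs3 1 (-αbar 3) *
    (Rs1 1 (αbar 1) * Rs3 1 (αbar 3) * Rs2 1 (α 2 + κ)) = 1 := by
  rw [(commute_Rs1_Rs3 1 (αbar 1) (αbar 3)).eq]
  simp only [mul_assoc]
  rw [← mul_assoc (Rs3 1 (-αbar 3)), Rs3_neg_mul, one_mul, ← mul_assoc (Rs1 1 (-αbar 1)),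
    Rs1_neg_mul, one_mul, sub_eq_add_neg, ← neg_add, Rs2_neg_mul]

/-- Applying `Ψσ` after `Tσ` cancels every factor in `q` as well as `t ↦ -t`. A claim on `Tσ`
thereby becomes one with only `x` factors on one side and `Ψσ` on the other. -/
theorem Ψσ_mul_Tσ : Ψσ * Tσ = Xσ * adExpX := by
  have hE := Xσ_commute onlyQ_adExpQ
  have hF := onlyX_adExpX.commute onlyQ_adExpQ
  have hA : Commute Xσ (Rs2 1 (-α 2 - κ) * Rs1 1 (-αbar 1) * Rs3 1 (-αbar 3)) :=
    ((Xσ_commute (onlyQ_Rs2 _)).mul_right (Xσ_commute (onlyQ_Rs1 _))).mul_right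
      (Xσ_commute (onlyQ_Rs3 _))
  have hA' : Commute adExpX (Rs2 1 (-α 2 - κ) * Rs1 1 (-αbar 1) * Rs3 1 (-αbar 3)) :=
    ((onlyX_adExpX.commute (onlyQ_Rs2 _)).mul_right
      (onlyX_adExpX.commute (onlyQ_Rs1 _))).mul_right (onlyX_adExpX.commute (onlyQ_Rs3 _))
  have h1 := q_factors_mul
  have hT : Tσ = Xσ * (negT * adExpX * adExpQ) *
      (Rs1 1 (αbar 1) * Rs3 1 (αbar 3) * Rs2 1 (α 2 + κ)) := by
    simp only [Tσ, Xσ, Rσ, mul_assoc]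
  rw [hT, Ψσ]
  generalize Rs2 1 (-α 2 - κ) * Rs1 1 (-αbar 1) * Rs3 1 (-αbar 3) = a at hA hA' h1 ⊢
  generalize Rs1 1 (αbar 1) * Rs3 1 (αbar 3) * Rs2 1 (α 2 + κ) = a' at h1 ⊢
  have hN := Xσ_commute_negT
  have e1 := adExpQ_negT
  have e2 := negT_mul_negT
  generalize Xσ = X at *
  generalize negT = N at *
  generalize adExpX = F at *
  generalize adExpQ = E at *
  -- The `x` factors are moved to the left; then `E N E = N` and `N N = 1` remove the middle, and
  -- the factors in `q` meet their inverses.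
  calc a * N * E * (X * (N * F * E) * a') = a * N * (E * X) * N * F * E * a' := by
        simp only [mul_assoc]
    _ = a * (N * X) * E * N * (F * E) * a' := by rw [← hE.eq]; simp only [mul_assoc]
    _ = a * X * N * (E * N * E) * F * a' := by rw [hN.eq, hF.eq]; simp only [mul_assoc]
    _ = a * X * (N * N) * F * a' := by rw [e1]; simp only [mul_assoc]
    _ = X * (F * a) * a' := by rw [e2, ← hA.eq, hA'.eq]; simp only [mul_assoc, mul_one, one_mul]
    _ = X * F := by rw [mul_assoc, mul_assoc, h1, mul_one]

/-! ### Separation of the `x` and `q` factors for the translation -/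

/-- The inverse of `Tπq`. -/
def Θπ : K ≃ₐ[Par] K :=
  Rqπ * Rs3 1 ((s 1 * s 2) (α 3)) * Rs2 1 (s 1 (α 2)) * Rs1 1 (α 1 - κ)

/-- The factors of `Tπ` with superscript `x`. -/
def Xπ : K ≃ₐ[Par] K :=
  Rxπ * Rs3 0 ((s 1 * s 2) (α 3)) * Rs2 0 (s 1 (α 2)) * Rs1 0 (α 1)

theorem Tπq_mul_Θπ : Tπq * Θπ = 1 := by
  rw [Tπq, Θπ, show -α 1 + κ = -(α 1 - κ) by ring]
  generalize (s 1 * s 2) (α 3) = b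
  generalize s 1 (α 2) = c
  generalize α 1 - κ = a
  calc _ = Rs1 1 (-a) * (Rs2 1 (-c) * (Rs3 1 (-b) * (Rqπ⁻¹ * Rqπ) * Rs3 1 b) * Rs2 1 c) *
        Rs1 1 a := by simp only [mul_assoc]
    _ = 1 := by rw [inv_mul_cancel, mul_one, Rs3_neg_mul, mul_one, Rs2_neg_mul, mul_one, Rs1_neg_mul]

/-- The factors in `x` commute with those in `q`, so `Θπ` can be moved next to `Tπq`, whose inverse
it is. -/
theorem Θπ_mul_Tπ : Θπ * Tπ = Xπ := by
  have hT : Tπ = Xπ * Tπq := rfl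
  have hx : ∀ {g : K ≃ₐ[Par] K}, OnlyQ g → Commute Xπ g := fun hg =>
    (((onlyX_Rxπ.commute hg).mul_left ((onlyX_Rs3 _).commute hg)).mul_left
      ((onlyX_Rs2 _).commute hg)).mul_left ((onlyX_Rs1 _).commute hg)
  have h : Commute Xπ Θπ :=
    (((hx onlyQ_Rqπ).mul_right (hx (onlyQ_Rs3 _))).mul_right (hx (onlyQ_Rs2 _))).mul_right
      (hx (onlyQ_Rs1 _))
  rw [hT, ← mul_assoc, ← h.eq, mul_assoc, mul_eq_one_comm.1 Tπq_mul_Θπ, mul_one]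

theorem s_one_s_two_α_three : (s 1 * s 2) (α 3) = α 3 + (α 2 + α 1) := by
  rw [AlgEquiv.mul_apply, s_two_α_three, map_add, s_one_α_three, s_one_α_two]

theorem Xπ_apply (z : K) : Xπ z = Rxπ (Rs3 0 (α 3 + (α 2 + α 1)) (Rs2 0 (α 2 + α 1)
    (Rs1 0 (α 1) z))) := by
  rw [Xπ, mul_mul_apply, s_one_s_two_α_three, s_one_α_two]

theorem Θπ_apply (z : K) : Θπ z = Rqπ (Rs3 1 (α 3 + (α 2 + α 1)) (Rs2 1 (α 2 + α 1)
    (Rs1 1 (α 1 - κ) z))) := by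
  rw [Θπ, mul_mul_apply, s_one_s_two_α_three, s_one_α_two]

theorem Xπ_Ham_zero : Xπ (Ham 0 1 (α 1) (α 2) (α 3)) =
    Ham 0 1 (α 1 - κ) (α 2) (α 3) - sc κ * (x - 1) * y := by rw [Xπ_apply, x_chain]
theorem Θπ_Ham_one : Θπ (Ham 1 1 (α 1 - κ) (α 2 + κ) (α 3)) =
    Ham 1 1 (α 1) (α 2 + κ) (α 3) + sc κ * (q - 1) * p := by rw [Θπ_apply, q_chain]
theorem Xπ_Ham_one (u a₁ a₂ a₃ : Par) : Xπ (Ham 1 u a₁ a₂ a₃) = Ham 1 u a₁ a₂ a₃ := by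
  rw [Xπ_apply, Rs1_fix (by decide), Rs2_fix (by decide) (by decide), Rs3_fix (by decide)]
  exact fix_Ham Rxπ Rxπ_q Rxπ_p Rxπ_t _ _ _ _
theorem Θπ_Ham_zero (u a₁ a₂ a₃ : Par) : Θπ (Ham 0 u a₁ a₂ a₃) = Ham 0 u a₁ a₂ a₃ := by
  rw [Θπ_apply, Rs1_fix (by decide), Rs2_fix (by decide) (by decide), Rs3_fix (by decide)]
  exact fix_Ham Rqπ Rqπ_x Rqπ_y Rqπ_t _ _ _ _
theorem Xπ_t : Xπ t = t := by
  simp only [Xπ_apply, Rs1_pos, Rs2_pos, Rs3_pos, Rxπ_t, Fin.reduceEq, ↓reduceIte, Fin.isValue]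
theorem Θπ_t : Θπ t = t := by
  simp only [Θπ_apply, Rs1_pos, Rs2_pos, Rs3_pos, Rqπ_t, Fin.reduceEq, ↓reduceIte, Fin.isValue]
theorem Xπ_d : Xπ d = d - sc (1 / ε₁) * t⁻¹ * (x - 1) * y := by
  simp only [Xπ_apply, Rs1_mom, Rs2_mom, Rs3_mom, Rxπ_d, Fin.reduceEq, ↓reduceIte, Fin.isValue]
theorem Θπ_d : Θπ d = d - sc (1 / ε₂) * t⁻¹ * (q - 1) * p := by
  simp only [Θπ_apply, Rs1_mom, Rs2_mom, Rs3_mom, Rqπ_d, Fin.reduceEq, ↓reduceIte, Fin.isValue]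

/-- By the relation between the parameters the word acts as a translation: the second parameter is
shifted by `-κ` and the first by `κ`. -/
theorem α_π_word : α 0 + 2 * α 1 + α 2 + α 3 = α 1 - κ := by rw [α_zero, κ]; ring

theorem B_π_word : B (act (s 1 * s 2 * s 3 * π⁻¹)) = sc ε₂ * Ham 0 1 (α 1 - κ) (α 2) (α 3) -
    sc ε₁ * Ham 1 1 (α 1 - κ) (α 2 + κ) (α 3) - sc (κ * ε₁ * ε₂) * t * d := by
  rw [B_eq_Ham, act_π_word, α_π_word]; rfl

theorem Tπ_B : Tπ (B α) = B (act (s 1 * s 2 * s 3 * π⁻¹)) := by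
  apply Θπ.injective
  rw [← AlgEquiv.mul_apply, Θπ_mul_Tπ, B_π_word, B_eq_Ham]
  simp only [map_mul, map_sub, map_add, map_neg, map_inv₀, map_one,
    AlgEquiv.commutes, Xπ_Ham_zero, Xπ_Ham_one, Θπ_Ham_zero, Θπ_Ham_one, Xπ_t, Θπ_t, Xπ_d, Θπ_d]
  simp only [Ham_zero, Ham_one, κ]
  simp only [inv_rules]
  simp only [atom_rules]
  try simp only [order_rules]
  try simp only [der_rules, param_rules, smul_eq_mul, mul_zero, add_zero, zero_add, sub_zero, neg_zero,
    zero_smul]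
  obtain ⟨⟨hx, hx1, hq, hq1, ht⟩, hxq, he, he'⟩ := denom_ne_zero
  match_scalars <;> (field_simp <;> ring)

/-! ### The operator identity for `Tσ` -/

/-- To be used with `W = X - b Y⁻¹`, of which only `Y W` and `W Y` are free of inverses. After
multiplication by `Y` on the left every `W` can be paired with a `Y`, on its left or on its right.
The terms with `a`, `b`, `T` come from gauge transformations applied earlier. -/
theorem mom_mul_sub_mul {Y X W c k a b r S G T v : K} (h₁ : Y * W = Y * X + c) (h₂ : W * Y = X * Y + c)
    (hk : Y * k = k * Y) (ha : Y * a = a * Y) (hb : Y * b = b * Y) (hT : Y * T = T * Y) :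
    Y * ((W - v) * G - k * (W * (W - 1) * Y + a * (W - 1) + b * W - T * W * r - S)) =
      (Y * X + c - Y * v) * G - k * ((Y * X + c) * (X * Y + c - Y) + a * (Y * X + c - Y) +
        b * (Y * X + c) - T * (Y * X + c) * r - Y * S) := by
  have e : W * (W - 1) * Y = W * (X * Y + c - Y) := by rw [mul_assoc, sub_mul, one_mul, h₂]
  rw [mul_sub, ← mul_assoc, mul_sub Y W, h₁, ← mul_assoc Y k, hk, mul_assoc k Y, e, mul_sub Y,
    mul_sub Y, mul_add Y, mul_add Y, ← mul_assoc Y W, h₁, ← mul_assoc Y a, ha, mul_assoc a Y,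
    mul_sub Y, h₁, mul_one, ← mul_assoc Y b, hb, mul_assoc b Y, h₁, ← mul_assoc Y (T * W),
    ← mul_assoc Y T, hT, mul_assoc T Y, h₁]

/-- The shift `y ↦ y - t` produces a multiple of `t x (x - 1)`. With `x - 1 = (x - q) + (q - 1)` the
first part moves the second parameter of the Hamiltonian from `-α 2` to `-α 2 - κ`, which is the
parameter of the reflection `s₂` that follows. -/
theorem x_side_aux : Rs1 0 (α 1) (Rs3 0 (α 3) (adExpX ((x - q) * L α))) =
    (x - q) * (Ham 0 (-1) (-α 1) (-α 2 - κ) (-α 3) + sc ε₁ * (t + sc (α 1 + α 3)) -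
      Ham 1 1 (α 1) (α 2 + κ) (α 3)) - sc κ * (x * (x - 1) * y + sc (α 1) * (x - 1) +
        sc (α 3) * x - t * x * (q - 1) - q * (q - 1) * p) := by
  simp only [x_sub_q_mul_L, H_eq_Ham, shiftPar_one, shiftPar_two, shiftPar_three, map_mul, map_sub, map_add, map_neg, map_inv₀, map_one,
    AlgEquiv.commutes, adExpX_Ham,
    adExpX_fix, Rs1_fix, Rs3_fix, Rs1_Ham_zero, Rs3_Ham_zero, ne_facts, ne_eq,
    not_false_eq_true, Rs1_pos, Rs3_pos, Rs1_mom, Rs3_mom, adExpX_pos, adExpX_y, adExpX_p,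
    Fin.reduceEq, ↓reduceIte, Fin.isValue]
  simp only [Ham_zero, Ham_one, κ]
  simp only [inv_rules]
  simp only [atom_rules]
  try simp only [order_rules]
  try simp only [der_rules, param_rules, smul_eq_mul, mul_zero, add_zero, zero_add, sub_zero, neg_zero,
    zero_smul]
  obtain ⟨⟨hx, hx1, hq, hq1, ht⟩, hxq, he, he'⟩ := denom_ne_zero
  match_scalars <;> (field_simp <;> ring)

theorem αbar_three_eq : -α 0 - α 1 - α 3 = α 2 + κ := by rw [α_zero, κ]; ring

/-- The outer sign puts the expression into the shape of `x_side_aux` with `x` and `q` interchanged,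
so that `mom_mul_sub_mul` applies with `p` as the momentum. -/
theorem q_side_aux : Rs1 1 (-αbar 1) (Rs3 1 (-αbar 3) (negT (adExpQ
    ((x - q) * L (act (σ * s 1 * s 3 * s 2)))))) =
    -((q - x) * (Ham 0 (-1) (-αbar 1) (α 2 + κ) (-αbar 3) + sc ε₂ * (t + sc (αbar 1 + αbar 3)) -
      Ham 1 1 (αbar 1) (-α 2 - κ) (αbar 3)) - sc κ * (q * (q - 1) * p + sc (-αbar 1) * (q - 1) +
        sc (-αbar 3) * q - -t * q * (x - 1) - x * (x - 1) * y)) := by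
  rw [x_sub_q_mul_L, H_eq_Ham, H_eq_Ham, shiftPar_one, shiftPar_two, shiftPar_three, act_σ_word]
  simp only [Matrix.cons_val]
  rw [αbar_three_eq, show α 0 + α 3 = -αbar 1 by rw [α_zero, αbar, κ]; ring,
    show α 0 + α 1 = -αbar 3 by rw [α_zero, αbar, κ]; ring]
  simp only [map_mul, map_sub, map_add, map_neg, map_inv₀, map_one,
    AlgEquiv.commutes, adExpQ_Ham,
    adExpQ_fix, negT_Ham_zero, negT_Ham_one, neg_neg, Rs1_fix, Rs3_fix, Rs1_Ham_one, Rs3_Ham_one,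
    ne_facts, ne_eq, not_false_eq_true, Rs1_pos, Rs3_pos, Rs1_mom, Rs3_mom, adExpQ_pos, adExpQ_y,
    adExpQ_p, negT_x, negT_y, negT_q, negT_p, negT_t, Fin.reduceEq, ↓reduceIte, Fin.isValue]
  simp only [Ham_zero, Ham_one, κ, αbar]
  simp only [inv_rules]
  simp only [atom_rules]
  try simp only [order_rules]
  try simp only [der_rules, param_rules, smul_eq_mul, mul_zero, add_zero, zero_add, sub_zero, neg_zero,
    zero_smul]
  obtain ⟨⟨hx, hx1, hq, hq1, ht⟩, hxq, he, he'⟩ := denom_ne_zero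
  match_scalars <;> (field_simp <;> ring)

theorem x_side : y * Rs2 0 (-α 2 - κ) (Rs1 0 (α 1) (Rs3 0 (α 3) (adExpX ((x - q) * L α)))) =
    (y * x + sc (α 2 + κ) - y * q) * (Ham 0 (-1) (-αbar 1) (α 2 + κ) (-αbar 3) -
      sc (α 2 + κ) * (-t - sc (αbar 1 + α 3 + ε₁)) + sc ε₁ * (t + sc (α 1 + α 3)) -
      Ham 1 1 (α 1) (α 2 + κ) (α 3)) - sc κ * ((y * x + sc (α 2 + κ)) *
        (x * y + sc (α 2 + κ) - y) + sc (α 1) * (y * x + sc (α 2 + κ) - y) +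
        sc (α 3) * (y * x + sc (α 2 + κ)) - t * (y * x + sc (α 2 + κ)) * (q - 1) -
        y * (q * (q - 1) * p)) := by
  have h₁ : y * (x - sc (-α 2 - κ) * y⁻¹) = y * x + sc (α 2 + κ) := by
    rw [mul_sub_inv (mom_ne_zero 0) (Algebra.commutes _), sub_eq_add_neg, ← map_neg]
    congr 2; ring
  have h₂ : (x - sc (-α 2 - κ) * y⁻¹) * y = x * y + sc (α 2 + κ) := by
    rw [sub_inv_mul (mom_ne_zero 0), sub_eq_add_neg, ← map_neg]
    congr 2; ring
  rw [← mom_mul_sub_mul h₁ h₂ (Algebra.commutes _ _).symm (Algebra.commutes _ _).symm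
    (Algebra.commutes _ _).symm (Skew.cross_ne (by decide)).eq, x_side_aux]
  congr 1
  simp only [map_mul, map_sub (Rs2 _ _), map_add (Rs2 _ _), map_one, AlgEquiv.commutes,
    Rs2_Ham_zero, Rs2_fix, ne_facts, ne_eq, not_false_eq_true, Rs2_pos, Rs2_mom, Fin.reduceEq,
    ↓reduceIte, Fin.isValue]
  rw [show -α 1 + (-α 2 - κ) = -αbar 1 by rw [αbar]; ring,
    show -α 3 + (-α 2 - κ) = -αbar 3 by rw [αbar]; ring, show -(-α 2 - κ) = α 2 + κ by ring]
  congr 4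
  simp only [αbar]
  simp only [atom_rules]
  try simp only [order_rules]
  try simp only [der_rules, param_rules, smul_eq_mul, mul_zero, add_zero, zero_add, sub_zero, neg_zero,
    zero_smul]
  obtain ⟨⟨hx, hx1, hq, hq1, ht⟩, hxq, he, he'⟩ := denom_ne_zero
  match_scalars <;> (field_simp <;> ring)

theorem q_side : p * Rs2 1 (-α 2 - κ) (Rs1 1 (-αbar 1) (Rs3 1 (-αbar 3) (negT (adExpQ
    ((x - q) * L (act (σ * s 1 * s 3 * s 2))))))) =
    -((p * q + sc (α 2 + κ) - p * x) * (Ham 0 (-1) (-αbar 1) (α 2 + κ) (-αbar 3) +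
      sc ε₂ * (t + sc (αbar 1 + αbar 3)) - (Ham 1 1 (α 1) (α 2 + κ) (α 3) -
        sc (α 2 + κ) * (t + sc (αbar 1 + α 3 - ε₂)))) - sc κ * ((p * q + sc (α 2 + κ)) *
        (q * p + sc (α 2 + κ) - p) + sc (-αbar 1) * (p * q + sc (α 2 + κ) - p) +
        sc (-αbar 3) * (p * q + sc (α 2 + κ)) - -t * (p * q + sc (α 2 + κ)) * (x - 1) -
        p * (x * (x - 1) * y))) := by
  have h₁ : p * (q - sc (-α 2 - κ) * p⁻¹) = p * q + sc (α 2 + κ) := by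
    rw [mul_sub_inv (mom_ne_zero 1) (Algebra.commutes _), sub_eq_add_neg, ← map_neg]
    congr 2; ring
  have h₂ : (q - sc (-α 2 - κ) * p⁻¹) * p = q * p + sc (α 2 + κ) := by
    rw [sub_inv_mul (mom_ne_zero 1), sub_eq_add_neg, ← map_neg]
    congr 2; ring
  have hT : p * -t = -t * p := by
    rw [mul_neg, neg_mul, neg_inj]; exact (Skew.cross_ne (by decide)).eq
  rw [← mom_mul_sub_mul h₁ h₂ (Algebra.commutes _ _).symm (Algebra.commutes _ _).symm
    (Algebra.commutes _ _).symm hT, q_side_aux, ← mul_neg]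
  congr 1
  simp only [map_mul, map_sub (Rs2 _ _), map_add (Rs2 _ _), map_neg (Rs2 _ _), map_one,
    AlgEquiv.commutes, Rs2_Ham_one, Rs2_fix, ne_facts, ne_eq, not_false_eq_true, Rs2_pos, Rs2_mom,
    Fin.reduceEq, ↓reduceIte, Fin.isValue]
  rw [show αbar 1 + (-α 2 - κ) = α 1 by rw [αbar]; ring,
    show αbar 3 + (-α 2 - κ) = α 3 by rw [αbar]; ring, show -(-α 2 - κ) = α 2 + κ by ring]
  congr 4
  simp only [αbar]
  simp only [atom_rules]
  try simp only [order_rules]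
  try simp only [der_rules, param_rules, smul_eq_mul, mul_zero, add_zero, zero_add, sub_zero, neg_zero,
    zero_smul]
  obtain ⟨⟨hx, hx1, hq, hq1, ht⟩, hxq, he, he'⟩ := denom_ne_zero
  match_scalars <;> (field_simp <;> ring)

set_option maxHeartbeats 4000000 in
-- The factors `y` and `p` have removed all inverse momenta, so both sides are polynomial in the
-- momenta and their normal forms can be compared.
theorem σ_identity : ((x - q) * p - sc (α 2 + κ)) * y *
      Rs2 0 (-α 2 - κ) (Rs1 0 (α 1) (Rs3 0 (α 3) (adExpX ((x - q) * L α)))) =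
    ((x - q) * y + sc (α 2 + κ)) * p * Rs2 1 (-α 2 - κ) (Rs1 1 (-αbar 1) (Rs3 1 (-αbar 3)
      (negT (adExpQ ((x - q) * L (act (σ * s 1 * s 3 * s 2))))))) := by
  rw [mul_assoc, x_side, mul_assoc ((x - q) * y + _), q_side]
  simp only [Ham_zero, Ham_one, αbar, κ]
  simp only [atom_rules]
  try simp only [order_rules]
  try simp only [der_rules, param_rules, smul_eq_mul, mul_zero, add_zero, zero_add, sub_zero, neg_zero,
    zero_smul]
  obtain ⟨⟨hx, hx1, hq, hq1, ht⟩, hxq, he, he'⟩ := denom_ne_zero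
  match_scalars <;> (field_simp <;> ring)

/-! ### The left multiplier for `σ s₁ s₃ s₂` -/

theorem Ψσ_apply (z : K) : Ψσ z = Rs2 1 (-α 2 - κ) (Rs1 1 (-αbar 1) (Rs3 1 (-αbar 3)
    (negT (adExpQ z)))) := by
  rw [Ψσ, AlgEquiv.mul_apply, mul_mul_apply]

theorem Ψσ_Tσ (z : K) : Ψσ (Tσ z) = Rs2 0 (-α 2 - κ) (Rs1 0 (α 1) (Rs3 0 (α 3) (adExpX z))) := by
  rw [← AlgEquiv.mul_apply, Ψσ_mul_Tσ, Xσ, mul_mul_apply]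

theorem Ψσ_shifted_mom :
    Ψσ (p + t + sc (αbar 1) * q⁻¹ + sc (αbar 3) * (q - 1)⁻¹) = p := by
  have h : Rs1 1 (-αbar 1) (Rs3 1 (-αbar 3) (negT (adExpQ
      (p + t + sc (αbar 1) * q⁻¹ + sc (αbar 3) * (q - 1)⁻¹)))) = p := by
    simp only [map_mul, map_sub, map_add, map_neg, map_inv₀, map_one,
    AlgEquiv.commutes, Rs1_pos, Rs3_pos, Rs1_mom, Rs3_mom, adExpQ_pos, adExpQ_p, negT_q, negT_p,
      negT_t, Fin.reduceEq, ↓reduceIte, Fin.isValue, neg_mul]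
    abel
  rw [Ψσ_apply, h, Rs2_mom]

theorem Ψσ_x : Ψσ x = x := by
  simp only [Ψσ_apply, adExpQ_pos, negT_x, Rs1_pos, Rs3_pos, Rs2_pos, Fin.reduceEq, ↓reduceIte,
    Fin.isValue]
theorem Ψσ_y : Ψσ y = y := by
  simp only [Ψσ_apply, adExpQ_y, negT_y, Rs1_mom, Rs3_mom, Rs2_mom, Fin.reduceEq, ↓reduceIte,
    Fin.isValue]
theorem Ψσ_q : Ψσ q = q - sc (-α 2 - κ) * p⁻¹ := by
  simp only [Ψσ_apply, adExpQ_pos, negT_q, Rs1_pos, Rs3_pos, Rs2_pos, Fin.reduceEq, ↓reduceIte,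
    Fin.isValue]

theorem smul_one_ne_zero {r : RatFun} (h : r ≠ 0) : r • (1 : K) ≠ 0 := by
  rw [ratFun_smul_def, mul_one]
  exact (map_ne_zero toK).2 h

theorem ne_zero_of_commutator {u : K} (v : K) {r : RatFun} (h : u * v - v * u = r • (1 : K))
    (hr : r ≠ 0) : u ≠ 0 := by
  rintro rfl
  rw [zero_mul, mul_zero, sub_zero] at h
  exact smul_one_ne_zero hr h.symm

theorem first_order_ne_zero (c : Par) : (x - q) * y + sc c ≠ 0 := by
  refine ne_zero_of_commutator x (r := (xR - qR) * cR ε₁) ?_ (mul_ne_zero x_sub_q_ne cR_ε₁_ne)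
  simp only [atom_rules]
  try simp only [order_rules]
  try simp only [der_rules, param_rules, smul_eq_mul, mul_zero, add_zero, zero_add, sub_zero, neg_zero,
    zero_smul]
  obtain ⟨⟨hx, hx1, hq, hq1, ht⟩, hxq, he, he'⟩ := denom_ne_zero
  match_scalars <;> (field_simp <;> ring)

/-- Under `Ψσ` the operator `P` becomes `p`, and `q` becomes an element `W` with `W p = q p + α₂ +
κ`. The denominator then factors as `((x - q) y + α₂ + κ) p`, the left factor in `σ_identity`. -/
theorem Ψσ_lσ : Ψσ lσ = (((x - q) * y + sc (α 2 + κ)) * p)⁻¹ * (((x - q) * p - sc (α 2 + κ)) * y) := by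
  have hW : (q - sc (-α 2 - κ) * p⁻¹) * p = q * p + sc (α 2 + κ) := by
    rw [sub_inv_mul (mom_ne_zero 1), sub_eq_add_neg, ← map_neg]
    congr 2; ring
  have h : lσ = ((x - q) * y * (p + t + sc (αbar 1) * q⁻¹ + sc (αbar 3) * (q - 1)⁻¹) + sc (α 2 + κ) *
      (y + (p + t + sc (αbar 1) * q⁻¹ + sc (αbar 3) * (q - 1)⁻¹)))⁻¹ * ((x - q) *
        (p + t + sc (αbar 1) * q⁻¹ + sc (αbar 3) * (q - 1)⁻¹) * y) := rfl
  have e := Ψσ_shifted_mom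
  rw [h]
  generalize p + t + sc (αbar 1) * q⁻¹ + sc (αbar 3) * (q - 1)⁻¹ = P at e
  simp only [map_mul, map_inv₀, map_sub Ψσ, map_add Ψσ, AlgEquiv.commutes, Ψσ_x, Ψσ_y, Ψσ_q, e]
  generalize q - sc (-α 2 - κ) * p⁻¹ = W at hW ⊢
  have h1 : (x - W) * p = (x - q) * p - sc (α 2 + κ) := by rw [sub_mul, hW, sub_mul]; abel
  congr 2
  rw [mul_assoc, ← p_y, ← mul_assoc, h1, sub_mul, mul_assoc, p_y, add_mul, mul_add,
    ← mul_assoc (x - q)]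
  abel

theorem Tσ_L : lσ * Tσ ((x - q) * L α) = (x - q) * L (act (σ * s 1 * s 3 * s 2)) := by
  apply Ψσ.injective
  have h := σ_identity
  have h0 : ((x - q) * y + sc (α 2 + κ)) * p ≠ 0 :=
    mul_ne_zero (first_order_ne_zero _) (mom_ne_zero 1)
  rw [map_mul, Ψσ_lσ, Ψσ_Tσ, mul_assoc, h, ← mul_assoc, inv_mul_cancel₀ h0, one_mul, Ψσ_apply]

/-! ### The automorphism `S` -/

theorem RS_apply (z : K) : RS z = Rs2 0 (α 2) (Rs2 1 (α 2 + κ) z) := by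
  rw [RS, AlgEquiv.mul_apply]

theorem RS_Ham_zero : RS (Ham 0 1 (α 1) (α 2) (α 3)) = Ham 0 1 (α 1 + α 2) (-α 2) (α 3 + α 2) +
    sc (α 2) * (sc 1 * t + sc (α 1 + α 2 + α 3 - ε₁)) := by
  rw [RS_apply, Rs2_fix (by decide) (by decide), Rs2_Ham_zero]
theorem RS_Ham_one : RS (Ham 1 1 (α 1) (α 2 + κ) (α 3)) =
    Ham 1 1 (α 1 + (α 2 + κ)) (-(α 2 + κ)) (α 3 + (α 2 + κ)) +
    sc (α 2 + κ) * (sc 1 * t + sc (α 1 + (α 2 + κ) + α 3 - ε₂)) := by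
  rw [RS_apply, Rs2_Ham_one]
  simp only [map_mul, map_sub, map_add, map_neg, map_inv₀, map_one,
    AlgEquiv.commutes, Rs2_fix, ne_facts, ne_eq, not_false_eq_true, Rs2_pos, Fin.reduceEq, ↓reduceIte, Fin.isValue]
theorem RS_x : RS x = x - sc (α 2) * y⁻¹ := by
  simp only [RS_apply, Rs2_pos, Fin.reduceEq, ↓reduceIte, Fin.isValue]
theorem RS_q : RS q = q - sc (α 2 + κ) * p⁻¹ := by
  simp only [RS_apply, Rs2_pos, Rs2_mom, map_mul, map_sub, map_add, map_neg, map_inv₀, map_one,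
    AlgEquiv.commutes, Fin.reduceEq, ↓reduceIte, Fin.isValue]
theorem RS_t : RS t = t := by
  simp only [RS_apply, Rs2_pos, Fin.reduceEq, ↓reduceIte, Fin.isValue]
theorem RS_mom (i : Fin 3) : RS (Skew.mom epsV i) = Skew.mom epsV i := by
  rw [RS_apply, Rs2_mom, Rs2_mom]

/-- Here both positions carry an inverse momentum. Since `y` and `p` commute, the factor `y p`
clears both at once. -/
theorem mom_mul_mom_mul {X W N N' V V' h k : K} (h₁ : y * X = N) (h₂ : X * y = N')
    (h₃ : p * W = V) (h₄ : W * p = V') (hX : p * X = X * p) (hk : ∀ z, z * k = k * z) :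
    y * p * ((X - W) * h - k * (X * (X - 1) * y - W * (W - 1) * p)) =
      (N * p - y * V) * h - k * (N * (N' - y) * p - y * V * (V' - p)) := by
  have e1 : X * (X - 1) * y = X * (N' - y) := by rw [mul_assoc, sub_mul, one_mul, h₂]
  have e2 : W * (W - 1) * p = W * (V' - p) := by rw [mul_assoc, sub_mul, one_mul, h₄]
  have e3 : y * p * X = N * p := by rw [mul_assoc, hX, ← mul_assoc, h₁]
  have e4 : y * p * W = y * V := by rw [mul_assoc, h₃]
  have e5 : p * (N' - y) = (N' - y) * p := by
    rw [← h₂, mul_sub, sub_mul, ← mul_assoc, hX, mul_assoc, mul_assoc, p_y]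
  rw [e1, e2, mul_sub (y * p), ← mul_assoc, mul_sub (y * p) X, e3, e4, ← mul_assoc _ k, hk,
    mul_assoc k, mul_sub (y * p), ← mul_assoc _ X, e3, ← mul_assoc _ W, e4, mul_assoc N p, e5,
    mul_assoc N]

theorem mom_mom_RS : y * p * RS ((x - q) * L α) =
    ((y * x - sc (α 2)) * p - y * (p * q - sc (α 2 + κ))) *
      (Ham 0 1 (α 1 + α 2) (-α 2) (α 3 + α 2) +
        sc (α 2) * (sc 1 * t + sc (α 1 + α 2 + α 3 - ε₁)) -
        (Ham 1 1 (α 1 + (α 2 + κ)) (-(α 2 + κ)) (α 3 + (α 2 + κ)) +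
          sc (α 2 + κ) * (sc 1 * t + sc (α 1 + (α 2 + κ) + α 3 - ε₂)))) -
      sc κ * ((y * x - sc (α 2)) * (x * y - sc (α 2) - y) * p -
        y * (p * q - sc (α 2 + κ)) * (q * p - sc (α 2 + κ) - p)) := by
  have hX : p * (x - sc (α 2) * y⁻¹) = (x - sc (α 2) * y⁻¹) * p :=
    ((show Commute p x from Skew.cross_ne (by decide)).sub_right
      ((show Commute p (sc (α 2)) from (Algebra.commutes _ _).symm).mul_right
        (show Commute p y from p_y).inv_right₀)).eq
  rw [← mom_mul_mom_mul (mul_sub_inv (mom_ne_zero 0) (Algebra.commutes _))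
    (sub_inv_mul (mom_ne_zero 0)) (mul_sub_inv (mom_ne_zero 1) (Algebra.commutes _))
    (sub_inv_mul (mom_ne_zero 1)) hX (fun z => (Algebra.commutes κ z).symm), x_sub_q_mul_L,
    H_eq_Ham, H_eq_Ham, shiftPar_one, shiftPar_two, shiftPar_three]
  simp only [map_mul, map_sub RS, map_one, AlgEquiv.commutes, RS_Ham_zero, RS_Ham_one, RS_x, RS_q,
    RS_mom]

theorem αS_values : αS 1 = α 1 + α 2 + ε₁ ∧ αS 2 = -α 2 - 2 * ε₁ ∧ αS 3 = α 3 + α 2 + ε₁ :=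
  ⟨rfl, rfl, rfl⟩

/-- The difference `x - q` as a rational function. -/
def wR : RatFun := xR - qR

theorem wR_ne : wR ≠ 0 := x_sub_q_ne
theorem der_wR : der 0 wR = cR ε₁ ∧ der 1 wR = -cR ε₂ ∧ der 2 wR = 0 := by
  rw [wR, map_sub, map_sub, map_sub, der_x₀, der_q₀, der_x₁, der_q₁, der_x₂, der_q₂, sub_zero,
    zero_sub, sub_zero]
  exact ⟨rfl, rfl, rfl⟩
theorem xR_eq : xR = wR + qR := (sub_add_cancel _ _).symm
theorem wR_rules : (xR - qR = wR ∧ x - q = wR • (1 : K)) ∧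
    (der 0 wR = cR ε₁ ∧ der 1 wR = -cR ε₂ ∧ der 2 wR = 0) ∧
    (∀ i r, der i (r ^ 2) = 2 * r * der i r) ∧ (∀ i r, der i (r ^ 3) = 3 * r ^ 2 * der i r) ∧
    ∀ i r, der i (r ^ 4) = 4 * r ^ 3 * der i r :=
  ⟨⟨rfl, by rw [wR, x_eq, q_eq, sub_smul]⟩, der_wR,
    fun i r => by rw [(der i).leibniz_pow]; simp; ring,
    fun i r => by rw [(der i).leibniz_pow]; simp; ring,
    fun i r => by rw [(der i).leibniz_pow]; simp; ring⟩

/-- The first power of `x - q` would leave a term in `(x - q)⁻¹`, created by differentiation; the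
second power suffices. -/
theorem D_mul_sq (b : Par) : D b * ((wR ^ 2) • (1 : K)) =
    (wR ^ 2) • (y * p) + (cR (b + ε₁ - 2 * ε₂) * wR) • y + (cR (2 * ε₁ - (b + ε₁)) * wR) • p +
      cR (2 * (b + ε₁) * (ε₁ + ε₂) - 2 * ε₁ * ε₂) • (1 : K) := by
  have hw := wR_ne
  rw [D]
  simp only [inv_rules]
  simp only [wR_rules, sc_eq]
  simp only [order_rules]
  simp only [der_rules, wR_rules, param_rules, smul_eq_mul, mul_zero, add_zero, zero_add]
  match_scalars <;> (field_simp <;> ring)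

/-- The product of the left multiplier for `S` with `(x - q)⁻¹`, cleared of denominators. -/
def mulS (g : Par) : K :=
  (wR ^ 4) • (y * (y * (p * p))) + (cR (2 * g) * (wR ^ 3)) • (y * (y * p) - y * (p * p)) +
    (cR (g * (ε₁ + g)) * (wR ^ 2)) • (p * p) + (cR (g * (ε₂ + g)) * (wR ^ 2)) • (y * y) -
    (cR (4 * (ε₁ + ε₂) * g + 2 * (g * g)) * (wR ^ 2)) • (y * p) +
    (cR (4 * g * (ε₁ + ε₂) * (ε₁ + g)) * wR) • p - (cR (4 * g * (ε₁ + ε₂) * (ε₂ + g)) * wR) • y +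
    cR (6 * g * (ε₁ + ε₂) * (ε₁ * ε₂ + g * (ε₁ + ε₂))) • (1 : K)

theorem const_rules : (∀ i, der i 3 = 0) ∧ (∀ i, der i 4 = 0) ∧ (∀ i, der i 6 = 0) ∧ cR 4 = 4 ∧
    cR 6 = 6 :=
  ⟨fun i => Frame.derivation_ofNat (der i) 3, fun i => Frame.derivation_ofNat (der i) 4,
    fun i => Frame.derivation_ofNat (der i) 6, map_ofNat _ 4, map_ofNat _ 6⟩

/-- The factor `(x - q)⁻¹` is the denominator of `L`. Differentiating the inverse powers raises
their order, and the fourth power on the left clears all of them. -/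
theorem multiplier_mul_inv (g : Par) :
    (wR ^ 4) • (((x - q) * y * p + sc (g - 2 * ε₂) * y + sc (2 * ε₁ - g) * p) *
      (D (g - ε₁) - sc (g * (ε₁ + ε₂)) * ((x - q) ^ 2)⁻¹) * (wR⁻¹ • (1 : K))) = mulS g := by
  have hw := wR_ne
  rw [D, sub_add_cancel, mulS]
  simp only [inv_rules]
  simp only [wR_rules, sc_eq]
  simp only [order_rules]
  simp only [der_rules, wR_rules, param_rules, const_rules, smul_eq_mul, mul_zero, add_zero, zero_add]
  match_scalars <;> (field_simp <;> ring)

theorem x_eq_wR : x = (wR + qR) • (1 : K) := xR_eq ▸ x_eq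

theorem L_eq_inv_mul (a : Fin 4 → Par) : L a = wR⁻¹ • (1 : K) * ((x - q) * (Ham 0 1 (a 1) (a 2) (a 3) -
    Ham 1 1 (a 1) (a 2 + κ) (a 3)) - sc κ * (x * (x - 1) * y - q * (q - 1) * p)) := by
  have h : wR⁻¹ • (1 : K) * ((x - q) * L a) = L a := by
    rw [wR_rules.1.2, smul_mul_assoc, smul_mul_assoc, one_mul, one_mul, smul_smul,
      inv_mul_cancel₀ wR_ne, one_smul]
  rw [← h, x_sub_q_mul_L, H_eq_Ham, H_eq_Ham, shiftPar_one, shiftPar_two, shiftPar_three]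

theorem L_num_mul_sq (a b c : Par) :
    ((x - q) * (Ham 0 1 a b c - Ham 1 1 a (b + κ) c) -
      sc κ * (x * (x - 1) * y - q * (q - 1) * p)) * (wR ^ 2 • (1 : K)) =
    (wR ^ 3 * (xR * (xR - 1))) • (y * y) + (wR ^ 3 * (cR (2 * ε₁ - a - c) * xR + cR (a - ε₁) +
      xR * (xR - 1) * tR) + cR (4 * ε₁ - κ) * wR ^ 2 * (xR * (xR - 1))) • y -
    (wR ^ 3 * (qR * (qR - 1))) • (p * p) - (wR ^ 3 * (cR (2 * ε₂ - a - c) * qR + cR (a - ε₂) +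
      qR * (qR - 1) * tR) - cR (4 * ε₂ + κ) * wR ^ 2 * (qR * (qR - 1))) • p +
    (wR ^ 4 * (tR * cR (b + ε₁)) + 2 * cR (ε₁ * ε₁ - ε₁ * κ) * wR * (xR * (xR - 1)) -
      2 * cR (ε₂ * ε₂ + ε₂ * κ) * wR * (qR * (qR - 1)) +
      2 * cR ε₁ * wR ^ 2 * (cR (2 * ε₁ - a - c) * xR + cR (a - ε₁) + xR * (xR - 1) * tR) +
      2 * cR ε₂ * wR ^ 2 * (cR (2 * ε₂ - a - c) * qR + cR (a - ε₂) + qR * (qR - 1) * tR)) •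
      (1 : K) := by
  simp only [Ham_zero, Ham_one, κ]
  simp only [atom_rules]
  simp only [order_rules]
  simp only [der_rules, wR_rules, param_rules, const_rules, smul_eq_mul, mul_zero, add_zero, zero_add]
  simp only [xR_eq]
  match_scalars <;> ring

/-- Powers of `x - q` do not commute with the momenta, so denominators are cleared on the left and
on the right separately. -/
theorem smul_mul_cancel {r s : RatFun} {a b : K} (hr : r ≠ 0) (hs : s ≠ 0)
    (h : r • (a * s • (1 : K)) = r • (b * s • (1 : K))) : a = b := by
  have h1 : toK r ≠ 0 := (map_ne_zero toK).2 hr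
  exact mul_right_cancel₀ (smul_one_ne_zero hs) (mul_left_cancel₀ h1 h)

set_option maxRecDepth 4000 in
set_option maxHeartbeats 4000000 in
theorem S_L : y * p * RS ((x - q) * L α) * D (α 2) =
    ((x - q) * y * p + sc (α 2 + κ - ε₂) * y + sc (ε₁ - α 2) * p) *
      (D (α 2) - sc ((α 2 + ε₁) * (ε₁ + ε₂)) * ((x - q) ^ 2)⁻¹) * L αS := by
  have hw := wR_ne
  refine smul_mul_cancel (r := wR ^ 4) (s := wR ^ 2)
    (pow_ne_zero _ hw) (pow_ne_zero _ hw) ?_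
  have h := multiplier_mul_inv (α 2 + ε₁)
  rw [add_sub_cancel_right, show α 2 + ε₁ - 2 * ε₂ = α 2 + κ - ε₂ by rw [κ]; ring,
    show 2 * ε₁ - (α 2 + ε₁) = ε₁ - α 2 by ring] at h
  rw [mul_assoc _ (D (α 2)), D_mul_sq, L_eq_inv_mul αS, ← mul_assoc, ← smul_mul_assoc _ (_ * _) (_ • _),
    ← smul_mul_assoc _ (_ * wR⁻¹ • (1 : K)), h, mom_mom_RS, mulS, mul_assoc _ (_ - _) (wR ^ 2 • (1 : K)), L_num_mul_sq]
  -- With `g = α₂ + ε₁` as parameter, `D` and all transformed parameters become linear expressions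
  -- without the shifts by `ε₁`.
  obtain ⟨g, hg⟩ : ∃ g, α 2 = g - ε₁ := ⟨α 2 + ε₁, (add_sub_cancel_right _ _).symm⟩
  have hg' : g - ε₁ + κ = g - ε₂ := by rw [κ]; ring
  have h₁ : α 1 + (g - ε₁) + ε₁ = α 1 + g := by ring
  have h₃ : α 3 + (g - ε₁) + ε₁ = α 3 + g := by ring
  have h₂ : -(g - ε₁) - 2 * ε₁ + ε₁ = -g := by ring
  simp only [αS_values, Ham_zero, Ham_one, hg, hg', h₁, h₂, h₃, sub_add_cancel, neg_sub, κ]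
  simp only [x_eq, q_eq, t_eq, sc_eq]
  simp only [order_rules]
  simp only [der_rules, wR_rules, param_rules, const_rules, smul_eq_mul, mul_zero, add_zero, zero_add]
  simp only [xR_eq]
  -- No denominators are left. With `x` replaced by `w + q` the remaining atoms satisfy no relation
  -- that the comparison needs.
  generalize cR ε₁ = e₁, cR ε₂ = e₂, cR (α 1) = a₁, cR (α 3) = a₃, cR g = g, wR = w, qR = q, tR = t
  match_scalars <;> ring

set_option maxHeartbeats 4000000 in
theorem RS_B : RS (B α + sc (κ * (α 2 + ε₁)) * (sc (α 1 + α 2 + α 3 + ε₁) + t)) * D (α 2) =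
    D (α 2) * B αS - sc (2 * (α 2 + ε₁) * ε₁ * ε₂) * ((x - q) ^ 2)⁻¹ * L αS := by
  have hw := wR_ne
  refine smul_mul_cancel (r := wR ^ 3) (s := wR ^ 2)
    (pow_ne_zero _ hw) (pow_ne_zero _ hw) ?_
  -- One of the three left powers of `x - q` clears `D`; all three are needed for the term with `L`.
  have h₁ : wR • D (α 2) = wR • (y * p) + cR (α 2 + ε₁) • (y - p) := by
    rw [D]
    simp only [inv_rules]
    simp only [wR_rules, sc_eq]
    simp only [order_rules]
    match_scalars <;> field_simp
  have h₂ : (wR ^ 3) • (sc (2 * (α 2 + ε₁) * ε₁ * ε₂) * ((x - q) ^ 2)⁻¹ * (wR⁻¹ • (1 : K))) =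
      sc (2 * (α 2 + ε₁) * ε₁ * ε₂) := by
    simp only [inv_rules]
    simp only [wR_rules, sc_eq]
    simp only [order_rules]
    match_scalars
    field_simp
  rw [mul_assoc _ (D (α 2)), D_mul_sq, L_eq_inv_mul αS, ← mul_assoc _ _ ((x - q) * _ - _), sub_mul, smul_sub,
    ← smul_mul_assoc _ (_ * _ * _) (_ • _), ← smul_mul_assoc _ (_ * _) (_ * _ - _), h₂, show wR ^ 3 = wR ^ 2 * wR by ring, ← smul_smul _ wR (_ * _ * _),
    ← smul_mul_assoc wR, ← smul_mul_assoc wR, h₁]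
  rw [B_eq_Ham]
  simp only [map_mul, map_sub RS, map_add RS, AlgEquiv.commutes, RS_Ham_zero, RS_Ham_one, RS_t,
    RS_mom]
  simp only [B_eq_Ham, αS_values, Ham_zero, Ham_one, κ]
  simp only [x_eq_wR, q_eq, t_eq, sc_eq]
  simp only [order_rules]
  simp only [der_rules, wR_rules, param_rules, const_rules, smul_eq_mul, mul_zero, add_zero, zero_add]
  match_scalars <;> ring

theorem S_B : S (B α + sc (κ * (α 2 + ε₁)) * (sc (α 1 + α 2 + α 3 + ε₁) + t)) =
    B αS - (D (α 2))⁻¹ * sc (2 * (α 2 + ε₁) * ε₁ * ε₂) * ((x - q) ^ 2)⁻¹ * L αS := by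
  have h (z : K) : S z = (D (α 2))⁻¹ * (RS z * D (α 2)) := by
    have : S z = (D (α 2))⁻¹ * RS z * ((D (α 2))⁻¹)⁻¹ := rfl
    rw [this, inv_inv, mul_assoc]
  rw [h, RS_B, mul_sub, inv_mul_cancel_left₀ (D_ne_zero _)]
  simp only [mul_assoc]

/-! ### The operator identity for `Tπ` -/

/-- The counterpart of `mom_mul_sub_mul` for `s₃`: here `W` is a momentum with a pole at `X = 1`,
and the left factor `X - 1` replaces it by `Z`. -/
theorem pos_sub_one_mul {X W Z Q c k a G S : K} (hZ : (X - 1) * W = Z)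
    (hk : k * (X - 1) = (X - 1) * k) (ha : a * (X - 1) = (X - 1) * a)
    (hc : c * (X - 1) = (X - 1) * c) :
    (X - 1) * ((W * X + c - W * Q) * G - k * ((W * X + c) * (X * W + c - W) +
      a * (W * X + c - W) - W * S)) =
    (Z * (X - Q) + c * (X - 1)) * G - k * ((Z * X + c * (X - 1)) * (Z + c) +
      a * ((Z + c) * (X - 1)) - Z * S) := by
  have e : X * W + c - W = Z + c := by rw [← hZ, sub_mul, one_mul]; abel
  have e' : (X - 1) * (W * X + c - W * Q) = Z * (X - Q) + c * (X - 1) := by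
    rw [mul_sub, mul_add, ← mul_assoc, ← mul_assoc, hZ, hc, mul_sub Z]; abel
  have e₂ : (X - 1) * (W * X + c) = Z * X + c * (X - 1) := by
    rw [mul_add, ← mul_assoc, hZ, hc]
  have e₃ : (X - 1) * (W * X + c - W) = (Z + c) * (X - 1) := by
    rw [mul_sub, e₂, hZ, add_mul, mul_sub Z, mul_one]; abel
  rw [e, mul_sub, ← mul_assoc, e', ← mul_assoc _ k, ← hk, mul_assoc k, mul_sub (X - 1), mul_add (X - 1),
    ← mul_assoc _ (W * X + c), e₂, ← mul_assoc _ a, ← ha, mul_assoc a, e₃, ← mul_assoc _ W, hZ]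

theorem mom_mul_sub_mul' {Y X W c k a S G v : K} (h₁ : Y * W = Y * X + c) (h₂ : W * Y = X * Y + c)
    (hk : Y * k = k * Y) (ha : Y * a = a * Y) :
    Y * ((W - v) * G - k * (W * (W - 1) * Y + a * (W - 1) - S)) =
      (Y * X + c - Y * v) * G - k * ((Y * X + c) * (X * Y + c - Y) + a * (Y * X + c - Y) -
        Y * S) := by
  have h := mom_mul_sub_mul (b := 0) (T := 0) (r := 0) (S := S) (G := G) (v := v) h₁ h₂ hk ha (by simp) (by simp)
  simpa only [zero_mul, mul_zero, add_zero, sub_zero] using h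

theorem x_sub_mul_L_π : (x - q) * L α = (x - q) * (Ham 0 1 (α 1) (α 2) (α 3) - Ham 1 1 (α 1) (α 2 + κ) (α 3)) -
    sc κ * (x * (x - 1) * y - q * (q - 1) * p) := by
  rw [x_sub_q_mul_L, H_eq_Ham, H_eq_Ham]; rfl

theorem x_multiplied : Rxπ ((x - 1) * Rs3 0 (α 3 + (α 2 + α 1)) (y * Rs2 0 (α 2 + α 1)
      (Rs1 0 (α 1) ((x - q) * L α)))) =
    ((sc (α 3 + (α 2 + α 1)) - (y + t) * (x - 1)) * (-(t⁻¹ * y) - q) + sc (-(α 2 + α 1)) * (-(t⁻¹ * y) - 1)) *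
      (Ham 0 1 (α 1 - κ) (α 2) (α 3) - sc κ * (x - 1) * y - Ham 1 1 (α 1) (α 2 + κ) (α 3)) -
    sc κ * (((sc (α 3 + (α 2 + α 1)) - (y + t) * (x - 1)) * -(t⁻¹ * y) + sc (-(α 2 + α 1)) * (-(t⁻¹ * y) - 1)) *
        (sc (α 3 + (α 2 + α 1)) - (y + t) * (x - 1) + sc (-(α 2 + α 1))) +
      sc (α 1) * ((sc (α 3 + (α 2 + α 1)) - (y + t) * (x - 1) + sc (-(α 2 + α 1))) * (-(t⁻¹ * y) - 1)) -
      (sc (α 3 + (α 2 + α 1)) - (y + t) * (x - 1)) * (q * (q - 1) * p)) := by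
  have hX : x ≠ 0 := Skew.pos_ne_zero (eps := epsV) 0
  have hX1 : x - 1 ≠ 0 := fun h => pos_ne_sc 0 1 ((sub_eq_zero.1 h).trans (map_one sc).symm)
  have h₁ : y * (x - sc (α 2 + α 1) * y⁻¹) = y * x + sc (-(α 2 + α 1)) := by
    rw [mul_sub_inv (mom_ne_zero 0) (Algebra.commutes _), sub_eq_add_neg, ← map_neg]
  have h₂ : (x - sc (α 2 + α 1) * y⁻¹) * y = x * y + sc (-(α 2 + α 1)) := by
    rw [sub_inv_mul (mom_ne_zero 0), sub_eq_add_neg, ← map_neg]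
  have e₁ : Rs1 0 (α 1) ((x - q) * L α) = (x - q) * Rs1 0 (α 1) (Ham 0 1 (α 1) (α 2) (α 3) - Ham 1 1 (α 1) (α 2 + κ) (α 3)) -
      sc κ * (x * (x - 1) * y + sc (α 1) * (x - 1) - q * (q - 1) * p) := by
    have h : x * (x - 1) * (y + sc (α 1) * x⁻¹) = x * (x - 1) * y + sc (α 1) * (x - 1) := by
      rw [mul_add, ← mul_assoc, ← Algebra.commutes, mul_assoc (sc _), ((Commute.refl x).sub_right (Commute.one_right _)).eq,
        mul_assoc (x - 1) x x⁻¹, mul_inv_cancel₀ hX, mul_one]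
    rw [x_sub_mul_L_π]
    simp only [map_mul, map_sub (Rs1 _ _), map_one, AlgEquiv.commutes, Rs1_pos, Rs1_mom, Fin.reduceEq,
      ↓reduceIte, Fin.isValue]
    rw [h]
  have hZ : (x - 1) * (y + sc (α 3 + (α 2 + α 1)) * (x - 1)⁻¹) = (x - 1) * y + sc (α 3 + (α 2 + α 1)) := by
    rw [mul_add, Algebra.commutes, mul_inv_cancel_left₀ hX1]
  have hZ' : Rxπ ((x - 1) * y + sc (α 3 + (α 2 + α 1))) = sc (α 3 + (α 2 + α 1)) - (y + t) * (x - 1) := by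
    simp only [map_mul, map_sub, map_add, map_neg, map_inv₀, map_one, AlgEquiv.commutes, Rxπ_x, Rxπ_y, Rxπ_q, Rxπ_p]
    simp only [inv_rules]
    simp only [atom_rules]
    try simp only [order_rules]
    try simp only [der_rules, param_rules, smul_eq_mul, mul_zero, add_zero, zero_add, sub_zero, neg_zero,
      zero_smul]
    obtain ⟨⟨hx, hx1, hq, hq1, ht⟩, hxq, he, he'⟩ := denom_ne_zero
    match_scalars <;> (field_simp <;> ring)
  have hG := x_chain
  -- The factor `y` removes the inverse momentum of `s₂`. The Hamiltonian part is an arbitrary `g`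
  -- here; it is carried along unexpanded and evaluated at the end by `x_chain`.
  have e₂ (g : K) : y * Rs2 0 (α 2 + α 1) ((x - q) * g - sc κ * (x * (x - 1) * y + sc (α 1) * (x - 1) - q * (q - 1) * p)) =
      (y * x + sc (-(α 2 + α 1)) - y * q) * Rs2 0 (α 2 + α 1) g - sc κ * ((y * x + sc (-(α 2 + α 1))) * (x * y + sc (-(α 2 + α 1)) - y) +
        sc (α 1) * (y * x + sc (-(α 2 + α 1)) - y) - y * (q * (q - 1) * p)) := by
    rw [← mom_mul_sub_mul' h₁ h₂ (Algebra.commutes _ _).symm (Algebra.commutes _ _).symm]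
    simp only [map_mul, map_sub (Rs2 _ _), map_add (Rs2 _ _), map_one, AlgEquiv.commutes, Rs2_pos,
      Rs2_mom, Fin.reduceEq, ↓reduceIte, Fin.isValue]
  have e₃ (g : K) : (x - 1) * Rs3 0 (α 3 + (α 2 + α 1)) ((y * x + sc (-(α 2 + α 1)) - y * q) * g - sc κ * ((y * x + sc (-(α 2 + α 1))) * (x * y + sc (-(α 2 + α 1)) - y) +
        sc (α 1) * (y * x + sc (-(α 2 + α 1)) - y) - y * (q * (q - 1) * p))) =
      (((x - 1) * y + sc (α 3 + (α 2 + α 1))) * (x - q) + sc (-(α 2 + α 1)) * (x - 1)) * Rs3 0 (α 3 + (α 2 + α 1)) g - sc κ * (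
        (((x - 1) * y + sc (α 3 + (α 2 + α 1))) * x + sc (-(α 2 + α 1)) * (x - 1)) * ((x - 1) * y + sc (α 3 + (α 2 + α 1)) + sc (-(α 2 + α 1))) +
        sc (α 1) * (((x - 1) * y + sc (α 3 + (α 2 + α 1)) + sc (-(α 2 + α 1))) * (x - 1)) - ((x - 1) * y + sc (α 3 + (α 2 + α 1))) * (q * (q - 1) * p)) := by
    rw [← pos_sub_one_mul hZ (Algebra.commutes _ _) (Algebra.commutes _ _) (Algebra.commutes _ _)]
    simp only [map_mul, map_sub (Rs3 _ _), map_add (Rs3 _ _), map_one, AlgEquiv.commutes, Rs3_pos,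
      Rs3_mom, Fin.reduceEq, ↓reduceIte, Fin.isValue]
  rw [e₁, e₂, e₃]
  have hH (u a₁ a₂ a₃ : Par) : Rxπ (Rs3 0 (α 3 + (α 2 + α 1)) (Rs2 0 (α 2 + α 1) (Rs1 0 (α 1) (Ham 1 u a₁ a₂ a₃)))) = Ham 1 u a₁ a₂ a₃ := by
    rw [Rs1_fix (by decide), Rs2_fix (by decide) (by decide), Rs3_fix (by decide)]
    exact fix_Ham Rxπ Rxπ_q Rxπ_p Rxπ_t _ _ _ _
  have hG' : Rxπ (Rs3 0 (α 3 + (α 2 + α 1)) (Rs2 0 (α 2 + α 1) (Rs1 0 (α 1) (Ham 0 1 (α 1) (α 2) (α 3) - Ham 1 1 (α 1) (α 2 + κ) (α 3))))) = Ham 0 1 (α 1 - κ) (α 2) (α 3) - sc κ * (x - 1) * y - Ham 1 1 (α 1) (α 2 + κ) (α 3) := by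
    rw [map_sub, map_sub, map_sub, map_sub, hH, hG]
  simp only [map_mul, map_sub Rxπ, map_add Rxπ, map_one, AlgEquiv.commutes, hG', Rxπ_x, Rxπ_q, Rxπ_p] at hZ' ⊢
  rw [hZ']

theorem q_sub_mul_L_π : (q - x) * L (act (s 1 * s 2 * s 3 * π⁻¹)) = (q - x) * (Ham 0 1 (α 1 - κ) (α 2) (α 3) - Ham 1 1 (α 1 - κ) (α 2 + κ) (α 3)) -
    sc κ * (q * (q - 1) * p - x * (x - 1) * y) := by
  rw [← neg_sub x q, neg_mul, x_sub_q_mul_L, H_eq_Ham, H_eq_Ham, shiftPar_one, shiftPar_two, shiftPar_three,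
    act_π_word]
  simp only [Matrix.cons_val, α_π_word]
  rw [neg_mul, ← neg_sub (x * _ * _), mul_neg]
  abel

theorem q_multiplied : Rqπ ((q - 1) * Rs3 1 (α 3 + (α 2 + α 1)) (p * Rs2 1 (α 2 + α 1)
      (Rs1 1 (α 1 - κ) ((q - x) * L (act (s 1 * s 2 * s 3 * π⁻¹)))))) =
    ((sc (α 3 + (α 2 + α 1)) - (p + t) * (q - 1)) * (-(t⁻¹ * p) - x) + sc (-(α 2 + α 1)) * (-(t⁻¹ * p) - 1)) *
      (Ham 0 1 (α 1 - κ) (α 2) (α 3) - (Ham 1 1 (α 1) (α 2 + κ) (α 3) + sc κ * (q - 1) * p)) -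
    sc κ * (((sc (α 3 + (α 2 + α 1)) - (p + t) * (q - 1)) * -(t⁻¹ * p) + sc (-(α 2 + α 1)) * (-(t⁻¹ * p) - 1)) *
        (sc (α 3 + (α 2 + α 1)) - (p + t) * (q - 1) + sc (-(α 2 + α 1))) +
      sc (α 1 - κ) * ((sc (α 3 + (α 2 + α 1)) - (p + t) * (q - 1) + sc (-(α 2 + α 1))) * (-(t⁻¹ * p) - 1)) -
      (sc (α 3 + (α 2 + α 1)) - (p + t) * (q - 1)) * (x * (x - 1) * y)) := by
  have hX : q ≠ 0 := Skew.pos_ne_zero (eps := epsV) 1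
  have hX1 : q - 1 ≠ 0 := fun h => pos_ne_sc 1 1 ((sub_eq_zero.1 h).trans (map_one sc).symm)
  have h₁ : p * (q - sc (α 2 + α 1) * p⁻¹) = p * q + sc (-(α 2 + α 1)) := by
    rw [mul_sub_inv (mom_ne_zero 1) (Algebra.commutes _), sub_eq_add_neg, ← map_neg]
  have h₂ : (q - sc (α 2 + α 1) * p⁻¹) * p = q * p + sc (-(α 2 + α 1)) := by
    rw [sub_inv_mul (mom_ne_zero 1), sub_eq_add_neg, ← map_neg]
  have e₁ : Rs1 1 (α 1 - κ) ((q - x) * L (act (s 1 * s 2 * s 3 * π⁻¹))) = (q - x) * Rs1 1 (α 1 - κ) (Ham 0 1 (α 1 - κ) (α 2) (α 3) - Ham 1 1 (α 1 - κ) (α 2 + κ) (α 3)) -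
      sc κ * (q * (q - 1) * p + sc (α 1 - κ) * (q - 1) - x * (x - 1) * y) := by
    have h : q * (q - 1) * (p + sc (α 1 - κ) * q⁻¹) = q * (q - 1) * p + sc (α 1 - κ) * (q - 1) := by
      rw [mul_add, ← mul_assoc, ← Algebra.commutes, mul_assoc (sc _), ((Commute.refl q).sub_right (Commute.one_right _)).eq,
        mul_assoc (q - 1) q q⁻¹, mul_inv_cancel₀ hX, mul_one]
    rw [q_sub_mul_L_π]
    simp only [map_mul, map_sub (Rs1 _ _), map_one, AlgEquiv.commutes, Rs1_pos, Rs1_mom, Fin.reduceEq,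
      ↓reduceIte, Fin.isValue]
    rw [h]
  have hZ : (q - 1) * (p + sc (α 3 + (α 2 + α 1)) * (q - 1)⁻¹) = (q - 1) * p + sc (α 3 + (α 2 + α 1)) := by
    rw [mul_add, Algebra.commutes, mul_inv_cancel_left₀ hX1]
  have hZ' : Rqπ ((q - 1) * p + sc (α 3 + (α 2 + α 1))) = sc (α 3 + (α 2 + α 1)) - (p + t) * (q - 1) := by
    simp only [map_mul, map_sub, map_add, map_neg, map_inv₀, map_one, AlgEquiv.commutes, Rqπ_x, Rqπ_y, Rqπ_q, Rqπ_p]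
    simp only [inv_rules]
    simp only [atom_rules]
    try simp only [order_rules]
    try simp only [der_rules, param_rules, smul_eq_mul, mul_zero, add_zero, zero_add, sub_zero, neg_zero,
      zero_smul]
    obtain ⟨⟨hx, hx1, hq, hq1, ht⟩, hxq, he, he'⟩ := denom_ne_zero
    match_scalars <;> (field_simp <;> ring)
  have hG := q_chain
  have e₂ (g : K) : p * Rs2 1 (α 2 + α 1) ((q - x) * g - sc κ * (q * (q - 1) * p + sc (α 1 - κ) * (q - 1) - x * (x - 1) * y)) =
      (p * q + sc (-(α 2 + α 1)) - p * x) * Rs2 1 (α 2 + α 1) g - sc κ * ((p * q + sc (-(α 2 + α 1))) * (q * p + sc (-(α 2 + α 1)) - p) +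
        sc (α 1 - κ) * (p * q + sc (-(α 2 + α 1)) - p) - p * (x * (x - 1) * y)) := by
    rw [← mom_mul_sub_mul' h₁ h₂ (Algebra.commutes _ _).symm (Algebra.commutes _ _).symm]
    simp only [map_mul, map_sub (Rs2 _ _), map_add (Rs2 _ _), map_one, AlgEquiv.commutes, Rs2_pos,
      Rs2_mom, Fin.reduceEq, ↓reduceIte, Fin.isValue]
  have e₃ (g : K) : (q - 1) * Rs3 1 (α 3 + (α 2 + α 1)) ((p * q + sc (-(α 2 + α 1)) - p * x) * g - sc κ * ((p * q + sc (-(α 2 + α 1))) * (q * p + sc (-(α 2 + α 1)) - p) +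
        sc (α 1 - κ) * (p * q + sc (-(α 2 + α 1)) - p) - p * (x * (x - 1) * y))) =
      (((q - 1) * p + sc (α 3 + (α 2 + α 1))) * (q - x) + sc (-(α 2 + α 1)) * (q - 1)) * Rs3 1 (α 3 + (α 2 + α 1)) g - sc κ * (
        (((q - 1) * p + sc (α 3 + (α 2 + α 1))) * q + sc (-(α 2 + α 1)) * (q - 1)) * ((q - 1) * p + sc (α 3 + (α 2 + α 1)) + sc (-(α 2 + α 1))) +
        sc (α 1 - κ) * (((q - 1) * p + sc (α 3 + (α 2 + α 1)) + sc (-(α 2 + α 1))) * (q - 1)) - ((q - 1) * p + sc (α 3 + (α 2 + α 1))) * (x * (x - 1) * y)) := by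
    rw [← pos_sub_one_mul hZ (Algebra.commutes _ _) (Algebra.commutes _ _) (Algebra.commutes _ _)]
    simp only [map_mul, map_sub (Rs3 _ _), map_add (Rs3 _ _), map_one, AlgEquiv.commutes, Rs3_pos,
      Rs3_mom, Fin.reduceEq, ↓reduceIte, Fin.isValue]
  rw [e₁, e₂, e₃]
  have hH (u a₁ a₂ a₃ : Par) : Rqπ (Rs3 1 (α 3 + (α 2 + α 1)) (Rs2 1 (α 2 + α 1) (Rs1 1 (α 1 - κ) (Ham 0 u a₁ a₂ a₃)))) = Ham 0 u a₁ a₂ a₃ := by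
    rw [Rs1_fix (by decide), Rs2_fix (by decide) (by decide), Rs3_fix (by decide)]
    exact fix_Ham Rqπ Rqπ_x Rqπ_y Rqπ_t _ _ _ _
  have hG' : Rqπ (Rs3 1 (α 3 + (α 2 + α 1)) (Rs2 1 (α 2 + α 1) (Rs1 1 (α 1 - κ) (Ham 0 1 (α 1 - κ) (α 2) (α 3) - Ham 1 1 (α 1 - κ) (α 2 + κ) (α 3))))) = Ham 0 1 (α 1 - κ) (α 2) (α 3) - (Ham 1 1 (α 1) (α 2 + κ) (α 3) + sc κ * (q - 1) * p) := by
    rw [map_sub, map_sub, map_sub, map_sub, hH, hG]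
  simp only [map_mul, map_sub Rqπ, map_add Rqπ, map_one, AlgEquiv.commutes, hG', Rqπ_x, Rqπ_q, Rqπ_y] at hZ' ⊢
  rw [hZ']

/-! ### The numerators and multipliers for the translation -/

theorem fr_x : fr.x = xR := rfl
theorem fr_q : fr.q = qR := rfl
theorem fr_t : fr.t = tR := rfl
theorem fr_y : fr.y = y := rfl
theorem fr_p : fr.p = p := rfl

set_option maxHeartbeats 4000000 in
-- The rotation turns the cleared momentum into a constant minus `(y + t)(x - 1)`, which is why the
-- shifted frame is the natural one. The inverse of `t` from the rotation stays in front.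
theorem x_multiplied_eq_num : Rxπ ((x - 1) * Rs3 0 (α 3 + (α 2 + α 1)) (y * Rs2 0 (α 2 + α 1)
      (Rs1 0 (α 1) ((x - q) * L α)))) = tR⁻¹ • fr.shifted.num (cR ε₁) (cR ε₂) (cR (α 1 - ε₁))
        (cR (α 1 + α 2)) (cR (α 1 + α 2 + α 3)) := by
  rw [x_multiplied]
  simp only [Frame.num, Frame.quad, Frame.corr, Frame.dham, Frame.ham, Frame.shifted_x, Frame.shifted_q, Frame.shifted_t, Frame.shifted_y, Frame.shifted_p, Frame.swap_x, Frame.swap_q, Frame.swap_t, Frame.swap_y, Frame.swap_p, fr_x, fr_q, fr_t, fr_y, fr_p, Ham_zero, Ham_one, κ]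
  simp only [inv_rules]
  simp only [atom_rules]
  try simp only [order_rules]
  try simp only [der_rules, param_rules, smul_eq_mul, mul_zero, add_zero, zero_add, sub_zero, neg_zero,
    zero_smul]
  obtain ⟨⟨hx, hx1, hq, hq1, ht⟩, hxq, he, he'⟩ := denom_ne_zero
  match_scalars <;> (field_simp <;> ring)

set_option maxHeartbeats 4000000 in
theorem q_multiplied_eq_num : Rqπ ((q - 1) * Rs3 1 (α 3 + (α 2 + α 1)) (p * Rs2 1 (α 2 + α 1)
      (Rs1 1 (α 1 - κ) ((q - x) * L (act (s 1 * s 2 * s 3 * π⁻¹)))))) =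
    tR⁻¹ • fr.shifted.num' (cR ε₁) (cR ε₂) (cR (α 1 - ε₁)) (cR (α 1 + α 2)) (cR (α 1 + α 2 + α 3)) := by
  rw [q_multiplied]
  simp only [Frame.num', Frame.quad, Frame.corr, Frame.dham, Frame.ham, Frame.shifted_x, Frame.shifted_q, Frame.shifted_t, Frame.shifted_y, Frame.shifted_p, Frame.swap_x, Frame.swap_q, Frame.swap_t, Frame.swap_y, Frame.swap_p, fr_x, fr_q, fr_t, fr_y, fr_p, Ham_zero, Ham_one, κ]
  simp only [inv_rules]
  simp only [atom_rules]
  try simp only [order_rules]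
  try simp only [der_rules, param_rules, smul_eq_mul, mul_zero, add_zero, zero_add, sub_zero, neg_zero,
    zero_smul]
  obtain ⟨⟨hx, hx1, hq, hq1, ht⟩, hxq, he, he'⟩ := denom_ne_zero
  match_scalars <;> (field_simp <;> ring)

/-- The weights of the first order factor of the multipliers. -/
def w₁ : RatFun := fr.shifted.wt₁ (cR ε₁) (cR ε₂) (cR (α 1 + α 2)) (cR (α 1 + α 2 + α 3))
def w₂ : RatFun := fr.shifted.wt₂ (cR ε₁) (cR ε₂) (cR (α 1 + α 2)) (cR (α 1 + α 2 + α 3))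
def w₀ : RatFun := fr.shifted.wt₀ (cR ε₁) (cR ε₂) (cR (α 1 + α 2)) (cR (α 1 + α 2 + α 3))

/-- As a polynomial in `(x - 1)(q - 1) t` the weight has degree two with leading coefficient `ε₁
ε₂`. It has to be invertible, because the multipliers are normalized by it. -/
theorem w₁_ne_zero : w₁ ≠ 0 := by
  intro h
  have e : w₁ = cR ε₁ * cR ε₂ * ((xR - 1) * (qR - 1) * tR * ((xR - 1) * (qR - 1) * tR)) +
      cR (ε₁ * ε₂ * (2 * (α 1 + α 2) - ε₁ - ε₂) + ε₁ * ε₁ * (α 1 + α 2 + α 3) + ε₂ * ε₂ * (α 1 + α 2 + α 3) +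
        (ε₁ - ε₂) * (ε₂ * (α 1 + α 2 + α 3) + ε₁ * ε₂ - ε₁ * (α 1 + α 2 + α 3))) * ((xR - 1) * (qR - 1) * tR) +
      cR ((ε₂ * (α 1 + α 2) - ε₁ * ε₂ + ε₁ * (α 1 + α 2 + α 3)) * (ε₁ * (α 1 + α 2) - ε₁ * ε₂ + ε₂ * (α 1 + α 2 + α 3))) := by
    simp only [w₁, Frame.wt₁, Frame.quadr, Frame.lin, Frame.shifted_x, Frame.shifted_q, Frame.shifted_t, Frame.shifted_y, Frame.shifted_p, Frame.swap_x, Frame.swap_q, Frame.swap_t, Frame.swap_y, Frame.swap_p, fr_x, fr_q, fr_t, fr_y, fr_p, param_rules]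
    ring
  -- The second derivative along `y` retains only the leading term.
  have h₂ : der 0 (der 0 w₁) = 2 * (cR ε₁ * cR ε₂) * (cR ε₁ * ((qR - 1) * tR)) ^ 2 := by
    rw [e]
    simp only [der_rules, smul_eq_mul, mul_zero, add_zero, zero_add, sub_zero]
    ring
  rw [h, map_zero, map_zero] at h₂
  exact mul_ne_zero (mul_ne_zero two_ne_zero (mul_ne_zero cR_ε₁_ne cR_ε₂_ne))
    (pow_ne_zero 2 (mul_ne_zero cR_ε₁_ne (mul_ne_zero q_sub_one_ne t_ne))) h₂.symm

/-- The linear coefficient of the quadratic factor of `mulNum`. -/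
def mA : RatFun := 2 * (qR - 1) * tR + (cR (ε₂ - α 3) + (xR - 1) * (qR - 1) * tR)
/-- The constant coefficient of the quadratic factor of `mulNum`. -/
def nA : RatFun := (qR - 1) * tR ^ 2 + (cR (ε₂ - α 3) + (xR - 1) * (qR - 1) * tR) * tR +
  (xR - 1) * tR * cR (ε₂ - (α 1 + α 2 + α 3))
/-- The linear coefficient of the quadratic factor of `mulNum'`. -/
def mB : RatFun := 2 * (xR - 1) * tR + (cR (ε₁ - α 3) + (xR - 1) * (qR - 1) * tR)
/-- The constant coefficient of the quadratic factor of `mulNum'`. -/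
def nB : RatFun := (xR - 1) * tR ^ 2 + (cR (ε₁ - α 3) + (xR - 1) * (qR - 1) * tR) * tR +
  (qR - 1) * tR * cR (ε₁ - (α 1 + α 2 + α 3))

/-- The coefficients of the multiplier on the left hand side. -/
def coeffA : ℕ → ℕ → RatFun
  | 0, 3 => (qR - 1) ^ 2 * w₂
  | 0, 2 => (xR - 1) * w₁ * tR * (qR - 1) + (qR - 1) * w₂ * (mA + cR ε₂) +
      ((qR - 1) * w₂ * tR + w₀) * (qR - 1)
  | 1, 0 => (xR - 1) * w₁ * nA
  | 0, 1 => (xR - 1) * w₁ * (tR * mA + cR ε₁ * (qR - 1) * tR) +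
      (qR - 1) * w₂ * (nA + (2 * tR * cR ε₂ + cR ε₂ * (xR - 1) * tR)) +
      ((qR - 1) * w₂ * tR + w₀) * mA + (xR - 1) * w₁ * (cR κ * (qR - 1) * tR)
  | 0, 0 => (xR - 1) * w₁ * (tR * nA + (cR ε₁ * (qR - 1) * tR ^ 2 + cR ε₁ * tR * cR (ε₂ - (α 1 + α 2 + α 3)))) +
      (qR - 1) * w₂ * (cR ε₂ * tR ^ 2 + cR ε₂ * (xR - 1) * tR ^ 2) +
      ((qR - 1) * w₂ * tR + w₀) * nA + (xR - 1) * w₁ * (cR κ * (qR - 1) * tR ^ 2 - tR *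
        fr.shifted.lin (cR ε₁) (cR ε₂) (cR (α 1 + α 2)) (cR (α 1 + α 2 + α 3)))
  -- The coefficients of `y p²` and `y p` are prescribed in `opA`, so the remaining entries are
  -- never read.
  | _, _ => 0

/-- The coefficients of the multiplier on the right hand side. -/
def coeffB : ℕ → ℕ → RatFun
  | 2, 1 => (qR - 1) * w₂ * (xR - 1)
  | 2, 0 => (xR - 1) * w₁ * (mB + cR ε₁) + ((xR - 1) * w₁ * tR + (qR - 1) * w₂ * tR + w₀) * (xR - 1)
  | 1, 1 => (qR - 1) * w₂ * mB
  | 1, 0 => (xR - 1) * w₁ * (nB + (2 * tR * cR ε₁ + cR ε₁ * (qR - 1) * tR)) +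
      ((xR - 1) * w₁ * tR + (qR - 1) * w₂ * tR + w₀) * mB + (qR - 1) * w₂ * (cR ε₂ * (xR - 1) * tR) -
      (qR - 1) * w₂ * (cR κ * (xR - 1) * tR)
  | 0, 1 => (qR - 1) * w₂ * nB
  | 0, 0 => (xR - 1) * w₁ * (cR ε₁ * tR ^ 2 + cR ε₁ * (qR - 1) * tR ^ 2) +
      ((xR - 1) * w₁ * tR + (qR - 1) * w₂ * tR + w₀) * nB +
      (qR - 1) * w₂ * (cR ε₂ * (xR - 1) * tR ^ 2 + cR ε₂ * tR * cR (ε₁ - (α 1 + α 2 + α 3))) -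
      (qR - 1) * w₂ * (cR κ * (xR - 1) * tR ^ 2 + tR * fr.shifted.swap.lin (cR ε₂) (cR ε₁) (cR (α 1 + α 2))
        (cR (α 1 + α 2 + α 3)))
  | _, _ => 0

/-- The normalization of the multipliers. -/
def nrm : RatFun := -((xR - 1) ^ 2 * w₁)⁻¹

theorem toK_eq (r : RatFun) : toK r = r • (1 : K) := (mul_one _).symm

set_option maxHeartbeats 4000000 in
-- The coefficient of `y p²` in `mulNum` is `(x - 1)(q - 1) w₁`; multiplication by `nrm` gives the
-- prescribed `-(q - 1)/(x - 1)`. The opposite factor `-nrm` makes the other multiplier monic in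
-- `y³`.
theorem opA_coeffA : opA (fun i j => toK (nrm * coeffA i j)) = nrm • fr.shifted.mulNum (cR ε₁) (cR ε₂) (cR (α 1 + α 2)) (cR (α 1 + α 2 + α 3)) := by
  rw [Frame.mulNum]
  -- The weights stand to the left of all momenta and are never differentiated, so they can be
  -- treated as atoms.
  change _ = nrm • ((((fr.shifted.x * w₁) • fr.shifted.y + (fr.shifted.q * w₂) • fr.shifted.p + w₀ • (1 : K)) * _) +
    (fr.shifted.x * w₁) • _)
  simp only [opA, coeffA]
  generalize fr.shifted.lin (cR ε₁) (cR ε₂) (cR (α 1 + α 2)) (cR (α 1 + α 2 + α 3)) = l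
  have hw := w₁_ne_zero
  simp only [Frame.quad, Frame.shifted_x, Frame.shifted_q, Frame.shifted_t, Frame.shifted_y, Frame.shifted_p, Frame.swap_x, Frame.swap_q, Frame.swap_t, Frame.swap_y, Frame.swap_p, fr_x, fr_q, fr_t, fr_y, fr_p, mA, nA, κ, nrm, toK_eq]
  generalize w₁ = w₁ at *
  generalize w₂ = w₂ at *
  generalize w₀ = w₀ at *
  simp only [pow_three p, pow_two p]
  simp only [inv_rules]
  simp only [atom_rules]
  try simp only [order_rules]
  try simp only [der_rules, param_rules, smul_eq_mul, mul_zero, add_zero, zero_add, sub_zero, neg_zero,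
    zero_smul]
  obtain ⟨⟨hx, hx1, hq, hq1, ht⟩, hxq, he, he'⟩ := denom_ne_zero
  match_scalars <;> (field_simp <;> ring)

set_option maxHeartbeats 4000000 in
theorem opB_coeffB : opB (fun i j => toK (-nrm * coeffB i j)) = (-nrm) • fr.shifted.mulNum' (cR ε₁) (cR ε₂) (cR (α 1 + α 2)) (cR (α 1 + α 2 + α 3)) := by
  rw [Frame.mulNum']
  change _ = (-nrm) • ((((fr.shifted.x * w₁) • fr.shifted.y + (fr.shifted.q * w₂) • fr.shifted.p + w₀ • (1 : K)) * _) -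
    (fr.shifted.q * w₂) • _)
  simp only [opB, coeffB]
  generalize fr.shifted.swap.lin _ _ _ _ = l
  have hw := w₁_ne_zero
  simp only [Frame.quad, Frame.shifted_x, Frame.shifted_q, Frame.shifted_t, Frame.shifted_y, Frame.shifted_p, Frame.swap_x, Frame.swap_q, Frame.swap_t, Frame.swap_y, Frame.swap_p, fr_x, fr_q, fr_t, fr_y, fr_p, mB, nB, κ, nrm, toK_eq]
  generalize w₁ = w₁ at *
  generalize w₂ = w₂ at *
  generalize w₀ = w₀ at *
  simp only [pow_three y, pow_two y]
  try simp only [order_rules]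
  try simp only [der_rules, param_rules, smul_eq_mul, mul_zero, add_zero, zero_add, sub_zero, neg_zero,
    zero_smul]
  obtain ⟨⟨hx, hx1, hq, hq1, ht⟩, hxq, he, he'⟩ := denom_ne_zero
  match_scalars <;> (field_simp <;> ring)

/-- The multiplier of the left hand side of the identity for `Tπ`. -/
def multiplierA : K := opA fun i j => toK (nrm * coeffA i j)
/-- The multiplier of the right hand side of the identity for `Tπ`. -/
def multiplierB : K := opB fun i j => toK (-nrm * coeffB i j)

/-- The multipliers contain no `d`, and `t` commutes with everything else; the factor `t⁻¹` can
therefore be moved in front of them. -/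
theorem commute_of_t {a : ℕ → ℕ → RatFun} {f : (ℕ → ℕ → K) → K} (hf : f = opA ∨ f = opB) :
    Commute (toK tR⁻¹) (f fun i j => toK (a i j)) := by
  have hr (r : RatFun) : toK r ∈ Subring.centralizer {toK tR⁻¹} :=
    Subring.mem_centralizer_iff.2 fun _ h => by
      rw [Set.mem_singleton_iff.1 h]; exact ratFun_comm (toK_mem _) (toK_mem _)
  have hm (i : Fin 3) (hi : i ≠ 2) : Skew.mom epsV i ∈ Subring.centralizer {toK tR⁻¹} :=
    Subring.mem_centralizer_iff.2 fun _ h => by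
      rw [Set.mem_singleton_iff.1 h, map_inv₀]
      exact (show Commute t _ from (Skew.cross_ne hi).eq.symm).inv_left₀
  have hy := hm 0 (by decide)
  have hp := hm 1 (by decide)
  have h₁ : (sc (α 3 - ε₂) + t * (1 - q) * (1 + x)) * (x - 1)⁻¹ =
      toK ((cR (α 3 - ε₂) + tR * (1 - qR) * (1 + xR)) * (xR - 1)⁻¹) := by
    simp only [map_mul, map_add, map_sub, map_one, map_inv₀, toK_cR, toK_xR, toK_qR, toK_tR]
  have h₂ : (q - 1) * (x - 1)⁻¹ = toK ((qR - 1) * (xR - 1)⁻¹) := by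
    simp only [map_mul, map_add, map_sub, map_one, map_inv₀, toK_cR, toK_xR, toK_qR, toK_tR]
  suffices h : (f fun i j => toK (a i j)) ∈ Subring.centralizer {toK tR⁻¹} from
    Subring.mem_centralizer_iff.1 h _ rfl
  rcases hf with rfl | rfl
  · rw [opA, h₁, h₂]
    repeat' first | exact hr _ | exact hy | exact hp | with_reducible apply Subring.add_mem | with_reducible apply Subring.sub_mem |
      with_reducible apply Subring.mul_mem | with_reducible apply Subring.pow_mem
  · rw [opB]
    repeat' first | exact hr _ | exact hy | exact hp | with_reducible apply Subring.add_mem | with_reducible apply Subring.sub_mem |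
      with_reducible apply Subring.mul_mem | with_reducible apply Subring.pow_mem

theorem cst_cR (c : Par) : fr.shifted.Cst (cR c) := ⟨der_cR 0 c, der_cR 1 c⟩

theorem π_identity : multiplierA * Rxπ ((x - 1) * Rs3 0 ((s 1 * s 2) (α 3))
      (y * Rs2 0 (s 1 (α 2)) (Rs1 0 (α 1) ((x - q) * L α)))) =
    multiplierB * Rqπ ((q - 1) * Rs3 1 ((s 1 * s 2) (α 3))
      (p * Rs2 1 (s 1 (α 2)) (Rs1 1 (α 1 - κ)
        ((x - q) * L (act (s 1 * s 2 * s 3 * π⁻¹)))))) := by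
  -- The sign from `x - q = -(q - x)` is absorbed by the opposite normalizations of the two
  -- multipliers.
  have h : (x - q) * L (act (s 1 * s 2 * s 3 * π⁻¹)) = -((q - x) * L (act (s 1 * s 2 * s 3 * π⁻¹))) := by
    rw [← neg_mul, neg_sub]
  rw [s_one_s_two_α_three, s_one_α_two, h]
  simp only [map_neg, mul_neg]
  rw [x_multiplied_eq_num, q_multiplied_eq_num, ratFun_smul_def, ratFun_smul_def, ← mul_assoc,
    ← mul_assoc, multiplierA, multiplierB, ← (commute_of_t (.inl rfl)).eq, ← (commute_of_t (.inr rfl)).eq, mul_assoc,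
    mul_assoc, opA_coeffA, opB_coeffB, smul_mul_assoc, smul_mul_assoc, neg_smul, mul_neg, neg_neg,
    fr.shifted.mulNum_num (cst_cR ε₁) (cst_cR ε₂) (cst_cR _) (cst_cR _) (cst_cR _) rfl rfl]

/-- The commutator with `x` lowers the degree in `y` by one. Three of them kill every term except
`y³`, which yields `6 ε₁³`. -/
theorem opB_ne_zero (b : ℕ → ℕ → RatFun) : (opB fun i j => toK (b i j)) ≠ 0 := by
  have key {u v : K} (h : u * x - x * u = v) (hv : v ≠ 0) : u ≠ 0 := by
    rintro rfl
    rw [zero_mul, mul_zero, sub_zero] at h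
    exact hv h.symm
  have h₁ : (opB fun i j => toK (b i j)) * x - x * (opB fun i j => toK (b i j)) =
      (3 * cR ε₁) • (y * y) + (2 * cR ε₁ * b 2 1) • (y * p) + (2 * cR ε₁ * b 2 0) • y +
        (cR ε₁ * b 1 1) • p + (cR ε₁ * b 1 0) • (1 : K) := by
    simp only [opB, toK_eq, pow_three y, pow_two y]
    simp only [atom_rules]
    simp only [order_rules]
    simp only [der_rules]
    match_scalars <;> ring
  have h₂ : ((3 * cR ε₁) • (y * y) + (2 * cR ε₁ * b 2 1) • (y * p) + (2 * cR ε₁ * b 2 0) • y +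
        (cR ε₁ * b 1 1) • p + (cR ε₁ * b 1 0) • (1 : K)) * x - x * ((3 * cR ε₁) • (y * y) +
        (2 * cR ε₁ * b 2 1) • (y * p) + (2 * cR ε₁ * b 2 0) • y +
        (cR ε₁ * b 1 1) • p + (cR ε₁ * b 1 0) • (1 : K)) = (6 * cR ε₁ * cR ε₁) • y +
        (2 * cR ε₁ * cR ε₁ * b 2 1) • p + (2 * cR ε₁ * cR ε₁ * b 2 0) • (1 : K) := by
    simp only [atom_rules]
    simp only [order_rules]
    simp only [der_rules]
    match_scalars <;> ring
  refine key h₁ (key h₂ (ne_zero_of_commutator x (r := 6 * cR ε₁ * cR ε₁ * cR ε₁) ?_ ?_))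
  · simp only [atom_rules]
    simp only [order_rules]
    simp only [der_rules]
    match_scalars <;> ring
  · have h := cR_ε₁_ne
    exact mul_ne_zero (mul_ne_zero (mul_ne_zero (by norm_num) h) h) h

/-- The multiplier is built from images under `Tπq`, so applying its inverse `Θπ` returns the
operators of `π_identity`; the leading factor on the right side there is invertible and cancels. -/
theorem Tπ_L : lπ multiplierA multiplierB * Tπ ((x - q) * L α) = (x - q) * L (act (s 1 * s 2 * s 3 * π⁻¹)) := by
  have hq : q - 1 ≠ 0 := fun h => pos_ne_sc 1 1 ((sub_eq_zero.1 h).trans (map_one sc).symm)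
  have h₀ : multiplierB * Rqπ ((q - 1) * Rs3 1 ((s 1 * s 2) (α 3)) p) ≠ 0 :=
    mul_ne_zero (opB_ne_zero _) ((map_ne_zero Rqπ).2 (mul_ne_zero hq ((map_ne_zero _).2 (mom_ne_zero 1))))
  have hΘ (z : K) : Θπ (Tπq z) = z := by
    rw [← AlgEquiv.mul_apply, mul_eq_one_comm.1 Tπq_mul_Θπ, AlgEquiv.one_apply]
  have hX : Θπ (Tπ ((x - q) * L α)) = Rxπ (Rs3 0 ((s 1 * s 2) (α 3)) (Rs2 0 (s 1 (α 2))
      (Rs1 0 (α 1) ((x - q) * L α)))) := by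
    rw [← AlgEquiv.mul_apply, Θπ_mul_Tπ, Xπ, mul_mul_apply]
  have h := π_identity
  apply Θπ.injective
  rw [map_mul Θπ, lπ, map_mul Θπ, map_inv₀, hΘ, hΘ, hX]
  rw [map_mul (Rs3 0 _), ← mul_assoc (x - 1), map_mul Rxπ (_ * _), ← mul_assoc multiplierA,
    map_mul (Rs3 1 _), ← mul_assoc (q - 1), map_mul Rqπ (_ * _), ← mul_assoc multiplierB] at h
  rw [mul_assoc, h, inv_mul_cancel_left₀ h₀, Θπ, mul_mul_apply]

theorem exists_multipliers : ∃ a b : ℕ → ℕ → K, (∀ i j, a i j ∈ ratFun ∧ b i j ∈ ratFun) ∧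
    lπ (opA a) (opB b) * Tπ ((x - q) * L α) = (x - q) * L (act (s 1 * s 2 * s 3 * π⁻¹)) ∧
    opA a * Rxπ ((x - 1) * Rs3 0 ((s 1 * s 2) (α 3))
        (y * Rs2 0 (s 1 (α 2)) (Rs1 0 (α 1) ((x - q) * L α)))) =
      opB b * Rqπ ((q - 1) * Rs3 1 ((s 1 * s 2) (α 3))
        (p * Rs2 1 (s 1 (α 2)) (Rs1 1 (α 1 - κ)
          ((x - q) * L (act (s 1 * s 2 * s 3 * π⁻¹)))))) :=
  ⟨_, _, fun _ _ => ⟨toK_mem _, toK_mem _⟩, Tπ_L, π_identity⟩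

end QW

end

theorem mainTheorem2 :
    -- the automorphisms attached to `s₁`, `s₃`, `σ`
    (R1 (L α) = L (act (s 1)) ∧
      R1 (B α) = B (act (s 1)) + sc (κ * α 1) * (sc (α 3) + t)) ∧
    (R3 (L α) = L (act (s 3)) ∧
      R3 (B α) = B (act (s 3)) + sc (κ * α 1 * α 3)) ∧
    (Rσ (L α) = L (act σ) ∧
      Rσ (B α) = B (act σ) - sc (κ * α 1) * t) ∧
    -- the square of `R_π = R^x_π R^q_π`, and the square of `R^x_π (R^q_π)⁻¹`
    ((Rπ ^ 2) ((x - q) * L α) = (q - x) * L (act (π ^ 2)) ∧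
      (Rπ ^ 2) (B α) = B (act (π ^ 2)) - sc (κ * (α 2 + α 3 - ε₂)) * t - sc (2 * κ * ε₁ * ε₂)) ∧
    (((Rxπ * Rqπ⁻¹) ^ 2) ((x - q) * L α) = (q - x) * L (act (π ^ 2)) ∧
      ((Rxπ * Rqπ⁻¹) ^ 2) (B α) = B (act (π ^ 2)) - sc (κ * (α 2 + α 3 + κ)) * t) ∧
    -- the automorphism attached to `σ s₁ s₃ s₂`
    (lσ * Tσ ((x - q) * L α) = (x - q) * L (act (σ * s 1 * s 3 * s 2)) ∧
      ((x - q) * p - sc (α 2 + κ)) * y *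
          Rs2 0 (-α 2 - κ) (Rs1 0 (α 1) (Rs3 0 (α 3) (adExpX ((x - q) * L α)))) =
        ((x - q) * y + sc (α 2 + κ)) * p *
          Rs2 1 (-α 2 - κ) (Rs1 1 (-αbar 1) (Rs3 1 (-αbar 3)
            (negT (adExpQ ((x - q) * L (act (σ * s 1 * s 3 * s 2))))))) ∧
      Tσ (B α) = B (act (σ * s 1 * s 3 * s 2)) + sc (κ * (α 2 + κ)) * (sc (α 0) + t)) ∧
    -- the automorphism attached to `s₁ s₂ s₃ π⁻¹`
    ((∃ a b : ℕ → ℕ → K, (∀ i j, a i j ∈ ratFun ∧ b i j ∈ ratFun) ∧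
        lπ (opA a) (opB b) * Tπ ((x - q) * L α) = (x - q) * L (act (s 1 * s 2 * s 3 * π⁻¹)) ∧
        opA a * Rxπ ((x - 1) * Rs3 0 ((s 1 * s 2) (α 3))
            (y * Rs2 0 (s 1 (α 2)) (Rs1 0 (α 1) ((x - q) * L α)))) =
          opB b * Rqπ ((q - 1) * Rs3 1 ((s 1 * s 2) (α 3))
            (p * Rs2 1 (s 1 (α 2)) (Rs1 1 (α 1 - κ)
              ((x - q) * L (act (s 1 * s 2 * s 3 * π⁻¹))))))) ∧
      Tπ (B α) = B (act (s 1 * s 2 * s 3 * π⁻¹))) ∧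
    -- the automorphism `S`
    (y * p * RS ((x - q) * L α) * D (α 2) =
        ((x - q) * y * p + sc (α 2 + κ - ε₂) * y + sc (ε₁ - α 2) * p) *
          (D (α 2) - sc ((α 2 + ε₁) * (ε₁ + ε₂)) * ((x - q) ^ 2)⁻¹) * L αS ∧
      S (B α + sc (κ * (α 2 + ε₁)) * (sc (α 1 + α 2 + α 3 + ε₁) + t)) =
        B αS - (D (α 2))⁻¹ * sc (2 * (α 2 + ε₁) * ε₁ * ε₂) * ((x - q) ^ 2)⁻¹ * L αS) := by
  exact ⟨⟨R1_L, R1_B⟩, ⟨R3_L, R3_B⟩, ⟨Rσ_L, Rσ_B⟩, ⟨Rπ_sq_L, Rπ_sq_B⟩, ⟨Rπ_inv_sq_L, Rπ_inv_sq_B⟩,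
    ⟨Tσ_L, σ_identity, Tσ_B⟩, ⟨exists_multipliers, Tπ_B⟩, S_L, S_B⟩
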